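/- **Notation.** $\mathbb{R}_+=(0,\infty)$; $q\in[1,+\infty]$; $L^q=L^q(\mathbb{R}^n)$ (complex valued); $W^{q,\infty}=\{v\in L^q:\ \partial_x^\beta v\in L^q\ \text{for all multi-indices }\beta\}$ (distributional derivatives) with the seminorms $\|\partial_x^\beta v\|_q$. Put $\mathcal{X}_q=C^\infty(\mathbb{R}_+,W^{q,\infty})\cap C([0,\infty),L^q)$ with the seminorms $\sup_{t\in K}\|\partial_t^j\partial_x^\beta u(t)\|_q$ ($j\in\mathbb{N}_0$, $\beta\in\mathbb{N}_0^n$, $K\subset\mathbb{R}_+$ compact) and $\sup_{t\in[0,b]}\|u(t)\|_q$ ($b\in\mathbb{N}$). The space $C^\infty(\mathbb{R}_+,M_n(\mathbb{R}))\cap C([0,\infty),M_n(\mathbb{R}))$ carries the analogous seminorms of the matrix entries. An asymptotic scale $\mho=\{\varsigma_\ell\}_{\ell\in\Upsilon}$ consists of continuous functions $\varsigma_\ell:(0,1)\to\mathbb{R}_+$, nondecreasing near $0$, indexed by a non-empty directed set $(\Upsilon,\prec)$ ($\prec$ a strict order), such that $\ell\prec\jmath$ implies $\varsigma_\ell=o(\varsigma_\jmath)$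 as $\epsilon\to0$, and for all $\ell,\jmath$ there is $\hbar$ with $\varsigma_\hbar=o(\varsigma_\ell\varsigma_\jmath)$. For a locally convex space $\mathcal{X}$ with seminorms $\|\cdot\|_\alpha$, a net $\{h_\epsilon\}_{\epsilon\in(0,1)}\subset\mathcal{X}$ is moderate if for every $\alpha$ there is $\ell$ with $\varsigma_\ell(\epsilon)\|h_\epsilon\|_\alpha=o(1)$, and negligible if $\|h_\epsilon\|_\alpha=o(\varsigma_\ell(\epsilon))$ for all $\alpha$ and $\ell$; $\mathcal{G}^\mho(\mathcal{X})$ is the space of moderate nets modulo negligible nets, and for $\Gamma\subset\mathcal X$ an element belongs to $\mathcal{G}^\mho(\Gamma)$ if it is represented by a moderate net with values in $\Gamma$. For $\mathcal X=L^q,\mathcal X_q$, $u\ge0$ means that $u\in\mathcal G^\mho(\mathcal X_+)$, where $\mathcal X_+$ is the cone of non-negative elements. **Diffusivity.** A diffusivity net is a net $\{a_\epsilon\}$ such that $a_\epsilon(t)$ is symmetric positive definite for $t>0$ and invertible for $t\ge0$, and both $\{a_\epsilon\}$ and $\{a_\epsilon^{-1}\}$ are moderate nets in $C^\infty(\mathbb{R}_+,M_n(\mathbb{R}))\cap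 C([0,\infty),M_n(\mathbb{R}))$. Let $a\in\mathcal{G}^\mho(C^\infty(\mathbb{R}_+,\mathrm{GL}(n))\cap C([0,\infty),\mathrm{GL}(n)))$ be a generalised diffusivity, i.e. a class represented by a diffusivity net. On $\mathcal{G}^\mho(C^\infty(\mathbb{R}_+,W^{q,\infty}))$ put $\partial_t[u_\epsilon]=[\partial_tu_\epsilon]$ and $\mathcal{L}_t[u_\epsilon]=[\sum_{i,j}(a_\epsilon)_{ij}(t)\,\partial^2_{x_ix_j}u_\epsilon]$; on $\mathcal G^\mho(\mathcal X_q)$ put $[u_\epsilon]|_0=[u_\epsilon(0)]\in\mathcal{G}^\mho(L^q)$. For a diffusivity net and $A_\epsilon(t)=\int_0^ta_\epsilon(s)\,ds$, let $\mathrm{W}^\epsilon_{t,t}$ be the identity and, for $0\le s<t$, let $\mathrm{W}^\epsilon_{s,t}$ be the convolution with $$\mathcal{W}_\epsilon(x;s,t)=\frac{1}{\sqrt{(4\pi)^n\det[A_\epsilon(t)-A_\epsilon(s)]}}\,e^{-\frac14\langle x,[A_\epsilon(t)-A_\epsilon(s)]^{-1}x\rangle}.$$ **Theorem.** Let $u_0\in\mathcal{G}^\mho(L^q)$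 and $f\in\mathcal{G}^\mho(\mathcal{X}_q)$, $q\in[1,+\infty]$; if $q=\infty$, assume that $u_0$ is represented by a moderate net of bounded uniformly continuous functions. Then there is a unique $$u=\mathrm{W}_{0,\natural}u_0+\int_0^\natural\mathrm{W}_{\sharp,\natural}f\in\mathcal{G}^\mho(\mathcal{X}_q)$$ given by the Duhamel formula, in the following sense: for every diffusivity net $\{a_\epsilon\}$ representing $a$, every net $\{u_{0,\epsilon}\}$ representing $u_0$ (consisting of bounded uniformly continuous functions if $q=\infty$) and every net $\{f_\epsilon\}$ representing $f$, the paths $$u_\epsilon(t)=\mathrm{W}^\epsilon_{0,t}u_{0,\epsilon}+\int_0^t\mathrm{W}^\epsilon_{s,t}f_\epsilon(s)\,ds,\qquad t\ge0,$$ form a moderate net in $\mathcal{X}_q$ that represents $u$. This $u$ solves the Cauchy problem $$\partial_tu-\mathcal{L}_tu=f\ \text{ in }\mathcal{G}^\mho(C^\infty(\mathbb{R}_+,W^{q,\infty})),\qquad u|_0=u_0 .$$ If $u_0\ge0$ and $f\ge0$, then $u\ge0$. -/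

import Mathlib

open Set Filter Topology MeasureTheory Asymptotics
open scoped ENNReal NNReal ContDiff SchwartzMap LineDeriv Convolution

noncomputable section

/-! ## Asymptotic scales and Colombeau extensions of locally convex spaces -/

/-- The parameter interval `(0, 1)` of nets. -/
abbrev NetParam : Type := Ioo (0 : ℝ) 1

/-- The filter `ε → 0` on the parameter interval. -/
def netLim : Filter NetParam := comap (Subtype.val : NetParam → ℝ) (𝓝 0)

/-- An asymptotic scale: positive continuous functions `ς ℓ` on `(0, 1)`, indexed by a non-empty
directed set, each nondecreasing near `0`, with the two little-o conditions. -/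
structure AsymptoticScale (Υ : Type*) [PartialOrder Υ] [IsDirectedOrder Υ] [Nonempty Υ] where
  toFun : Υ → NetParam → ℝ
  continuous' : ∀ ℓ, Continuous (toFun ℓ)
  pos' : ∀ ℓ ε, 0 < toFun ℓ ε
  increasing' : ∀ ℓ, ∃ δ : ℝ, 0 < δ ∧ MonotoneOn (toFun ℓ) {ε | (ε : ℝ) < δ}
  isLittleO_of_lt' : ∀ ℓ j, ℓ < j → toFun ℓ =o[netLim] toFun j
  exists_isLittleO_mul' : ∀ ℓ j, ∃ k, toFun k =o[netLim] fun ε => toFun ℓ ε * toFun j ε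

namespace AsymptoticScale

variable {Υ : Type*} [PartialOrder Υ] [IsDirectedOrder Υ] [Nonempty Υ] (ς : AsymptoticScale Υ)

/-- Scale functions are bounded near `0`. -/
theorem isBigO_one (ℓ : Υ) : ς.toFun ℓ =O[netLim] (fun _ => (1 : ℝ)) := by
  obtain ⟨δ, hδ, hm⟩ := ς.increasing' ℓ
  have hpos : 0 < min (δ / 2) (1 / 2) := by positivity
  let ε₀ : NetParam := ⟨min (δ / 2) (1 / 2), hpos,
    lt_of_le_of_lt (min_le_right _ _) (by norm_num)⟩
  have h₀ : (ε₀ : ℝ) < δ := lt_of_le_of_lt (min_le_left _ _) (by linarith)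
  refine IsBigO.of_bound (ς.toFun ℓ ε₀) ?_
  have : ∀ᶠ ε : NetParam in netLim, (ε : ℝ) < min (δ / 2) (1 / 2) :=
    tendsto_comap.eventually (Iio_mem_nhds hpos)
  filter_upwards [this] with ε hε
  have h2 : ς.toFun ℓ ε ≤ ς.toFun ℓ ε₀ :=
    hm (show (ε : ℝ) < δ from lt_trans hε h₀) h₀ hε.le
  simpa [abs_of_pos (ς.pos' ℓ ε)] using h2

/-- Any two scale functions dominate a common third one. -/
theorem exists_isLittleO_both (ℓ j : Υ) :
    ∃ k, ς.toFun k =o[netLim] ς.toFun ℓ ∧ ς.toFun k =o[netLim] ς.toFun j := by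
  obtain ⟨k, hk⟩ := ς.exists_isLittleO_mul' ℓ j
  refine ⟨k, hk.trans_isBigO ?_, hk.trans_isBigO ?_⟩
  · simpa using (isBigO_refl (ς.toFun ℓ) netLim).mul (ς.isBigO_one j)
  · simpa using (ς.isBigO_one ℓ).mul (isBigO_refl (ς.toFun j) netLim)

/-- Some scale function tends to `0`. -/
theorem exists_isLittleO_one : ∃ k, ς.toFun k =o[netLim] (fun _ => (1 : ℝ)) := by
  obtain ⟨ℓ⟩ := ‹Nonempty Υ›
  obtain ⟨k, hk, -⟩ := ς.exists_isLittleO_both ℓ ℓ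
  exact ⟨k, hk.trans_isBigO (ς.isBigO_one ℓ)⟩

end AsymptoticScale

section Colombeau

variable {Υ : Type*} [PartialOrder Υ] [IsDirectedOrder Υ] [Nonempty Υ] (ς : AsymptoticScale Υ)
variable {𝕜 : Type*} [RCLike 𝕜]
variable {X : Type*} [AddCommGroup X] [Module 𝕜 X] {ι : Type*} (p : SeminormFamily 𝕜 X ι)

/-- Moderate nets: for every seminorm `p i` there is a scale function `ς ℓ` with
`ς ℓ ε * p i (h ε) = o(1)`. -/
def moderateNets : Submodule 𝕜 (NetParam → X) where
  carrier := {h | ∀ i, ∃ ℓ,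
    (fun ε => ς.toFun ℓ ε * p i (h ε)) =o[netLim] (fun _ => (1 : ℝ))}
  zero_mem' := fun i => ⟨Classical.arbitrary Υ, by simp [tendsto_const_nhds]⟩
  add_mem' := by
    intro h g hh hg i
    obtain ⟨ℓ, hℓ⟩ := hh i
    obtain ⟨j, hj⟩ := hg i
    obtain ⟨k, hk1, hk2⟩ := ς.exists_isLittleO_both ℓ j
    refine ⟨k, ?_⟩
    have h1 : (fun ε => ς.toFun k ε * p i (h ε)) =o[netLim] (fun _ => (1 : ℝ)) :=
      ((hk1.isBigO.mul (isBigO_refl _ _)).trans_isLittleO hℓ)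
    have h2 : (fun ε => ς.toFun k ε * p i (g ε)) =o[netLim] (fun _ => (1 : ℝ)) :=
      ((hk2.isBigO.mul (isBigO_refl _ _)).trans_isLittleO hj)
    refine IsBigO.trans_isLittleO (IsBigO.of_bound 1 (Eventually.of_forall fun ε => ?_))
      (h1.add h2)
    have hp := ς.pos' k ε
    rw [one_mul, Real.norm_of_nonneg (by positivity), Real.norm_of_nonneg (by positivity),
      ← mul_add]
    exact mul_le_mul_of_nonneg_left (map_add_le_add _ _ _) hp.le
  smul_mem' := by
    intro c h hh i
    obtain ⟨ℓ, hℓ⟩ := hh i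
    refine ⟨ℓ, ?_⟩
    have := hℓ.const_mul_left ‖c‖
    refine this.congr_left fun ε => ?_
    simp only [Pi.smul_apply, map_smul_eq_mul]
    ring

/-- Negligible nets: `p i (h ε) = o(ς ℓ ε)` for every seminorm and every scale function. -/
def negligibleNets : Submodule 𝕜 (NetParam → X) where
  carrier := {h | ∀ i, ∀ ℓ, (fun ε => p i (h ε)) =o[netLim] ς.toFun ℓ}
  zero_mem' := fun i ℓ => by simp
  add_mem' := by
    intro h g hh hg i ℓ
    refine IsBigO.trans_isLittleO (IsBigO.of_bound 1 (Eventually.of_forall fun ε => ?_))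
      ((hh i ℓ).add (hg i ℓ))
    rw [one_mul, Real.norm_of_nonneg (by positivity), Real.norm_of_nonneg (by positivity)]
    exact map_add_le_add _ _ _
  smul_mem' := by
    intro c h hh i ℓ
    refine ((hh i ℓ).const_mul_left ‖c‖).congr_left fun ε => ?_
    simp only [Pi.smul_apply, map_smul_eq_mul]

/-- The Colombeau extension of the locally convex space `(X, p)`: moderate nets modulo negligible
nets. -/
abbrev Colombeau : Type _ :=
  moderateNets ς p ⧸ (negligibleNets ς p).comap (moderateNets ς p).subtype

variable {ς p}

/-- The net `h` represents the generalised element `x`. -/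
def Represents (h : NetParam → X) (x : Colombeau ς p) : Prop :=
  ∃ hm : h ∈ moderateNets ς p, (Submodule.Quotient.mk ⟨h, hm⟩ : Colombeau ς p) = x

/-- `x` belongs to the Colombeau extension of the subset `Γ` of `X`: it is represented by a
moderate net with values in `Γ`. -/
def Colombeau.IsIn (Γ : Set X) (x : Colombeau ς p) : Prop :=
  ∃ h : NetParam → X, (∀ ε, h ε ∈ Γ) ∧ Represents h x

theorem moderateNets_sup {h : NetParam → X} (hm : h ∈ moderateNets ς p) (s : Finset ι) :
    ∃ ℓ, (fun ε => ς.toFun ℓ ε * (s.sup p) (h ε)) =o[netLim] (fun _ => (1 : ℝ)) := by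
  classical
  induction s using Finset.induction_on with
  | empty => exact ⟨Classical.arbitrary Υ, by simp [Seminorm.bot_eq_zero, tendsto_const_nhds]⟩
  | insert i s _ ih =>
    obtain ⟨ℓ, hℓ⟩ := ih
    obtain ⟨j, hj⟩ := hm i
    obtain ⟨k, hk1, hk2⟩ := ς.exists_isLittleO_both ℓ j
    refine ⟨k, ?_⟩
    have h1 : (fun ε => ς.toFun k ε * (s.sup p) (h ε)) =o[netLim] (fun _ => (1 : ℝ)) :=
      ((hk1.isBigO.mul (isBigO_refl _ _)).trans_isLittleO hℓ)
    have h2 : (fun ε => ς.toFun k ε * p i (h ε)) =o[netLim] (fun _ => (1 : ℝ)) :=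
      ((hk2.isBigO.mul (isBigO_refl _ _)).trans_isLittleO hj)
    refine IsBigO.trans_isLittleO (IsBigO.of_bound 1 (Eventually.of_forall fun ε => ?_))
      (h1.add h2)
    have hp := ς.pos' k ε
    rw [one_mul, Real.norm_of_nonneg (by positivity), Real.norm_of_nonneg (by positivity),
      ← mul_add, Finset.sup_insert]
    refine mul_le_mul_of_nonneg_left ?_ hp.le
    have a1 : 0 ≤ p i (h ε) := apply_nonneg _ _
    have a2 : 0 ≤ (s.sup p) (h ε) := apply_nonneg _ _
    rw [Seminorm.sup_apply]
    exact sup_le (by linarith) (by linarith)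

theorem negligibleNets_sup {h : NetParam → X} (hm : h ∈ negligibleNets ς p) (s : Finset ι)
    (ℓ : Υ) : (fun ε => (s.sup p) (h ε)) =o[netLim] ς.toFun ℓ := by
  classical
  induction s using Finset.induction_on with
  | empty => simp [Seminorm.bot_eq_zero]
  | insert i s _ ih =>
    refine IsBigO.trans_isLittleO (IsBigO.of_bound 1 (Eventually.of_forall fun ε => ?_))
      (ih.add (hm i ℓ))
    have a1 : 0 ≤ p i (h ε) := apply_nonneg _ _
    have a2 : 0 ≤ (s.sup p) (h ε) := apply_nonneg _ _
    rw [one_mul, Real.norm_of_nonneg (by positivity), Real.norm_of_nonneg (by positivity),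
      Finset.sup_insert, Seminorm.sup_apply]
    exact sup_le (by linarith) (by linarith)

variable {Y : Type*} [AddCommGroup Y] [Module 𝕜 Y] {κ : Type*} {r : SeminormFamily 𝕜 Y κ}

theorem moderateNets_map (T : X →ₗ[𝕜] Y) (hT : Seminorm.IsBounded p r T) {h : NetParam → X}
    (hm : h ∈ moderateNets ς p) : (fun ε => T (h ε)) ∈ moderateNets ς r := by
  intro i
  obtain ⟨s, C, hC⟩ := hT i
  obtain ⟨ℓ, hℓ⟩ := moderateNets_sup hm s
  refine ⟨ℓ, IsBigO.trans_isLittleO (IsBigO.of_bound C (Eventually.of_forall fun ε => ?_)) hℓ⟩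
  have hp := ς.pos' ℓ ε
  rw [Real.norm_of_nonneg (by positivity), Real.norm_of_nonneg (by positivity)]
  have : r i (T (h ε)) ≤ C * (s.sup p) (h ε) := hC (h ε)
  calc _ ≤ ς.toFun ℓ ε * (C * (s.sup p) (h ε)) := mul_le_mul_of_nonneg_left this hp.le
    _ = _ := by ring

theorem negligibleNets_map (T : X →ₗ[𝕜] Y) (hT : Seminorm.IsBounded p r T) {h : NetParam → X}
    (hm : h ∈ negligibleNets ς p) : (fun ε => T (h ε)) ∈ negligibleNets ς r := by
  intro i ℓ
  obtain ⟨s, C, hC⟩ := hT i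
  refine IsBigO.trans_isLittleO (IsBigO.of_bound C (Eventually.of_forall fun ε => ?_))
    (negligibleNets_sup hm s ℓ)
  rw [Real.norm_of_nonneg (by positivity), Real.norm_of_nonneg (by positivity)]
  exact hC (h ε)

/-- The extension `[h ε] ↦ [T (h ε)]` of a continuous linear operator `T` to the Colombeau
extensions. -/
def Colombeau.map (ς : AsymptoticScale Υ) (T : X →ₗ[𝕜] Y) (hT : Seminorm.IsBounded p r T) :
    Colombeau ς p →ₗ[𝕜] Colombeau ς r :=
  Submodule.mapQ _ _
    { toFun := fun h => ⟨fun ε => T (h.1 ε), moderateNets_map T hT h.2⟩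
      map_add' := fun h g => by ext ε; simp
      map_smul' := fun c h => by ext ε; simp }
    (fun _ hm => negligibleNets_map T hT hm)

variable {𝕜' : Type*} [RCLike 𝕜'] {Z : Type*} [AddCommGroup Z] [Module 𝕜' Z] {ι' : Type*}
  {z : SeminormFamily 𝕜' Z ι'}

/-- Continuity of a bi-additive map in terms of seminorms. -/
def BilinBounded (z : SeminormFamily 𝕜' Z ι') (p : SeminormFamily 𝕜 X ι)
    (r : SeminormFamily 𝕜 Y κ) (B : Z →+ X →+ Y) : Prop :=
  ∀ i, ∃ (s : Finset ι') (t : Finset ι) (C : ℝ), 0 ≤ C ∧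
    ∀ a x, r i (B a x) ≤ C * ((s.sup z) a * (t.sup p) x)

theorem moderateNets_map₂ {B : Z →+ X →+ Y} (hB : BilinBounded z p r B)
    {a : NetParam → Z} {h : NetParam → X} (ha : a ∈ moderateNets ς z)
    (hh : h ∈ moderateNets ς p) : (fun ε => B (a ε) (h ε)) ∈ moderateNets ς r := by
  intro i
  obtain ⟨s, t, C, hC0, hC⟩ := hB i
  obtain ⟨ℓ, hℓ⟩ := moderateNets_sup ha s
  obtain ⟨j, hj⟩ := moderateNets_sup hh t
  obtain ⟨k, hk⟩ := ς.exists_isLittleO_mul' ℓ j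
  refine ⟨k, ?_⟩
  have h1 : (fun ε => (ς.toFun ℓ ε * ς.toFun j ε) * ((s.sup z) (a ε) * (t.sup p) (h ε)))
      =o[netLim] (fun _ => (1 : ℝ)) := by
    have := hℓ.mul hj
    simp only [mul_one] at this
    exact this.congr_left fun ε => by ring
  have h2 := (hk.isBigO.mul
    (isBigO_refl (fun ε => (s.sup z) (a ε) * (t.sup p) (h ε)) netLim)).trans_isLittleO h1
  refine IsBigO.trans_isLittleO (IsBigO.of_bound C (Eventually.of_forall fun ε => ?_)) h2
  have hp := ς.pos' k ε
  rw [Real.norm_of_nonneg (by positivity), Real.norm_of_nonneg (by positivity)]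
  calc _ ≤ ς.toFun k ε * (C * ((s.sup z) (a ε) * (t.sup p) (h ε))) :=
        mul_le_mul_of_nonneg_left (hC _ _) hp.le
    _ = _ := by ring

theorem negligibleNets_map₂_right {B : Z →+ X →+ Y} (hB : BilinBounded z p r B)
    {a : NetParam → Z} {h : NetParam → X} (ha : a ∈ moderateNets ς z)
    (hh : h ∈ negligibleNets ς p) : (fun ε => B (a ε) (h ε)) ∈ negligibleNets ς r := by
  intro i ℓ
  obtain ⟨s, t, C, hC0, hC⟩ := hB i
  obtain ⟨j, hj⟩ := moderateNets_sup ha s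
  obtain ⟨k, hk⟩ := ς.exists_isLittleO_mul' ℓ j
  have h0 := negligibleNets_sup hh t k
  have h1 : (fun ε => (s.sup z) (a ε) * (t.sup p) (h ε)) =o[netLim] ς.toFun ℓ := by
    have e1 := (h0.trans hk).mul_isBigO (isBigO_refl (fun ε => (s.sup z) (a ε)) netLim)
    have e2 := (isBigO_refl (ς.toFun ℓ) netLim).mul hj.isBigO
    simp only [mul_one] at e2
    refine (e1.congr_left fun ε => mul_comm _ _).trans_isBigO (e2.congr_left fun ε => ?_)
    ring
  refine IsBigO.trans_isLittleO (IsBigO.of_bound C (Eventually.of_forall fun ε => ?_)) h1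
  rw [Real.norm_of_nonneg (by positivity), Real.norm_of_nonneg (by positivity)]
  exact hC _ _

theorem negligibleNets_map₂_left {B : Z →+ X →+ Y} (hB : BilinBounded z p r B)
    {a : NetParam → Z} {h : NetParam → X} (ha : a ∈ negligibleNets ς z)
    (hh : h ∈ moderateNets ς p) : (fun ε => B (a ε) (h ε)) ∈ negligibleNets ς r := by
  intro i ℓ
  obtain ⟨s, t, C, hC0, hC⟩ := hB i
  obtain ⟨j, hj⟩ := moderateNets_sup hh t
  obtain ⟨k, hk⟩ := ς.exists_isLittleO_mul' ℓ j
  have h0 := negligibleNets_sup ha s k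
  have h1 : (fun ε => (s.sup z) (a ε) * (t.sup p) (h ε)) =o[netLim] ς.toFun ℓ := by
    have e1 := (h0.trans hk).mul_isBigO (isBigO_refl (fun ε => (t.sup p) (h ε)) netLim)
    have e2 := (isBigO_refl (ς.toFun ℓ) netLim).mul hj.isBigO
    simp only [mul_one] at e2
    refine e1.trans_isBigO (e2.congr_left fun ε => ?_)
    ring
  refine IsBigO.trans_isLittleO (IsBigO.of_bound C (Eventually.of_forall fun ε => ?_)) h1
  rw [Real.norm_of_nonneg (by positivity), Real.norm_of_nonneg (by positivity)]
  exact hC _ _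

/-- The extension `([a ε], [h ε]) ↦ [B (a ε) (h ε)]` of a continuous bi-additive map `B` to the
Colombeau extensions. -/
def Colombeau.map₂ (ς : AsymptoticScale Υ) (B : Z →+ X →+ Y) (hB : BilinBounded z p r B)
    (a : Colombeau ς z) (x : Colombeau ς p) : Colombeau ς r :=
  Quotient.liftOn₂' a x
    (fun a h => Submodule.Quotient.mk
      ⟨fun ε => B (a.1 ε) (h.1 ε), moderateNets_map₂ hB a.2 h.2⟩)
    (by
      intro a h a' h' haa hhh
      rw [Submodule.quotientRel_def] at haa hhh
      refine (Submodule.Quotient.eq _).2 ?_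
      have e : (fun ε => B (a.1 ε) (h.1 ε)) - (fun ε => B (a'.1 ε) (h'.1 ε))
          = (fun ε => B ((a.1 - a'.1) ε) (h.1 ε)) + fun ε => B (a'.1 ε) ((h.1 - h'.1) ε) := by
        ext ε
        simp [map_sub]
      show (fun ε => B (a.1 ε) (h.1 ε)) - (fun ε => B (a'.1 ε) (h'.1 ε)) ∈ negligibleNets ς r
      rw [e]
      exact Submodule.add_mem _ (negligibleNets_map₂_left hB haa h.2)
        (negligibleNets_map₂_right hB a'.2 hhh))

end Colombeau

/-! ## Spaces of paths -/

section Paths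

open TopologicalSpace

variable (𝕜 : Type*) [RCLike 𝕜] (F : Type*) [NormedAddCommGroup F] [NormedSpace ℝ F]
  [NormedSpace 𝕜 F] [SMulCommClass ℝ 𝕜 F]

/-- `C^∞(ℝ₊, F)` with `ℝ₊ = (0, ∞)`, for a normed space `F`. A path is recorded as a function on
`ℝ` of which only the values on `(0, ∞)` are used: the seminorms below do not see the other
values. -/
def smoothPaths : Submodule 𝕜 (ℝ → F) where
  carrier := {g | ContDiffOn ℝ ∞ g (Ioi 0)}
  zero_mem' := contDiffOn_const
  add_mem' := fun hf hg => ContDiffOn.add hf hg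
  smul_mem' := fun c _ hf => ContDiffOn.const_smul c hf

/-- `C([0, ∞), F)`. Only the values on `[0, ∞)` are used. -/
def contPaths : Submodule 𝕜 (ℝ → F) where
  carrier := {g | ContinuousOn g (Ici 0)}
  zero_mem' := continuousOn_const
  add_mem' := fun hf hg => ContinuousOn.add hf hg
  smul_mem' := fun c _ hf => ContinuousOn.const_smul hf c

variable {F}

/-- The restriction of `∂_t^j g` to a compact subset `K` of `(0, ∞)`. -/
def smoothPaths.restrictDeriv (j : ℕ) (K : Compacts (Ioi (0 : ℝ))) :
    smoothPaths 𝕜 F →ₗ[𝕜] C(K, F) where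
  toFun g := ⟨fun t => iteratedDerivWithin j g.1 (Ioi 0) (t : Ioi (0 : ℝ)), by
    have h := ContDiffOn.continuousOn_iteratedDerivWithin g.2
      (m := j) (by exact_mod_cast le_top) (uniqueDiffOn_Ioi 0)
    exact (continuousOn_iff_continuous_domRestrict.1 h).comp continuous_subtype_val⟩
  map_add' f g := by
    ext t
    exact iteratedDerivWithin_add (t : Ioi (0 : ℝ)).2 (uniqueDiffOn_Ioi 0)
      ((f.2.of_le (by exact_mod_cast le_top)) _ (t : Ioi (0 : ℝ)).2)
      ((g.2.of_le (by exact_mod_cast le_top)) _ (t : Ioi (0 : ℝ)).2)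
  map_smul' c f := by
    ext t
    exact iteratedDerivWithin_const_smul (t : Ioi (0 : ℝ)).2 (uniqueDiffOn_Ioi 0) c
      ((f.2.of_le (by exact_mod_cast le_top)) _ (t : Ioi (0 : ℝ)).2)

/-- The restriction of `g` to `[0, b]`. -/
def contPaths.restrict (b : ℕ) : contPaths 𝕜 F →ₗ[𝕜] C(Icc (0 : ℝ) b, F) where
  toFun g := ⟨fun t => g.1 t,
    continuousOn_iff_continuous_domRestrict.1 (g.2.mono Icc_subset_Ici_self)⟩
  map_add' f g := by ext t; rfl
  map_smul' c f := by ext t; rfl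

variable (F)

/-- The seminorms `sup_{t ∈ K} ‖∂_t^j g(t)‖` of `C^∞(ℝ₊, F)`, for `j ∈ ℕ` and `K ⊂ ℝ₊` compact. -/
def smoothSeminorms : SeminormFamily 𝕜 (smoothPaths 𝕜 F) (ℕ × Compacts (Ioi (0 : ℝ))) :=
  fun i => (normSeminorm 𝕜 C(i.2, F)).comp (smoothPaths.restrictDeriv 𝕜 i.1 i.2)

/-- The seminorms `sup_{t ∈ [0, b]} ‖g(t)‖` of `C([0, ∞), F)`, for `b ∈ ℕ`. -/
def contSeminorms : SeminormFamily 𝕜 (contPaths 𝕜 F) ℕ :=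
  fun b => (normSeminorm 𝕜 C(Icc (0 : ℝ) b, F)).comp (contPaths.restrict 𝕜 b)

/-- The family of all the seminorms of `M` and of `N` on the intersection `M ⊓ N`. -/
def infSeminorms {V : Type*} [AddCommGroup V] [Module 𝕜 V] {M N : Submodule 𝕜 V} {ι κ : Type*}
    (p : SeminormFamily 𝕜 M ι) (r : SeminormFamily 𝕜 N κ) :
    SeminormFamily 𝕜 (M ⊓ N : Submodule 𝕜 V) (ι ⊕ κ) :=
  Sum.elim (fun i => (p i).comp (Submodule.inclusion inf_le_left))
    (fun i => (r i).comp (Submodule.inclusion inf_le_right))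

/-- The continuous inclusion of `M ⊓ N` in `M`. -/
theorem isBounded_inclusion_left {V : Type*} [AddCommGroup V] [Module 𝕜 V] {M N : Submodule 𝕜 V}
    {ι κ : Type*} (p : SeminormFamily 𝕜 M ι) (r : SeminormFamily 𝕜 N κ) :
    Seminorm.IsBounded (infSeminorms 𝕜 p r) p (Submodule.inclusion inf_le_left) := by
  intro i
  refine ⟨{Sum.inl i}, 1, fun x => ?_⟩
  simp [infSeminorms]

variable {F}

theorem norm_restrictDeriv_le_iff {g : smoothPaths 𝕜 F} {j : ℕ} {K : Compacts (Ioi (0 : ℝ))}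
    {C : ℝ} (hC : 0 ≤ C) : smoothSeminorms 𝕜 F (j, K) g ≤ C ↔
      ∀ t ∈ K, ‖iteratedDerivWithin j g.1 (Ioi 0) (t : ℝ)‖ ≤ C := by
  refine (ContinuousMap.norm_le _ hC).trans ⟨fun h t ht => h ⟨t, ht⟩, fun h t => h t.1 t.2⟩

theorem norm_iteratedDerivWithin_le {g : smoothPaths 𝕜 F} {j : ℕ} {K : Compacts (Ioi (0 : ℝ))}
    {t : Ioi (0 : ℝ)} (ht : t ∈ K) :
    ‖iteratedDerivWithin j g.1 (Ioi 0) (t : ℝ)‖ ≤ smoothSeminorms 𝕜 F (j, K) g :=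
  (norm_restrictDeriv_le_iff 𝕜 (apply_nonneg _ _)).1 le_rfl t ht

end Paths

/-! ## The Sobolev space `W^{q,∞}(ℝⁿ)` -/

section Sobolev

variable (n : ℕ) (q : ℝ≥0∞) [Fact (1 ≤ q)]

/-- `L^q(ℝⁿ)`, complex valued. -/
abbrev LqSpace : Type := Lp ℂ q (volume : Measure (EuclideanSpace ℝ (Fin n)))

variable {n q}

/-- A function in `L^q(ℝⁿ)` as a tempered distribution. -/
def toDistr : LqSpace n q →L[ℂ] 𝓢'(EuclideanSpace ℝ (Fin n), ℂ) :=
  Lp.toTemperedDistributionCLM ℂ volume q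

/-- The distributional derivative `∂_{x_{i₁}} ⋯ ∂_{x_{i_k}}` for a word `m = [i₁, …, i_k]`. Since
partial derivatives commute, these are exactly the derivatives `∂_x^β` for multi-indices `β`. -/
def distrDeriv : List (Fin n) → 𝓢'(EuclideanSpace ℝ (Fin n), ℂ) →L[ℂ]
    𝓢'(EuclideanSpace ℝ (Fin n), ℂ)
  | [] => ContinuousLinearMap.id ℂ _
  | i :: m => (LineDeriv.lineDerivOpCLM ℂ 𝓢'(EuclideanSpace ℝ (Fin n), ℂ)
      (EuclideanSpace.single i (1 : ℝ))).comp (distrDeriv m)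

variable (n q)

/-- `W^{q,∞}(ℝⁿ)`: all distributional derivatives of all orders belong to `L^q(ℝⁿ)`. -/
def sobolevInfty : Submodule ℂ (LqSpace n q) where
  carrier := {v | ∀ m, ∃ w : LqSpace n q, toDistr w = distrDeriv m (toDistr v)}
  zero_mem' := fun m => ⟨0, by simp⟩
  add_mem' := by
    intro v w hv hw m
    obtain ⟨v', hv'⟩ := hv m
    obtain ⟨w', hw'⟩ := hw m
    exact ⟨v' + w', by simp [hv', hw']⟩
  smul_mem' := by
    intro c v hv m
    obtain ⟨v', hv'⟩ := hv m
    exact ⟨c • v', by simp [hv']⟩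

variable {n q}

open Classical in
/-- The weak derivative `∂_x^m v` as an element of `L^q(ℝⁿ)`, for `v ∈ W^{q,∞}(ℝⁿ)`. -/
def weakDeriv (m : List (Fin n)) (v : LqSpace n q) : LqSpace n q :=
  if h : ∃ w : LqSpace n q, toDistr w = distrDeriv m (toDistr v) then h.choose else 0

theorem toDistr_injective : Function.Injective (toDistr : LqSpace n q → _) :=
  LinearMap.ker_eq_bot.1 (Lp.ker_toTemperedDistributionCLM_eq_bot (F := ℂ)
    (μ := (volume : Measure (EuclideanSpace ℝ (Fin n)))) (p := q))

theorem toDistr_weakDeriv {v : LqSpace n q} (hv : v ∈ sobolevInfty n q) (m : List (Fin n)) :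
    toDistr (weakDeriv m v) = distrDeriv m (toDistr v) := by
  rw [weakDeriv, dif_pos (hv m)]
  exact (hv m).choose_spec

theorem weakDeriv_eq {v w : LqSpace n q} {m : List (Fin n)}
    (h : toDistr w = distrDeriv m (toDistr v)) : weakDeriv m v = w := by
  have h' : ∃ w : LqSpace n q, toDistr w = distrDeriv m (toDistr v) := ⟨w, h⟩
  rw [weakDeriv, dif_pos h']
  exact toDistr_injective (h'.choose_spec.trans h.symm)

theorem weakDeriv_add {v w : LqSpace n q} (hv : v ∈ sobolevInfty n q)
    (hw : w ∈ sobolevInfty n q) (m : List (Fin n)) :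
    weakDeriv m (v + w) = weakDeriv m v + weakDeriv m w :=
  weakDeriv_eq (by simp [toDistr_weakDeriv, hv, hw])

theorem weakDeriv_smul {v : LqSpace n q} (hv : v ∈ sobolevInfty n q) (c : ℂ)
    (m : List (Fin n)) : weakDeriv m (c • v) = c • weakDeriv m v :=
  weakDeriv_eq (by simp [toDistr_weakDeriv, hv])

theorem distrDeriv_append (m m' : List (Fin n)) (T : 𝓢'(EuclideanSpace ℝ (Fin n), ℂ)) :
    distrDeriv (m ++ m') T = distrDeriv m (distrDeriv m' T) := by
  induction m with
  | nil => rfl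
  | cons i m ih => simp [distrDeriv, ih]

theorem weakDeriv_mem {v : LqSpace n q} (hv : v ∈ sobolevInfty n q) (m : List (Fin n)) :
    weakDeriv m v ∈ sobolevInfty n q := fun m' =>
  ⟨weakDeriv (m' ++ m) v, by rw [toDistr_weakDeriv hv, toDistr_weakDeriv hv, distrDeriv_append]⟩

theorem weakDeriv_weakDeriv {v : LqSpace n q} (hv : v ∈ sobolevInfty n q)
    (m m' : List (Fin n)) : weakDeriv m (weakDeriv m' v) = weakDeriv (m ++ m') v :=
  weakDeriv_eq (by rw [toDistr_weakDeriv hv, toDistr_weakDeriv hv, distrDeriv_append])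

/-- Derivatives of distributions are given by duality. -/
theorem exists_distrDeriv_apply (m : List (Fin n)) (φ : 𝓢(EuclideanSpace ℝ (Fin n), ℂ)) :
    ∃ ψ : 𝓢(EuclideanSpace ℝ (Fin n), ℂ), ∀ T, distrDeriv m T φ = T ψ := by
  induction m generalizing φ with
  | nil => exact ⟨φ, fun T => rfl⟩
  | cons i m ih =>
    obtain ⟨ψ, hψ⟩ := ih (-(∂_{EuclideanSpace.single i (1 : ℝ)} φ))
    exact ⟨ψ, fun T => hψ T⟩

/-- The pairing with a fixed Schwartz function is a continuous functional on `L^q`. -/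
def pairing (φ : 𝓢(EuclideanSpace ℝ (Fin n), ℂ)) : LqSpace n q →L[ℂ] ℂ where
  toFun v := toDistr v φ
  map_add' v w := by simp
  map_smul' c v := by simp
  cont := by
    have h1 : Continuous (toDistr : LqSpace n q → _) := toDistr.cont
    exact (PointwiseConvergenceCLM.evalCLM (RingHom.id ℂ) ℂ φ).cont.comp h1

end Sobolev

/-! ## The space `C^∞(ℝ₊, W^{q,∞}(ℝⁿ)) ∩ C([0, ∞), L^q(ℝⁿ))` -/

section SobolevPaths

open TopologicalSpace

variable (n : ℕ) (q : ℝ≥0∞) [Fact (1 ≤ q)]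

/-- `C^∞(ℝ₊, W^{q,∞}(ℝⁿ))`: since the topology of `W^{q,∞}` is given by the norms
`‖∂_x^m v‖_q`, smoothness of `u` means that every `t ↦ ∂_x^m u(t)` is smooth with values in
`L^q(ℝⁿ)`. Only the values on `(0, ∞)` are used. -/
def sobolevPaths : Submodule ℂ (ℝ → LqSpace n q) where
  carrier := {u | (∀ t, 0 < t → u t ∈ sobolevInfty n q) ∧
    ∀ m, ContDiffOn ℝ ∞ (fun t => weakDeriv m (u t)) (Ioi 0)}
  zero_mem' := ⟨fun _ _ => Submodule.zero_mem _, fun m => by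
    have : weakDeriv m (0 : LqSpace n q) = 0 := weakDeriv_eq (by simp)
    simpa [this] using contDiffOn_const⟩
  add_mem' := fun {u v} hu hv => ⟨fun t ht => Submodule.add_mem _ (hu.1 t ht) (hv.1 t ht),
    fun m => ((hu.2 m).add (hv.2 m)).congr fun t ht =>
      weakDeriv_add (hu.1 t ht) (hv.1 t ht) m⟩
  smul_mem' := fun c u hu => ⟨fun t ht => Submodule.smul_mem _ c (hu.1 t ht),
    fun m => ((hu.2 m).const_smul c).congr fun t ht => weakDeriv_smul (hu.1 t ht) c m⟩

variable {n q}

open Classical in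
/-- The path `t ↦ ∂_x^m u(t)` on `(0, ∞)`. -/
def sobolevPaths.spaceDeriv (m : List (Fin n)) :
    sobolevPaths n q →ₗ[ℂ] smoothPaths ℂ (LqSpace n q) where
  toFun u := ⟨fun t => if 0 < t then weakDeriv m (u.1 t) else 0,
    (u.2.2 m).congr fun t ht => if_pos ht⟩
  map_add' u v := by
    ext1
    funext t
    by_cases ht : 0 < t
    · simp [ht, weakDeriv_add (u.2.1 t ht) (v.2.1 t ht)]
    · simp [ht]
  map_smul' c u := by
    ext1
    funext t
    by_cases ht : 0 < t
    · simp [ht, weakDeriv_smul (u.2.1 t ht)]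
    · simp [ht]

variable (n q)

/-- The seminorms `sup_{t ∈ K} ‖∂_t^j ∂_x^m u(t)‖_q` of `C^∞(ℝ₊, W^{q,∞}(ℝⁿ))`. -/
def sobolevSeminorms : SeminormFamily ℂ (sobolevPaths n q)
    (List (Fin n) × (ℕ × Compacts (Ioi (0 : ℝ)))) :=
  fun i => (smoothSeminorms ℂ (LqSpace n q) i.2).comp (sobolevPaths.spaceDeriv i.1)

/-- `C^∞(ℝ₊, W^{q,∞}(ℝⁿ)) ∩ C([0, ∞), L^q(ℝⁿ))`. -/
abbrev solutionSpace : Submodule ℂ (ℝ → LqSpace n q) :=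
  sobolevPaths n q ⊓ contPaths ℂ (LqSpace n q)

/-- The seminorms of `C^∞(ℝ₊, W^{q,∞}(ℝⁿ))` together with those of `C([0, ∞), L^q(ℝⁿ))`. -/
abbrev solutionSeminorms : SeminormFamily ℂ (solutionSpace n q)
    ((List (Fin n) × (ℕ × Compacts (Ioi (0 : ℝ)))) ⊕ ℕ) :=
  infSeminorms ℂ (sobolevSeminorms n q) (contSeminorms ℂ (LqSpace n q))

/-- The norm of `L^q(ℝⁿ)`, as a one-element family of seminorms. -/
abbrev lqSeminorms : SeminormFamily ℂ (LqSpace n q) Unit := fun _ => normSeminorm ℂ _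

/-- Evaluation at `t = 0`. -/
def evalZero : solutionSpace n q →ₗ[ℂ] LqSpace n q where
  toFun u := u.1 0
  map_add' _ _ := rfl
  map_smul' _ _ := rfl

theorem isBounded_evalZero :
    Seminorm.IsBounded (solutionSeminorms n q) (lqSeminorms n q) (evalZero n q) := by
  intro i
  refine ⟨{Sum.inr 0}, 1, fun u => ?_⟩
  rw [one_smul, Finset.sup_singleton]
  exact ContinuousMap.norm_coe_le_norm
    (contPaths.restrict ℂ 0 (Submodule.inclusion inf_le_right u) :
      C(Icc (0 : ℝ) ((0 : ℕ) : ℝ), LqSpace n q)) ⟨0, by simp⟩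

variable {n q}

theorem hasDerivAt_weakDeriv {u : ℝ → LqSpace n q} (hu : u ∈ sobolevPaths n q)
    (m : List (Fin n)) {t : ℝ} (ht : 0 < t) :
    HasDerivAt (fun t => weakDeriv m (u t)) (deriv (fun t => weakDeriv m (u t)) t) t :=
  (((hu.2 m).contDiffAt (Ioi_mem_nhds ht)).differentiableAt (by simp)).hasDerivAt

theorem weakDeriv_nil (v : LqSpace n q) : weakDeriv [] v = v := weakDeriv_eq rfl

/-- Time and space derivatives commute. -/
theorem toDistr_deriv {u : ℝ → LqSpace n q} (hu : u ∈ sobolevPaths n q)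
    (m : List (Fin n)) {t : ℝ} (ht : 0 < t) :
    toDistr (deriv (fun t => weakDeriv m (u t)) t) = distrDeriv m (toDistr (deriv u t)) := by
  ext φ
  obtain ⟨ψ, hψ⟩ := exists_distrDeriv_apply m φ
  rw [hψ]
  have h1 := ((pairing (q := q) φ).restrictScalars ℝ).hasFDerivAt.comp_hasDerivAt t
    (hasDerivAt_weakDeriv hu m ht)
  have h0 := hasDerivAt_weakDeriv hu [] ht
  simp only [weakDeriv_nil] at h0
  have h2 := ((pairing (q := q) ψ).restrictScalars ℝ).hasFDerivAt.comp_hasDerivAt t h0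
  have he : (fun t => (pairing (q := q) φ) (weakDeriv m (u t))) =ᶠ[𝓝 t]
      fun t => (pairing (q := q) ψ) (u t) := by
    filter_upwards [Ioi_mem_nhds ht] with s hs
    show toDistr (weakDeriv m (u s)) φ = toDistr (u s) ψ
    rw [toDistr_weakDeriv (hu.1 s hs), hψ]
  exact (h1.congr_of_eventuallyEq he.symm).unique h2

open Classical in
/-- The time derivative `∂_t` on `C^∞(ℝ₊, W^{q,∞}(ℝⁿ))`. -/
def timeDeriv : sobolevPaths n q →ₗ[ℂ] sobolevPaths n q where
  toFun u := ⟨fun t => if 0 < t then deriv u.1 t else 0, by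
    refine ⟨fun t ht => ?_, fun m => ?_⟩
    · beta_reduce
      rw [if_pos ht]
      exact fun m => ⟨_, toDistr_deriv u.2 m ht⟩
    · refine ContDiffOn.congr (f := deriv fun t => weakDeriv m (u.1 t)) ?_ fun t ht => ?_
      · exact (u.2.2 m).deriv_of_isOpen isOpen_Ioi (by simp)
      · beta_reduce
        rw [if_pos (mem_Ioi.1 ht)]
        exact weakDeriv_eq (toDistr_deriv u.2 m ht)⟩
  map_add' u v := by
    ext1
    funext t
    by_cases ht : 0 < t
    · have hu := hasDerivAt_weakDeriv u.2 [] ht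
      have hv := hasDerivAt_weakDeriv v.2 [] ht
      simp only [weakDeriv_nil] at hu hv
      simpa [ht] using (hu.add hv).deriv
    · simp [ht]
  map_smul' c u := by
    ext1
    funext t
    by_cases ht : 0 < t
    · have hu := hasDerivAt_weakDeriv u.2 [] ht
      simp only [weakDeriv_nil] at hu
      simpa [ht] using (hu.const_smul c).deriv
    · simp [ht]

theorem spaceDeriv_timeDeriv (u : sobolevPaths n q) (m : List (Fin n)) :
    EqOn (sobolevPaths.spaceDeriv m (timeDeriv u)).1
      (derivWithin (sobolevPaths.spaceDeriv m u).1 (Ioi 0)) (Ioi 0) := by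
  intro t ht
  have h1 : (sobolevPaths.spaceDeriv m (timeDeriv u)).1 t
      = deriv (fun t => weakDeriv m (u.1 t)) t := by
    show (if 0 < t then weakDeriv m (if 0 < t then deriv u.1 t else 0) else 0) = _
    rw [if_pos (mem_Ioi.1 ht), if_pos (mem_Ioi.1 ht)]
    exact weakDeriv_eq (toDistr_deriv u.2 m ht)
  rw [h1, derivWithin_of_isOpen isOpen_Ioi ht]
  refine Filter.EventuallyEq.deriv_eq ?_
  filter_upwards [Ioi_mem_nhds ht] with s hs
  exact (if_pos hs).symm

theorem isBounded_timeDeriv : Seminorm.IsBounded (sobolevSeminorms n q) (sobolevSeminorms n q)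
    (timeDeriv (n := n) (q := q)) := by
  rintro ⟨m, j, K⟩
  refine ⟨{(m, j + 1, K)}, 1, fun u => ?_⟩
  rw [one_smul, Finset.sup_singleton]
  refine (norm_restrictDeriv_le_iff ℂ (apply_nonneg _ _)).2 fun t ht => ?_
  rw [iteratedDerivWithin_congr (spaceDeriv_timeDeriv u m) t.2, ← iteratedDerivWithin_succ']
  exact norm_iteratedDerivWithin_le ℂ ht

end SobolevPaths

/-! ## Diffusivity matrices and the operator `𝓛_t` -/

section Diffusivity

open TopologicalSpace

variable (n : ℕ) (q : ℝ≥0∞) [Fact (1 ≤ q)]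

/-- `C^∞(ℝ₊, M_n(ℝ)) ∩ C([0, ∞), M_n(ℝ))`, described through the matrix entries. -/
def matrixPaths : Submodule ℝ (ℝ → Matrix (Fin n) (Fin n) ℝ) where
  carrier := {a | ∀ i j, (fun t => a t i j) ∈ smoothPaths ℝ ℝ ⊓ contPaths ℝ ℝ}
  zero_mem' := fun _ _ => Submodule.zero_mem _
  add_mem' := fun ha hb i j => Submodule.add_mem _ (ha i j) (hb i j)
  smul_mem' := fun c _ ha i j => Submodule.smul_mem _ c (ha i j)

variable {n}

/-- The entry `t ↦ a_{ij}(t)`. -/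
def matrixPaths.entry (i : Fin n × Fin n) :
    matrixPaths n →ₗ[ℝ] (smoothPaths ℝ ℝ ⊓ contPaths ℝ ℝ : Submodule ℝ (ℝ → ℝ)) where
  toFun a := ⟨fun t => a.1 t i.1 i.2, a.2 i.1 i.2⟩
  map_add' _ _ := rfl
  map_smul' _ _ := rfl

variable (n)

/-- The seminorms of `C^∞(ℝ₊, M_n(ℝ)) ∩ C([0, ∞), M_n(ℝ))`: those of `C^∞(ℝ₊) ∩ C([0, ∞))`
applied to all the entries. -/
def matrixSeminorms : SeminormFamily ℝ (matrixPaths n)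
    ((Fin n × Fin n) × ((ℕ × Compacts (Ioi (0 : ℝ))) ⊕ ℕ)) :=
  fun i => (infSeminorms ℝ (smoothSeminorms ℝ ℝ) (contSeminorms ℝ ℝ) i.2).comp
    (matrixPaths.entry i.1)

variable {n q}

theorem toDistr_diffusion (a : Matrix (Fin n) (Fin n) ℝ) {v : LqSpace n q}
    (hv : v ∈ sobolevInfty n q) (m : List (Fin n)) :
    toDistr (∑ i, ∑ j, a i j • weakDeriv (m ++ [i, j]) v) =
      distrDeriv m (toDistr (∑ i, ∑ j, a i j • weakDeriv [i, j] v)) := by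
  have hs : ∀ (c : ℝ) (w : LqSpace n q), c • w = (c : ℂ) • w := fun c w =>
    (RCLike.real_smul_eq_coe_smul (K := ℂ) c w)
  simp only [hs, map_sum, map_smul, toDistr_weakDeriv hv, distrDeriv_append]

open Classical in
/-- The operator `𝓛_t u(t) = ∑_{i,j} a_{ij}(t) ∂²_{x_i x_j} u(t)` on `C^∞(ℝ₊, W^{q,∞}(ℝⁿ))`. -/
def diffusionOp : matrixPaths n →+ sobolevPaths n q →+ sobolevPaths n q :=
  AddMonoidHom.mk' (fun a => AddMonoidHom.mk' (fun u =>
    ⟨fun t => if 0 < t then ∑ i, ∑ j, a.1 t i j • weakDeriv [i, j] (u.1 t) else 0, by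
      refine ⟨fun t ht => ?_, fun m => ?_⟩
      · beta_reduce
        rw [if_pos ht]
        exact fun m => ⟨_, toDistr_diffusion (a.1 t) (u.2.1 t ht) m⟩
      · refine ContDiffOn.congr (f := fun t => ∑ i, ∑ j, a.1 t i j •
          weakDeriv (m ++ [i, j]) (u.1 t)) ?_ fun t ht => ?_
        · exact ContDiffOn.sum fun i _ => ContDiffOn.sum fun j _ =>
            ContDiffOn.smul (a.2 i j).1 (u.2.2 _)
        · beta_reduce
          rw [if_pos (mem_Ioi.1 ht)]
          exact weakDeriv_eq (toDistr_diffusion (a.1 t) (u.2.1 t ht) m)⟩) (by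
      intro u v
      ext1
      funext t
      by_cases ht : 0 < t
      · simp [ht, weakDeriv_add (u.2.1 t ht) (v.2.1 t ht), Finset.sum_add_distrib]
      · simp [ht])) (by
    intro a b
    ext1 u
    ext1
    funext t
    by_cases ht : 0 < t
    · simp [ht, add_smul, Finset.sum_add_distrib]
    · simp [ht])

theorem spaceDeriv_diffusionOp (a : matrixPaths n) (u : sobolevPaths n q) (m : List (Fin n)) :
    EqOn (sobolevPaths.spaceDeriv m (diffusionOp a u)).1
      (fun t => ∑ i, ∑ j, a.1 t i j • (sobolevPaths.spaceDeriv (m ++ [i, j]) u).1 t)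
      (Ioi 0) := by
  intro t ht
  have ht' : 0 < t := ht
  show (if 0 < t then weakDeriv m (if 0 < t then
    ∑ i, ∑ j, a.1 t i j • weakDeriv [i, j] (u.1 t) else 0) else 0) =
    ∑ i, ∑ j, a.1 t i j • (if 0 < t then weakDeriv (m ++ [i, j]) (u.1 t) else 0)
  simp only [if_pos ht']
  exact weakDeriv_eq (toDistr_diffusion (a.1 t) (u.2.1 t ht) m)

theorem bilinBounded_diffusionOp : BilinBounded (matrixSeminorms n) (sobolevSeminorms n q)
    (sobolevSeminorms n q) (diffusionOp (n := n) (q := q)) := by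
  classical
  rintro ⟨m, k, K⟩
  let s : Finset ((Fin n × Fin n) × ((ℕ × Compacts (Ioi (0 : ℝ))) ⊕ ℕ)) :=
    (Finset.univ ×ˢ Finset.range (k + 1)).image fun x => (x.1, Sum.inl (x.2, K))
  let t : Finset (List (Fin n) × (ℕ × Compacts (Ioi (0 : ℝ)))) :=
    ((Finset.univ : Finset (Fin n × Fin n)) ×ˢ Finset.range (k + 1)).image
      fun x => (m ++ [x.1.1, x.1.2], (x.2, K))
  refine ⟨s, t, ∑ _i : Fin n, ∑ _j : Fin n, ∑ c ∈ Finset.range (k + 1), (k.choose c : ℝ),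
    by positivity, fun a u => ?_⟩
  set P := (s.sup (matrixSeminorms n)) a with hP
  set Q := (t.sup (sobolevSeminorms n q)) u with hQ
  have hP0 : 0 ≤ P := apply_nonneg _ _
  have hQ0 : 0 ≤ Q := apply_nonneg _ _
  refine (norm_restrictDeriv_le_iff ℂ (by positivity)).2 fun τ hτ => ?_
  rw [iteratedDerivWithin_congr (spaceDeriv_diffusionOp a u m) τ.2]
  have hsm : ∀ i j, ContDiffOn ℝ ∞ (fun t => a.1 t i j •
      (sobolevPaths.spaceDeriv (m ++ [i, j]) u).1 t) (Ioi 0) := fun i j =>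
    ContDiffOn.smul (a.2 i j).1 (sobolevPaths.spaceDeriv (m ++ [i, j]) u).2
  have hk : ∀ (N : ℕ), ((N : ℕ∞ω) ≤ ((⊤ : ℕ∞) : ℕ∞ω)) := fun N => by exact_mod_cast le_top
  rw [iteratedDerivWithin_fun_sum τ.2 (uniqueDiffOn_Ioi 0)
    (fun i _ => (ContDiffOn.sum fun j _ => (hsm i j).of_le (hk k)) _ τ.2), Finset.sum_mul]
  refine norm_sum_le_of_le _ fun i _ => ?_
  rw [iteratedDerivWithin_fun_sum τ.2 (uniqueDiffOn_Ioi 0)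
    (fun j _ => ((hsm i j).of_le (hk k)) _ τ.2), Finset.sum_mul]
  refine norm_sum_le_of_le _ fun j _ => ?_
  rw [← norm_iteratedFDerivWithin_eq_norm_iteratedDerivWithin]
  refine (norm_iteratedFDerivWithin_smul_le (a.2 i j).1
    (sobolevPaths.spaceDeriv (m ++ [i, j]) u).2 (uniqueDiffOn_Ioi 0) τ.2 (hk k)).trans ?_
  rw [Finset.sum_mul]
  refine Finset.sum_le_sum fun c hc => ?_
  rw [mul_assoc]
  refine mul_le_mul_of_nonneg_left ?_ (by positivity)
  rw [norm_iteratedFDerivWithin_eq_norm_iteratedDerivWithin,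
    norm_iteratedFDerivWithin_eq_norm_iteratedDerivWithin]
  refine mul_le_mul ?_ ?_ (norm_nonneg _) hP0
  · have h1 : matrixSeminorms n ((i, j), Sum.inl (c, K)) ≤ s.sup (matrixSeminorms n) :=
      Finset.le_sup (f := matrixSeminorms n)
        (Finset.mem_image.2 ⟨((i, j), c), by simpa using hc, rfl⟩)
    exact (norm_iteratedDerivWithin_le ℝ
      (g := Submodule.inclusion inf_le_left (matrixPaths.entry (i, j) a)) hτ).trans (h1 a)
  · have h1 : sobolevSeminorms n q (m ++ [i, j], (k - c, K)) ≤ t.sup (sobolevSeminorms n q) :=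
      Finset.le_sup (f := sobolevSeminorms n q)
        (Finset.mem_image.2 ⟨((i, j), k - c), by simp, rfl⟩)
    exact (norm_iteratedDerivWithin_le ℂ
      (g := sobolevPaths.spaceDeriv (m ++ [i, j]) u) hτ).trans (h1 u)

end Diffusivity

/-! ## The heat kernel and the heat operators -/

section Heat

variable {n : ℕ} {q : ℝ≥0∞} [Fact (1 ≤ q)]

/-- `A(t) = ∫₀ᵗ a(s) ds`. -/
def diffusionIntegral (a : ℝ → Matrix (Fin n) (Fin n) ℝ) (t : ℝ) : Matrix (Fin n) (Fin n) ℝ :=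
  Matrix.of fun i j => ∫ s in (0 : ℝ)..t, a s i j

/-- The heat kernel
`𝓦(x; s, t) = ((4π)ⁿ det (A(t) - A(s)))^{-1/2} exp (-⟨x, (A(t) - A(s))⁻¹ x⟩ / 4)`. -/
def heatKernel (a : ℝ → Matrix (Fin n) (Fin n) ℝ) (s t : ℝ) (x : EuclideanSpace ℝ (Fin n)) : ℝ :=
  1 / √((4 * Real.pi) ^ n * (diffusionIntegral a t - diffusionIntegral a s).det) *
    Real.exp (-(1 / 4) *
      (x.ofLp ⬝ᵥ (diffusionIntegral a t - diffusionIntegral a s)⁻¹.mulVec x.ofLp))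

open Classical in
/-- The heat operator on `L^q(ℝⁿ)`: convolution with `𝓦(·; s, t)` for `s < t`, and the identity
for `s = t`. (For a diffusivity matrix `a` the convolution is always in `L^q`, so the last
alternative does not occur.) -/
def heatOp (a : ℝ → Matrix (Fin n) (Fin n) ℝ) (s t : ℝ) (v : LqSpace n q) : LqSpace n q :=
  if s = t then v
  else if h : MemLp (heatKernel a s t ⋆[ContinuousLinearMap.lsmul ℝ ℝ, volume] (v : _ → ℂ)) q
      volume then h.toLp _
  else 0

/-- The Duhamel path `t ↦ W_{0,t} u₀ + ∫₀ᵗ W_{s,t} f(s) ds`, with the Bochner integral of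
`L^q(ℝⁿ)`. -/
def duhamel (a : ℝ → Matrix (Fin n) (Fin n) ℝ) (u₀ : LqSpace n q) (f : ℝ → LqSpace n q) (t : ℝ) :
    LqSpace n q :=
  heatOp a 0 t u₀ + ∫ s in (0 : ℝ)..t, heatOp a s t (f s)

end Heat

/-! ## The very weak Cauchy problem -/

section VeryWeak

variable {Υ : Type*} [PartialOrder Υ] [IsDirectedOrder Υ] [Nonempty Υ] (ς : AsymptoticScale Υ)
variable (n : ℕ) (q : ℝ≥0∞) [Fact (1 ≤ q)]

/-- Nets of diffusivity matrices in `C^∞(ℝ₊, GL(n)) ∩ C([0, ∞), GL(n))`: every `a ε t` is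
symmetric positive definite for `t > 0` and invertible for `t ≥ 0`, and the net is moderate as a
net of paths in the group `GL(n)`, that is, both `a ε` and the inverse paths `b ε` form moderate
nets. -/
def IsDiffusivityNet (a : NetParam → matrixPaths n) : Prop :=
  a ∈ moderateNets ς (matrixSeminorms n) ∧
  (∀ ε t, 0 < t → ((a ε).1 t).PosDef) ∧
  ∃ b ∈ moderateNets ς (matrixSeminorms n), ∀ ε t, 0 ≤ t → (a ε).1 t * (b ε).1 t = 1

/-- The set of initial data: all of `L^q(ℝⁿ)` if `q < ∞`, and the bounded uniformly continuous
functions if `q = ∞`. -/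
def initialData : Set (LqSpace n q) :=
  {v | q = ⊤ → ∃ g : EuclideanSpace ℝ (Fin n) → ℂ, UniformContinuous g ∧ v =ᵐ[volume] g}

/-- The cone of non-negative elements of `L^q(ℝⁿ)`. -/
def nonnegLq : Set (LqSpace n q) := {v | ∀ᵐ x, 0 ≤ (v x).re ∧ (v x).im = 0}

/-- The cone of non-negative elements of `C^∞(ℝ₊, W^{q,∞}(ℝⁿ)) ∩ C([0, ∞), L^q(ℝⁿ))`. -/
def nonnegPaths : Set (solutionSpace n q) := {u | ∀ t, 0 ≤ t → u.1 t ∈ nonnegLq n q}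

/-- The generalised diffusivities, `𝓖(C^∞(ℝ₊, M_n) ∩ C([0, ∞), M_n))`. -/
abbrev GenMatrix : Type := Colombeau ς (matrixSeminorms n)

/-- `𝓖(L^q(ℝⁿ))`. -/
abbrev GenLq : Type := Colombeau ς (lqSeminorms n q)

/-- `𝓖(C^∞(ℝ₊, W^{q,∞}(ℝⁿ)))`. -/
abbrev GenSobolev : Type := Colombeau ς (sobolevSeminorms n q)

/-- `𝓖(C^∞(ℝ₊, W^{q,∞}(ℝⁿ)) ∩ C([0, ∞), L^q(ℝⁿ)))`. -/
abbrev GenSolution : Type := Colombeau ς (solutionSeminorms n q)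

/-- A generalised diffusivity: an element represented by a net of diffusivity matrices. -/
def IsDiffusivity (a : GenMatrix ς n) : Prop :=
  ∃ h, IsDiffusivityNet ς n h ∧ Represents h a

variable {ς n q}

/-- The natural map `𝓖(C^∞(ℝ₊, W^{q,∞}) ∩ C([0, ∞), L^q)) → 𝓖(C^∞(ℝ₊, W^{q,∞}))`. -/
def GenSolution.toSobolev : GenSolution ς n q →ₗ[ℂ] GenSobolev ς n q :=
  Colombeau.map ς _ (isBounded_inclusion_left ℂ _ _)

/-- The restriction `u ↦ u|₀` to `t = 0`. -/
def GenSolution.atZero : GenSolution ς n q →ₗ[ℂ] GenLq ς n q :=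
  Colombeau.map ς _ (isBounded_evalZero n q)

/-- The operator `∂_t [u ε] = [∂_t u ε]`. -/
def GenSobolev.timeDeriv : GenSobolev ς n q →ₗ[ℂ] GenSobolev ς n q :=
  Colombeau.map ς _ isBounded_timeDeriv

/-- The operator `𝓛_t [u ε] = [∑_{i,j} (a ε)_{ij} ∂²_{x_i x_j} u ε]` for `a = [a ε]`. -/
def GenSobolev.diffusion (a : GenMatrix ς n) (u : GenSobolev ς n q) : GenSobolev ς n q :=
  Colombeau.map₂ ς diffusionOp bilinBounded_diffusionOp a u

/-- `u` is given by the Duhamel formula: for all admissible nets `a ε`, `u₀ ε`, `f ε` representing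
`a`, `u₀`, `f`, the paths `t ↦ W_{0,t} (u₀ ε) + ∫₀ᵗ W_{s,t} (f ε)(s) ds`, with the heat operators of
`a ε`, form a moderate net in `C^∞(ℝ₊, W^{q,∞}) ∩ C([0, ∞), L^q)` that represents `u`. -/
def IsDuhamel (a : GenMatrix ς n) (u₀ : GenLq ς n q) (f u : GenSolution ς n q) : Prop :=
  ∀ (aN : NetParam → matrixPaths n) (u₀N : NetParam → LqSpace n q)
    (fN : NetParam → solutionSpace n q),
    IsDiffusivityNet ς n aN → Represents aN a →
    (∀ ε, u₀N ε ∈ initialData n q) → Represents u₀N u₀ → Represents fN f →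
    ∃ uN : NetParam → solutionSpace n q, Represents uN u ∧
      ∀ ε t, 0 ≤ t → (uN ε).1 t = duhamel (aN ε).1 (u₀N ε) (fN ε).1 t

end VeryWeak

end

/-!
# Generalised solutions of the Cauchy problem with very weak diffusivity

*One problem.* Everything rests on the heat semigroup `T_B = e^{∑ B_{ij} ∂_i ∂_j}`, indexed by the
positive semidefinite matrices `B` and defined as the average of the translates `v(· - S z)` over a
centred Gaussian vector `z` of covariance `2`, where `S Sᵀ = B`. In this form no inverse or
determinant of `B` occurs, `T_B` is a contraction of `L^q` for every `q ∈ [1, ∞]`, and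
`T_{A + B} = T_A T_B` says that independent Gaussian vectors add up (`heatSemigroup_add`).
Convolution with the kernel `𝓦(·; s, t)` is `T_B` for
`B = A(t) - A(s)` (`IsElliptic.heatOp_eq`), so the operators `W_{s,t}` form an evolution family.

Gaussian integration by parts gives the heat equation in integrated form,
`T_B w - w = ∫₀¹ 2r T_{r² B} (∑ B_{ij} ∂_i ∂_j w) dr` (`heatSemigroup_sub_eq`), hence expansions of
`T_B` of first and second order at `B = 0`, and the smoothing estimate
`‖∂_x^m T_A v‖ ≤ C c^{-|m|/2} ‖v‖` for `A ≥ c` (`norm_weakDeriv_heatSemigroup_le`). Together they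
yield `‖T_A v - T_{A'} v‖ ≤ C (η / c) ‖v‖` if `A, A' ≥ c` and `η` bounds the entries of `A - A'`
(`norm_heatSemigroup_sub_heatSemigroup_le_of_abs`).

By the evolution law the Duhamel path `u` may be restarted at any time `s > 0`
(`IsElliptic.mildSolution_split`). It follows that `u(t)` is smooth in `x`, that its spatial
derivatives are continuous in `t`, and that they have the right derivatives which the equation
predicts; these are continuous, so the equation holds (`IsElliptic.hasDerivAt_mildSolution`) and `u`
is smooth in `t` by bootstrapping. Continuity at `t = 0` is the strong continuity of the heat
semigroup: it holds on all of `L^q` for `q < ∞`, and on the uniformly continuous functions for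
`q = ∞` (`tendsto_heatSemigroup`).

*Nets.* The inverse of a diffusivity net is moderate, so on every bounded interval `a_ε ≥ 1 / K_ε`
with a moderate net `K_ε` (`IsDiffusivityNet.exists_isElliptic`). All constants above are polynomial
in `√K_ε`, `K_ε` and the norms of the data, so the Duhamel paths form a moderate net; seminorms with
time derivatives are reduced to spatial ones by the equation (`CauchyNet.path_mem_moderateNets`).
In the same way, the difference of the Duhamel paths of two equivalent nets of data is estimated by
differences of the data times moderate factors, so it is negligible
(`CauchyNet.Equivalent.path_sub_mem_negligibleNets`). Thus the class of the Duhamel net does not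
depend on the representatives, which is existence. Uniqueness holds because the formula prescribes
the paths on `[0, ∞)`, and the Cauchy problem holds for each `ε`.

*Positivity.* The heat semigroup and the Bochner integral preserve the closed convex cone of
non-negative functions. If `q = ∞`, a representative of `u₀` has to be found that is both
non-negative and uniformly continuous: the positive part of the real part of a uniformly continuous
one, which differs from it by a negligible net (`CauchyNet.exists_isDataFor_nonneg`).
-/

noncomputable section

/-! ### Averages of translates on `L^q` -/

section Averages

variable {n : ℕ} {q : ℝ≥0∞} {Ω : Type*} [MeasurableSpace Ω]
  {P : Measure Ω} {ρ : Ω → ℝ} {Y : Ω → EuclideanSpace ℝ (Fin n)}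

theorem quasiMeasurePreserving_sub [SFinite P] (hY : Measurable Y) :
    Measure.QuasiMeasurePreserving
      (fun x : EuclideanSpace ℝ (Fin n) × Ω => x.1 - Y x.2) (volume.prod P) volume := by
  refine ⟨by fun_prop, Measure.AbsolutelyContinuous.mk fun s hs h0 => ?_⟩
  rw [Measure.map_apply (by fun_prop) hs,
    Measure.prod_apply_symm ((by fun_prop : Measurable fun x : EuclideanSpace ℝ (Fin n) × Ω =>
      x.1 - Y x.2) hs)]
  refine (lintegral_congr fun τ => ?_).trans lintegral_zero
  have : (fun x => (x, τ)) ⁻¹' ((fun x : EuclideanSpace ℝ (Fin n) × Ω => x.1 - Y x.2) ⁻¹' s)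
      = (fun x => x - Y τ) ⁻¹' s := rfl
  rw [this]
  exact (measurePreserving_sub_right volume (Y τ)).quasiMeasurePreserving.preimage_null h0

theorem aestronglyMeasurable_translate [SFinite P] (hρ : AEStronglyMeasurable ρ P)
    (hY : Measurable Y) {v : EuclideanSpace ℝ (Fin n) → ℂ} (hv : AEStronglyMeasurable v volume) :
    AEStronglyMeasurable (fun x : EuclideanSpace ℝ (Fin n) × Ω => ρ x.2 • v (x.1 - Y x.2))
      (volume.prod P) :=
  hρ.comp_snd.smul (hv.comp_quasiMeasurePreserving (quasiMeasurePreserving_sub hY))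

/-- Jensen's inequality for the power `p` and the weight `‖ρ‖ₑ`, which need not have mass `1`. -/
theorem lintegral_rpow_le_mul_lintegral_rpow (hρ : AEStronglyMeasurable ρ P) {h : Ω → ℂ}
    (hh : AEStronglyMeasurable h P) {p : ℝ} (hp : 1 ≤ p) :
    (∫⁻ τ, ‖ρ τ • h τ‖ₑ ∂P) ^ p ≤
      (∫⁻ τ, ‖ρ τ‖ₑ ∂P) ^ (p - 1) * ∫⁻ τ, ‖ρ τ‖ₑ * ‖h τ‖ₑ ^ p ∂P := by
  have hp0 : 0 < p := by linarith
  have hac : P.withDensity (fun τ => ‖ρ τ‖ₑ) ≪ P := withDensity_absolutelyContinuous _ _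
  -- comparison of the `L¹` and `L^p` norms of `h` for the finite measure `‖ρ‖ₑ P`
  have H := eLpNorm'_le_eLpNorm'_mul_rpow_measure_univ (p := 1) (q := p) one_pos hp
    (hh.mono_ac hac)
  rw [eLpNorm', eLpNorm', withDensity_apply _ MeasurableSet.univ, Measure.restrict_univ] at H
  simp only [ENNReal.rpow_one, div_one] at H
  rw [lintegral_withDensity_eq_lintegral_mul₀ hρ.enorm hh.enorm,
    lintegral_withDensity_eq_lintegral_mul₀ hρ.enorm (hh.enorm.pow_const _)] at H
  simp only [Pi.mul_apply] at H
  simp only [enorm_smul]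
  calc _ ≤ _ := ENNReal.rpow_le_rpow H hp0.le
    _ = _ := by
      rw [ENNReal.mul_rpow_of_nonneg _ _ hp0.le, ← ENNReal.rpow_mul, ← ENNReal.rpow_mul,
        mul_comm, one_div, inv_mul_cancel₀ hp0.ne', ENNReal.rpow_one, sub_mul,
        inv_mul_cancel₀ hp0.ne', one_mul]

/-- Young's inequality for averages of translates. The lower integral on the left makes sense for
all `x`, so it can be used to prove that the average exists almost everywhere. -/
theorem eLpNorm_average_le [SFinite P] [hq : Fact (1 ≤ q)] (hρ : Integrable ρ P)
    (hY : Measurable Y) {v : EuclideanSpace ℝ (Fin n) → ℂ} (hv : AEStronglyMeasurable v volume) :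
    eLpNorm (fun x => ∫⁻ τ, ‖ρ τ • v (x - Y τ)‖ₑ ∂P) q volume ≤
      (∫⁻ τ, ‖ρ τ‖ₑ ∂P) * eLpNorm v q volume := by
  have hmeas := aestronglyMeasurable_translate hρ.1 hY hv
  have hv' : AEStronglyMeasurable (fun x : EuclideanSpace ℝ (Fin n) × Ω => v (x.1 - Y x.2))
      (volume.prod P) := hv.comp_quasiMeasurePreserving (quasiMeasurePreserving_sub hY)
  rcases eq_or_ne q ⊤ with rfl | hqt
  · rw [eLpNorm_exponent_top, eLpNorm_exponent_top]
    refine essSup_le_of_ae_le _ ?_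
    have h1 : ∀ᵐ x : EuclideanSpace ℝ (Fin n) × Ω ∂(volume.prod P),
        ‖v (x.1 - Y x.2)‖ₑ ≤ eLpNormEssSup v volume :=
      (quasiMeasurePreserving_sub (P := P) hY).ae (enorm_ae_le_eLpNormEssSup v volume)
    filter_upwards [Measure.ae_ae_of_ae_prod h1] with x hx
    rw [enorm_eq_self, ← lintegral_mul_const'' _ hρ.1.enorm]
    refine lintegral_mono_ae ?_
    filter_upwards [hx] with τ hτ
    rw [enorm_smul]
    gcongr
  · have hq1 : 1 ≤ q.toReal := by
      simpa using ENNReal.toReal_mono hqt hq.out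
    have hq0 : q ≠ 0 := (zero_lt_one.trans_le hq.out).ne'
    have hp0 : 0 < q.toReal := by linarith
    rw [eLpNorm_eq_lintegral_rpow_enorm_toReal hq0 hqt,
      eLpNorm_eq_lintegral_rpow_enorm_toReal hq0 hqt]
    simp only [enorm_eq_self]
    have key : ∫⁻ x, (∫⁻ τ, ‖ρ τ • v (x - Y τ)‖ₑ ∂P) ^ q.toReal ≤
        (∫⁻ τ, ‖ρ τ‖ₑ ∂P) ^ q.toReal * ∫⁻ x, ‖v x‖ₑ ^ q.toReal := by
      calc _ ≤ ∫⁻ x, (∫⁻ τ, ‖ρ τ‖ₑ ∂P) ^ (q.toReal - 1) *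
            ∫⁻ τ, ‖ρ τ‖ₑ * ‖v (x - Y τ)‖ₑ ^ q.toReal ∂P := by
              refine lintegral_mono_ae ?_
              filter_upwards [hv'.prodMk_left] with x hx
              exact lintegral_rpow_le_mul_lintegral_rpow hρ.1 hx hq1
        _ = (∫⁻ τ, ‖ρ τ‖ₑ ∂P) ^ (q.toReal - 1) *
            ∫⁻ x, ∫⁻ τ, ‖ρ τ‖ₑ * ‖v (x - Y τ)‖ₑ ^ q.toReal ∂P :=
              lintegral_const_mul' _ _ (ENNReal.rpow_ne_top_of_nonneg (by linarith)
                hρ.2.ne)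
        _ = (∫⁻ τ, ‖ρ τ‖ₑ ∂P) ^ (q.toReal - 1) *
            ∫⁻ τ, (∫⁻ x, ‖ρ τ‖ₑ * ‖v (x - Y τ)‖ₑ ^ q.toReal) ∂P := by
              rw [lintegral_lintegral_swap]
              exact hρ.1.comp_snd.enorm.mul (hv'.enorm.pow_const _)
        _ = (∫⁻ τ, ‖ρ τ‖ₑ ∂P) ^ (q.toReal - 1) *
            ∫⁻ τ, ‖ρ τ‖ₑ * (∫⁻ x, ‖v x‖ₑ ^ q.toReal) ∂P := by
              congr 1
              refine lintegral_congr fun τ => ?_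
              rw [lintegral_const_mul' _ _ enorm_ne_top,
                lintegral_sub_right_eq_self (fun x => ‖v x‖ₑ ^ q.toReal)]
        _ = _ := by
              rw [lintegral_mul_const'' _ hρ.1.enorm, ← mul_assoc]
              congr 1
              conv_lhs => rw [← ENNReal.rpow_one (∫⁻ τ, ‖ρ τ‖ₑ ∂P)]
              rw [← ENNReal.rpow_mul, one_mul, ← ENNReal.rpow_add_of_nonneg _ _
                (by linarith) zero_le_one, sub_add_cancel]
    refine (ENNReal.rpow_le_rpow key (by positivity)).trans_eq ?_
    rw [ENNReal.mul_rpow_of_nonneg _ _ (by positivity), ← ENNReal.rpow_mul, one_div,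
      mul_inv_cancel₀ hp0.ne', ENNReal.rpow_one]

variable [Fact (1 ≤ q)]

theorem ae_integrable_average [SFinite P] (hρ : Integrable ρ P) (hY : Measurable Y)
    (v : LqSpace n q) : ∀ᵐ x, Integrable (fun τ => ρ τ • v (x - Y τ)) P := by
  have hv := (Lp.memLp v).1
  have hmeas := aestronglyMeasurable_translate hρ.1 hY hv
  have h1 : eLpNorm (fun x => ∫⁻ τ, ‖ρ τ • v (x - Y τ)‖ₑ ∂P) q volume < ⊤ :=
    (eLpNorm_average_le hρ hY hv).trans_lt (ENNReal.mul_lt_top hρ.2 (Lp.memLp v).2)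
  have h2 : AEMeasurable (fun x => ∫⁻ τ, ‖ρ τ • v (x - Y τ)‖ₑ ∂P) volume :=
    hmeas.enorm.lintegral_prod_right'
  have h3 : ∀ᵐ x, ∫⁻ τ, ‖ρ τ • v (x - Y τ)‖ₑ ∂P < ⊤ := by
    rcases eq_or_ne q ⊤ with rfl | hqt
    · rw [eLpNorm_exponent_top] at h1
      filter_upwards [ENNReal.ae_le_essSup (μ := volume)
        fun x => ∫⁻ τ, ‖ρ τ • v (x - Y τ)‖ₑ ∂P] with x hx
      exact hx.trans_lt (by simpa [eLpNormEssSup] using h1)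
    · have hq0 : q ≠ 0 := (zero_lt_one.trans_le (Fact.out : 1 ≤ q)).ne'
      have hp0 := ENNReal.toReal_pos hq0 hqt
      rw [eLpNorm_lt_top_iff_lintegral_rpow_enorm_lt_top hq0 hqt] at h1
      simp only [enorm_eq_self] at h1
      filter_upwards [ae_lt_top' (h2.pow_const _) h1.ne] with x hx
      exact (ENNReal.rpow_lt_top_iff_of_pos hp0).1 hx
  filter_upwards [h3, hmeas.prodMk_left] with x hx hm
  exact ⟨hm, hx⟩

theorem memLp_average [SFinite P] (hρ : Integrable ρ P) (hY : Measurable Y) (v : LqSpace n q) :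
    MemLp (fun x => ∫ τ, ρ τ • v (x - Y τ) ∂P) q volume ∧
    eLpNorm (fun x => ∫ τ, ρ τ • v (x - Y τ) ∂P) q volume ≤
      (∫⁻ τ, ‖ρ τ‖ₑ ∂P) * eLpNorm v q volume := by
  have hv := (Lp.memLp v).1
  have hmeas := aestronglyMeasurable_translate hρ.1 hY hv
  have h1 : eLpNorm (fun x => ∫ τ, ρ τ • v (x - Y τ) ∂P) q volume ≤
      (∫⁻ τ, ‖ρ τ‖ₑ ∂P) * eLpNorm v q volume := by
    refine le_trans (eLpNorm_mono_enorm fun x => ?_) (eLpNorm_average_le hρ hY hv)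
    rw [enorm_eq_self]
    exact enorm_integral_le_lintegral_enorm _
  exact ⟨⟨hmeas.integral_prod_right', h1.trans_lt (ENNReal.mul_lt_top hρ.2 (Lp.memLp v).2)⟩, h1⟩

/-- Averages of translates do not depend on the representative of an element of `L^q`: the
representatives `v`, `w` agree at `x - Y(τ)` for almost all `x` and `τ`, even if the distribution of
`Y` is singular. -/
theorem ae_ae_eq_translate [SFinite P] (hY : Measurable Y)
    {v w : EuclideanSpace ℝ (Fin n) → ℂ} (h : v =ᵐ[volume] w) :
    ∀ᵐ x, ∀ᵐ τ ∂P, v (x - Y τ) = w (x - Y τ) :=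
  Measure.ae_ae_of_ae_prod ((quasiMeasurePreserving_sub (P := P) hY).ae h)

/-- The weighted average of translates `v ↦ ∫ ρ(τ) v(· - Y(τ)) dP(τ)`, a bounded operator on
`L^q(ℝⁿ)`. Convolution with an integrable kernel is the case where `Y` is the identity, but letting
`Y` vary makes changes of variables in the kernel superfluous. -/
def translateAverage [SFinite P] (hρ : Integrable ρ P) (hY : Measurable Y) :
    LqSpace n q →L[ℂ] LqSpace n q :=
  LinearMap.mkContinuous
    { toFun := fun v => (memLp_average hρ hY v).1.toLp _
      map_add' := fun v w => by
        rw [← MemLp.toLp_add]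
        refine (MemLp.toLp_eq_toLp_iff _ _).2 ?_
        filter_upwards [ae_ae_eq_translate (P := P) hY (Lp.coeFn_add v w),
          ae_integrable_average hρ hY v, ae_integrable_average hρ hY w] with x hx hv hw
        rw [Pi.add_apply, ← integral_add hv hw]
        refine integral_congr_ae ?_
        filter_upwards [hx] with τ hτ
        rw [hτ, Pi.add_apply, smul_add]
      map_smul' := fun c v => by
        rw [RingHom.id_apply, ← MemLp.toLp_const_smul]
        refine (MemLp.toLp_eq_toLp_iff _ _).2 ?_
        filter_upwards [ae_ae_eq_translate (P := P) hY (Lp.coeFn_smul c v)] with x hx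
        rw [Pi.smul_apply, ← integral_smul]
        refine integral_congr_ae ?_
        filter_upwards [hx] with τ hτ
        rw [hτ, Pi.smul_apply, smul_comm] }
    (∫ τ, ‖ρ τ‖ ∂P) (fun v => by
      show ‖(memLp_average hρ hY v).1.toLp _‖ ≤ _
      rw [Lp.norm_toLp, Lp.norm_def, integral_norm_eq_lintegral_enorm hρ.1, ← ENNReal.toReal_mul]
      exact ENNReal.toReal_mono (ENNReal.mul_lt_top hρ.2 (Lp.memLp v).2).ne
        (memLp_average hρ hY v).2)

theorem coeFn_translateAverage [SFinite P] (hρ : Integrable ρ P) (hY : Measurable Y)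
    (v : LqSpace n q) :
    translateAverage hρ hY v =ᵐ[volume] fun x => ∫ τ, ρ τ • v (x - Y τ) ∂P :=
  MemLp.coeFn_toLp (memLp_average hρ hY v).1

theorem norm_translateAverage_le [SFinite P] (hρ : Integrable ρ P) (hY : Measurable Y)
    (v : LqSpace n q) : ‖translateAverage hρ hY v‖ ≤ (∫ τ, ‖ρ τ‖ ∂P) * ‖v‖ :=
  ContinuousLinearMap.le_of_opNorm_le _
    (LinearMap.mkContinuous_norm_le _ (integral_nonneg fun _ => norm_nonneg _) _) v

theorem toDistr_apply (v : LqSpace n q) (φ : 𝓢(EuclideanSpace ℝ (Fin n), ℂ)) :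
    toDistr v φ = ∫ x, φ x • v x :=
  Lp.toTemperedDistribution_apply v φ

theorem integrable_schwartz_smul (v : LqSpace n q) (φ : 𝓢(EuclideanSpace ℝ (Fin n), ℂ)) :
    Integrable (fun x => φ x • v x) := by
  have : ENNReal.HolderConjugate q (1 - q⁻¹)⁻¹ :=
    ENNReal.HolderConjugate.inv_one_sub_inv' Fact.out
  have : ENNReal.HolderConjugate (1 - q⁻¹)⁻¹ q := ENNReal.HolderConjugate.symm
  rw [← memLp_one_iff_integrable]
  exact (Lp.memLp v).smul (p := (1 - q⁻¹)⁻¹) (r := 1)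
    (φ.memLp (1 - q⁻¹)⁻¹ (volume : Measure (EuclideanSpace ℝ (Fin n))))

/-- The translate `φ(· + y)`. -/
abbrev schwartzTranslate (y : EuclideanSpace ℝ (Fin n)) (φ : 𝓢(EuclideanSpace ℝ (Fin n), ℂ)) :
    𝓢(EuclideanSpace ℝ (Fin n), ℂ) := φ.compSubConstCLM ℂ (-y)

theorem schwartzTranslate_apply (y x : EuclideanSpace ℝ (Fin n))
    (φ : 𝓢(EuclideanSpace ℝ (Fin n), ℂ)) :
    schwartzTranslate y φ x = φ (x + y) := by simp [schwartzTranslate]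

theorem lineDeriv_schwartzTranslate (y e : EuclideanSpace ℝ (Fin n))
    (φ : 𝓢(EuclideanSpace ℝ (Fin n), ℂ)) :
    ∂_{e} (schwartzTranslate y φ) = schwartzTranslate y (∂_{e} φ) := by
  ext x
  simp only [SchwartzMap.lineDerivOp_apply_eq_fderiv, schwartzTranslate_apply]
  congr 1
  have : (schwartzTranslate y φ : EuclideanSpace ℝ (Fin n) → ℂ) = fun x => φ (x + y) :=
    funext fun x => schwartzTranslate_apply y x φ
  rw [this, fderiv_comp_add_right]

/-- Hölder's inequality, with the same constant (a norm of `φ`) for all the translates of `φ`. -/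
theorem exists_norm_toDistr_translate_le (φ : 𝓢(EuclideanSpace ℝ (Fin n), ℂ)) :
    ∃ C, 0 ≤ C ∧ ∀ (v : LqSpace n q) y, ∫ x, ‖φ (x + y) • v x‖ ≤ C * ‖v‖ := by
  have : ENNReal.HolderConjugate q (1 - q⁻¹)⁻¹ :=
    ENNReal.HolderConjugate.inv_one_sub_inv' Fact.out
  have : ENNReal.HolderConjugate (1 - q⁻¹)⁻¹ q := ENNReal.HolderConjugate.symm
  refine ⟨(eLpNorm φ (1 - q⁻¹)⁻¹ volume).toReal, by positivity, fun v y => ?_⟩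
  have hφ := φ.memLp (1 - q⁻¹)⁻¹ (volume : Measure (EuclideanSpace ℝ (Fin n)))
  have hm := measurePreserving_add_right (volume : Measure (EuclideanSpace ℝ (Fin n))) y
  have h1 := eLpNorm_comp_measurePreserving (p := (1 - q⁻¹)⁻¹) hφ.1 hm
  have h2 : eLpNorm ((fun x => φ (x + y)) • (v : _ → ℂ)) 1 volume ≤ _ :=
    eLpNorm_smul_le_mul_eLpNorm (p := (1 - q⁻¹)⁻¹) (q := q) (Lp.memLp v).1
    (hφ.comp_measurePreserving hm).1
  rw [show (fun x => φ (x + y)) = φ ∘ fun x => x + y from rfl, h1] at h2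
  rw [integral_norm_eq_lintegral_enorm (by
    have := (integrable_schwartz_smul v (schwartzTranslate y φ)).1
    simpa only [schwartzTranslate_apply] using this), Lp.norm_def, ← ENNReal.toReal_mul]
  refine ENNReal.toReal_mono (ENNReal.mul_lt_top hφ.2 (Lp.memLp v).2).ne ?_
  rw [eLpNorm_one_eq_lintegral_enorm] at h2
  exact h2

theorem integrable_prod_translate [SFinite P] (hρ : Integrable ρ P) (hY : Measurable Y)
    (v : LqSpace n q) (φ : 𝓢(EuclideanSpace ℝ (Fin n), ℂ)) :
    Integrable (fun x : EuclideanSpace ℝ (Fin n) × Ω => ρ x.2 • (φ (x.1 + Y x.2) • v x.1))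
      (volume.prod P) := by
  obtain ⟨C, hC0, hC⟩ := exists_norm_toDistr_translate_le (q := q) φ
  have hm : AEStronglyMeasurable
      (fun x : EuclideanSpace ℝ (Fin n) × Ω => ρ x.2 • (φ (x.1 + Y x.2) • v x.1))
      (volume.prod P) := by
    have h1 : AEStronglyMeasurable
        (fun x : EuclideanSpace ℝ (Fin n) × Ω => φ (x.1 + Y x.2)) (volume.prod P) :=
      (φ.continuous.measurable.comp (by fun_prop :
        Measurable fun x : EuclideanSpace ℝ (Fin n) × Ω => x.1 + Y x.2)).aestronglyMeasurable
    exact hρ.1.comp_snd.smul (h1.smul (Lp.memLp v).1.comp_fst)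
  rw [integrable_prod_iff' hm]
  refine ⟨Eventually.of_forall fun τ => ?_, ?_⟩
  · beta_reduce
    have := integrable_schwartz_smul v (schwartzTranslate (Y τ) φ)
    simp only [schwartzTranslate_apply] at this
    exact this.smul (ρ τ)
  · refine Integrable.mono' (g := fun τ => ‖ρ τ‖ * (C * ‖v‖)) (hρ.norm.mul_const _)
      hm.norm.prod_swap.integral_prod_right' (Eventually.of_forall fun τ => ?_)
    simp only [norm_smul (ρ τ), integral_const_mul]
    rw [norm_mul, norm_norm, Real.norm_of_nonneg (integral_nonneg fun _ => norm_nonneg _)]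
    exact mul_le_mul_of_nonneg_left (hC v (Y τ)) (norm_nonneg _)

/-- Tested against `φ`, an average of translates becomes a scalar integral of the pairings of `v`
with translates of `φ`. All identities between averages are reduced to this formula. -/
theorem toDistr_translateAverage [SFinite P] (hρ : Integrable ρ P) (hY : Measurable Y)
    (v : LqSpace n q) (φ : 𝓢(EuclideanSpace ℝ (Fin n), ℂ)) :
    toDistr (translateAverage hρ hY v) φ = ∫ τ, ρ τ • toDistr v (schwartzTranslate (Y τ) φ) ∂P := by
  have hint := integrable_prod_translate hρ hY v φ
  -- the shear `(x, τ) ↦ (x - Y τ, τ)` preserves the product measure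
  have hmp : MeasurePreserving (fun x : EuclideanSpace ℝ (Fin n) × Ω => (x.1 - Y x.2, x.2))
      (volume.prod P) (volume.prod P) := by
    have := MeasurePreserving.skew_product (μa := P) (μb := P)
      (μc := (volume : Measure (EuclideanSpace ℝ (Fin n))))
      (μd := (volume : Measure (EuclideanSpace ℝ (Fin n)))) (MeasurePreserving.id P)
      (g := fun τ x => x - Y τ) (by fun_prop)
      (Eventually.of_forall fun τ => (measurePreserving_sub_right volume (Y τ)).map_eq)
    exact (Measure.measurePreserving_swap.comp (this.comp Measure.measurePreserving_swap))
  have hint' := hmp.integrable_comp_of_integrable hint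
  simp only [Function.comp_def, sub_add_cancel] at hint'
  calc toDistr (translateAverage hρ hY v) φ
      = ∫ x, ∫ τ, ρ τ • (φ x • v (x - Y τ)) ∂P := by
        rw [toDistr_apply]
        refine integral_congr_ae ?_
        filter_upwards [coeFn_translateAverage hρ hY v] with x hx
        rw [hx, ← integral_smul]
        exact integral_congr_ae (Eventually.of_forall fun τ => smul_comm _ _ _)
    _ = ∫ τ, (∫ x, ρ τ • (φ x • v (x - Y τ))) ∂P := integral_integral_swap hint'
    _ = _ := by
        refine integral_congr_ae (Eventually.of_forall fun τ => ?_)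
        beta_reduce
        rw [integral_smul, toDistr_apply]
        congr 1
        simp only [schwartzTranslate_apply]
        conv_lhs => rw [← integral_add_right_eq_self _ (Y τ)]
        simp

/-- An average of translates is the transpose of the average of the opposite translates. -/
theorem toDistr_translateAverage' [SFinite P] (hρ : Integrable ρ P) (hY : Measurable Y)
    (v : LqSpace n q) (φ : 𝓢(EuclideanSpace ℝ (Fin n), ℂ)) :
    toDistr (translateAverage hρ hY v) φ = ∫ x, (∫ τ, ρ τ • φ (x + Y τ) ∂P) * v x := by
  rw [toDistr_translateAverage]
  simp only [toDistr_apply, ← integral_smul, schwartzTranslate_apply]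
  rw [← integral_integral_swap (f := fun x τ => ρ τ • (φ (x + Y τ) • v x))
    (integrable_prod_translate hρ hY v φ)]
  refine integral_congr_ae (Eventually.of_forall fun x => ?_)
  beta_reduce
  rw [← integral_mul_const]
  refine integral_congr_ae (Eventually.of_forall fun τ => ?_)
  simp [mul_assoc]

/-- `ψ = ± ∂^m φ`, so one and the same test function `ψ` serves all the translates of `φ`. -/
theorem exists_distrDeriv_translate (m : List (Fin n)) (φ : 𝓢(EuclideanSpace ℝ (Fin n), ℂ)) :
    ∃ ψ : 𝓢(EuclideanSpace ℝ (Fin n), ℂ), ∀ T y,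
      distrDeriv m T (schwartzTranslate y φ) = T (schwartzTranslate y ψ) := by
  induction m generalizing φ with
  | nil => exact ⟨φ, fun T y => rfl⟩
  | cons i m ih =>
    obtain ⟨ψ, hψ⟩ := ih (-(∂_{EuclideanSpace.single i (1 : ℝ)} φ))
    refine ⟨ψ, fun T y => ?_⟩
    rw [← hψ]
    show distrDeriv m T (-(∂_{EuclideanSpace.single i (1 : ℝ)} (schwartzTranslate y φ))) = _
    rw [lineDeriv_schwartzTranslate]
    exact congrArg _ (map_neg (SchwartzMap.compSubConstCLM ℂ (-y)) _).symm

theorem schwartzTranslate_zero (φ : 𝓢(EuclideanSpace ℝ (Fin n), ℂ)) :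
    schwartzTranslate 0 φ = φ := by
  ext x
  simp

/-- Averages of translates commute with distributional derivatives. -/
theorem toDistr_translateAverage_of_distrDeriv [SFinite P] (hρ : Integrable ρ P)
    (hY : Measurable Y) {v w : LqSpace n q} {m : List (Fin n)}
    (h : toDistr w = distrDeriv m (toDistr v)) :
    toDistr (translateAverage hρ hY w) = distrDeriv m (toDistr (translateAverage hρ hY v)) := by
  ext φ
  obtain ⟨ψ, hψ⟩ := exists_distrDeriv_translate m φ
  have h1 := hψ (toDistr (translateAverage hρ hY v)) 0
  rw [schwartzTranslate_zero, schwartzTranslate_zero] at h1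
  rw [h1, toDistr_translateAverage, toDistr_translateAverage]
  simp only [h, hψ]

theorem translateAverage_mem_sobolevInfty [SFinite P] (hρ : Integrable ρ P)
    (hY : Measurable Y) {v : LqSpace n q} (hv : v ∈ sobolevInfty n q) :
    translateAverage hρ hY v ∈ sobolevInfty n q := fun m =>
  ⟨_, toDistr_translateAverage_of_distrDeriv hρ hY (toDistr_weakDeriv hv m)⟩

theorem weakDeriv_translateAverage [SFinite P] (hρ : Integrable ρ P)
    (hY : Measurable Y) {v : LqSpace n q} (hv : v ∈ sobolevInfty n q) (m : List (Fin n)) :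
    weakDeriv m (translateAverage hρ hY v) = translateAverage hρ hY (weakDeriv m v) :=
  weakDeriv_eq (toDistr_translateAverage_of_distrDeriv hρ hY (toDistr_weakDeriv hv m))

theorem toDistr_ext {v w : LqSpace n q} (h : ∀ φ, toDistr v φ = toDistr w φ) : v = w :=
  toDistr_injective (by ext φ; exact h φ)

end Averages

/-! ### Gaussian averages and the semigroup law -/

section Gaussian

variable {n : ℕ} {q : ℝ≥0∞}

/-- The density `(4π)^{-n/2} exp (-|z|² / 4)` of the heat kernel at time `1`. -/
def gaussDensity (z : EuclideanSpace ℝ (Fin n)) : ℝ :=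
  1 / √((4 * Real.pi) ^ n) * Real.exp (-(1 / 4) * ‖z‖ ^ 2)

theorem gaussDensity_nonneg (z : EuclideanSpace ℝ (Fin n)) : 0 ≤ gaussDensity z := by
  unfold gaussDensity; positivity

@[fun_prop]
theorem continuous_gaussDensity : Continuous (gaussDensity (n := n)) := by
  unfold gaussDensity; fun_prop

theorem integrable_exp_neg_mul_norm_sq {b : ℝ} (hb : 0 < b) :
    Integrable fun z : EuclideanSpace ℝ (Fin n) => Real.exp (-b * ‖z‖ ^ 2) := by
  have h := (GaussianFourier.integrable_cexp_neg_mul_sq_norm_add (V := EuclideanSpace ℝ (Fin n))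
    (b := b) (by simpa using hb) 0 0).re
  refine h.congr (Eventually.of_forall fun z => ?_)
  simp only [zero_mul, add_zero]
  rw [show (-(b : ℂ) * (‖z‖ : ℂ) ^ 2) = ((-b * ‖z‖ ^ 2 : ℝ) : ℂ) by push_cast; ring,
    ← Complex.ofReal_exp]
  rfl

theorem integrable_gaussDensity : Integrable (gaussDensity (n := n)) :=
  (integrable_exp_neg_mul_norm_sq (by norm_num)).const_mul _

theorem integrable_norm_mul_gaussDensity :
    Integrable fun z : EuclideanSpace ℝ (Fin n) => ‖z‖ * gaussDensity z := by
  refine Integrable.mono' (g := fun z => 1 / √((4 * Real.pi) ^ n) *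
    (2 * Real.exp (-(1 / 8) * ‖z‖ ^ 2)))
    (((integrable_exp_neg_mul_norm_sq (by norm_num)).const_mul _).const_mul _)
    (by fun_prop) (Eventually.of_forall fun z => ?_)
  rw [Real.norm_of_nonneg (mul_nonneg (norm_nonneg _) (gaussDensity_nonneg z)), gaussDensity,
    mul_left_comm]
  refine mul_le_mul_of_nonneg_left ?_ (by positivity)
  -- half of the exponent `-|z|² / 4` absorbs the factor `|z|`
  have h1 : ‖z‖ ≤ 2 * Real.exp (1 / 8 * ‖z‖ ^ 2) := by
    have := Real.add_one_le_exp (1 / 8 * ‖z‖ ^ 2)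
    nlinarith [sq_nonneg (‖z‖ - 2)]
  calc _ ≤ 2 * Real.exp (1 / 8 * ‖z‖ ^ 2) * Real.exp (-(1 / 4) * ‖z‖ ^ 2) := by gcongr
    _ = _ := by rw [mul_assoc, ← Real.exp_add]; ring_nf

theorem integral_gaussDensity : ∫ z : EuclideanSpace ℝ (Fin n), gaussDensity z = 1 := by
  unfold gaussDensity
  rw [integral_const_mul, GaussianFourier.integral_rexp_neg_mul_sq_norm (by norm_num),
    finrank_euclideanSpace_fin, show Real.pi / (1 / 4) = 4 * Real.pi by ring, Real.sqrt_eq_rpow,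
    ← Real.rpow_natCast, ← Real.rpow_mul (by positivity), mul_one_div]
  exact one_div_mul_cancel (by positivity)

theorem hasLineDerivAt_gaussDensity (z e : EuclideanSpace ℝ (Fin n)) :
    HasLineDerivAt ℝ gaussDensity (-(1 / 2) * inner ℝ z e * gaussDensity z) z e := by
  have h1 : HasFDerivAt (fun z : EuclideanSpace ℝ (Fin n) => ‖z‖ ^ 2) _ z :=
    (hasStrictFDerivAt_norm_sq z).hasFDerivAt
  have h2 := (((h1.const_mul (-(1 / 4))).exp).const_mul (1 / √((4 * Real.pi) ^ n))).hasLineDerivAt e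
  convert! h2 using 1
  simp [gaussDensity]
  ring

/-- The Gaussian probability measure with density `gaussDensity`. -/
def gaussMeasure (n : ℕ) : Measure (EuclideanSpace ℝ (Fin n)) :=
  volume.withDensity fun z => ENNReal.ofReal (gaussDensity z)

theorem integral_gaussMeasure {F : Type*} [NormedAddCommGroup F] [NormedSpace ℝ F]
    (h : EuclideanSpace ℝ (Fin n) → F) :
    ∫ z, h z ∂(gaussMeasure n) = ∫ z, gaussDensity z • h z := by
  rw [gaussMeasure, integral_withDensity_eq_integral_toReal_smul (by fun_prop)
    (Eventually.of_forall fun _ => ENNReal.ofReal_lt_top)]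
  simp [ENNReal.toReal_ofReal (gaussDensity_nonneg _)]

instance : IsProbabilityMeasure (gaussMeasure n) := by
  refine ⟨?_⟩
  rw [gaussMeasure, withDensity_apply _ MeasurableSet.univ, Measure.restrict_univ,
    ← ofReal_integral_eq_lintegral_ofReal integrable_gaussDensity
      (Eventually.of_forall gaussDensity_nonneg), integral_gaussDensity, ENNReal.ofReal_one]

/-- If `Z` has density `gaussDensity`, then `S Z` is a centred Gaussian vector of covariance matrix
`2 S Sᵀ`. In particular its law depends on `S Sᵀ` only. -/
theorem charFun_map_gaussMeasure (S : Matrix (Fin n) (Fin n) ℝ)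
    (ξ : EuclideanSpace ℝ (Fin n)) :
    charFun ((gaussMeasure n).map (Matrix.toEuclideanCLM (𝕜 := ℝ) S)) ξ =
      Complex.exp (-(ξ.ofLp ⬝ᵥ (S * S.transpose).mulVec ξ.ofLp : ℝ)) := by
  have hadj : ∀ z, inner ℝ (Matrix.toEuclideanCLM (𝕜 := ℝ) S z) ξ =
      inner ℝ (Matrix.toEuclideanCLM (𝕜 := ℝ) S.transpose ξ) z := by
    intro z
    have h := map_star (Matrix.toEuclideanCLM (n := Fin n) (𝕜 := ℝ)) S
    rw [ContinuousLinearMap.star_eq_adjoint] at h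
    have h2 : S.transpose = star S := by
      rw [Matrix.star_eq_conjTranspose, Matrix.conjTranspose_eq_transpose_of_trivial]
    rw [h2, h, ContinuousLinearMap.adjoint_inner_left, real_inner_comm]
  rw [charFun_apply, integral_map (by fun_prop) (by fun_prop), integral_gaussMeasure]
  simp only [hadj]
  set η := Matrix.toEuclideanCLM (𝕜 := ℝ) S.transpose ξ with hη
  have h1 : ∀ z : EuclideanSpace ℝ (Fin n),
      gaussDensity z • Complex.exp ((inner ℝ η z : ℝ) * Complex.I) =
      (1 / √((4 * Real.pi) ^ n) : ℝ) *
        Complex.exp (-((1 / 4 : ℝ) : ℂ) * ‖z‖ ^ 2 + Complex.I * (inner ℝ η z : ℝ)) := by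
    intro z
    rw [gaussDensity, Complex.exp_add, Complex.real_smul, Complex.ofReal_mul, Complex.ofReal_exp]
    push_cast
    ring_nf
  simp only [h1]
  rw [integral_const_mul, GaussianFourier.integral_cexp_neg_mul_sq_norm_add (by norm_num),
    finrank_euclideanSpace_fin, ← mul_assoc]
  have h2 : ((1 / √((4 * Real.pi) ^ n) : ℝ) : ℂ) *
      ((Real.pi : ℂ) / ((1 / 4 : ℝ) : ℂ)) ^ ((n : ℂ) / 2) = 1 := by
    rw [show (Real.pi : ℂ) / ((1 / 4 : ℝ) : ℂ) = ((4 * Real.pi : ℝ) : ℂ) by push_cast; ring,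
      show ((n : ℂ) / 2) = ((n / 2 : ℝ) : ℂ) by push_cast; ring,
      ← Complex.ofReal_cpow (by positivity), ← Complex.ofReal_mul, Real.sqrt_eq_rpow,
      ← Real.rpow_natCast, ← Real.rpow_mul (by positivity), mul_one_div,
      one_div_mul_cancel (by positivity), Complex.ofReal_one]
  rw [h2, one_mul]
  congr 1
  have h3 : ‖η‖ ^ 2 = ξ.ofLp ⬝ᵥ (S * S.transpose).mulVec ξ.ofLp := by
    rw [EuclideanSpace.real_norm_sq_eq, ← Matrix.mulVec_mulVec, Matrix.dotProduct_mulVec,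
      ← Matrix.mulVec_transpose]
    simp [hη, dotProduct, sq]
  rw [← h3, Complex.I_sq]
  push_cast
  ring

theorem stronglyMeasurable_toDistr_translate [Fact (1 ≤ q)] (v : LqSpace n q)
    (φ : 𝓢(EuclideanSpace ℝ (Fin n), ℂ)) :
    StronglyMeasurable fun y => toDistr v (schwartzTranslate y φ) := by
  simp only [toDistr_apply, schwartzTranslate_apply]
  refine StronglyMeasurable.integral_prod_right'
    (f := fun x : EuclideanSpace ℝ (Fin n) × EuclideanSpace ℝ (Fin n) => φ (x.2 + x.1) • v x.2) ?_
  have hc : Continuous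
      fun x : EuclideanSpace ℝ (Fin n) × EuclideanSpace ℝ (Fin n) => x.2 + x.1 := by
    fun_prop
  exact (φ.continuous.comp hc).stronglyMeasurable.smul
    ((Lp.stronglyMeasurable v).comp_measurable measurable_snd)

theorem integrable_toDistr_translate [Fact (1 ≤ q)] (v : LqSpace n q)
    (φ : 𝓢(EuclideanSpace ℝ (Fin n), ℂ)) (μ : Measure (EuclideanSpace ℝ (Fin n)))
    [IsFiniteMeasure μ] : Integrable (fun y => toDistr v (schwartzTranslate y φ)) μ := by
  obtain ⟨C, hC0, hC⟩ := exists_norm_toDistr_translate_le (q := q) φ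
  refine Integrable.mono' (integrable_const (C * ‖v‖))
    (stronglyMeasurable_toDistr_translate v φ).aestronglyMeasurable
    (Eventually.of_forall fun y => ?_)
  simp only [toDistr_apply, schwartzTranslate_apply]
  exact (norm_integral_le_integral_norm _).trans (hC v y)

variable [Fact (1 ≤ q)]

/-- The Gaussian average `v ↦ ∫ g(z) v(· - S z) dz`. It is convolution with the heat kernel of
covariance matrix `2 S Sᵀ`; singular `S` are allowed. -/
def gaussOp (S : Matrix (Fin n) (Fin n) ℝ) : LqSpace n q →L[ℂ] LqSpace n q :=
  translateAverage integrable_gaussDensity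
    (Y := fun z => Matrix.toEuclideanCLM (𝕜 := ℝ) S z) (by fun_prop)

theorem norm_gaussOp_le (S : Matrix (Fin n) (Fin n) ℝ) (v : LqSpace n q) :
    ‖gaussOp S v‖ ≤ ‖v‖ := by
  refine (norm_translateAverage_le _ _ v).trans_eq ?_
  simp only [Real.norm_of_nonneg (gaussDensity_nonneg _), integral_gaussDensity, one_mul]

theorem toDistr_gaussOp (S : Matrix (Fin n) (Fin n) ℝ) (v : LqSpace n q)
    (φ : 𝓢(EuclideanSpace ℝ (Fin n), ℂ)) :
    toDistr (gaussOp S v) φ = ∫ y, toDistr v (schwartzTranslate y φ)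
      ∂((gaussMeasure n).map (Matrix.toEuclideanCLM (𝕜 := ℝ) S)) := by
  rw [integral_map (by fun_prop)
    (stronglyMeasurable_toDistr_translate v φ).aestronglyMeasurable, integral_gaussMeasure]
  exact toDistr_translateAverage _ _ v φ

theorem schwartzTranslate_schwartzTranslate (y y' : EuclideanSpace ℝ (Fin n))
    (φ : 𝓢(EuclideanSpace ℝ (Fin n), ℂ)) :
    schwartzTranslate y' (schwartzTranslate y φ) = schwartzTranslate (y + y') φ := by
  ext x
  simp only [schwartzTranslate_apply]
  congr 1
  abel

/-- Independent centred Gaussian vectors add up to a Gaussian vector: the covariances add. The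
characteristic functions identify the convolution of the two laws, without any invertibility. -/
theorem gaussOp_gaussOp {S S' S'' : Matrix (Fin n) (Fin n) ℝ}
    (h : S * S.transpose + S' * S'.transpose = S'' * S''.transpose) (v : LqSpace n q) :
    gaussOp S (gaussOp S' v) = gaussOp S'' v := by
  have := fun S => Measure.isProbabilityMeasure_map (μ := gaussMeasure n)
    (f := Matrix.toEuclideanCLM (n := Fin n) (𝕜 := ℝ) S) (by fun_prop)
  refine toDistr_ext fun φ => ?_
  rw [toDistr_gaussOp, toDistr_gaussOp]
  simp only [toDistr_gaussOp, schwartzTranslate_schwartzTranslate]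
  rw [← integral_conv (integrable_toDistr_translate v φ _)]
  congr 1
  refine Measure.ext_of_charFun ?_
  ext ξ
  rw [charFun_conv, charFun_map_gaussMeasure, charFun_map_gaussMeasure, charFun_map_gaussMeasure,
    ← Complex.exp_add, ← h, Matrix.add_mulVec, dotProduct_add]
  push_cast
  ring_nf

theorem gaussOp_zero (v : LqSpace n q) : gaussOp 0 v = v := by
  refine toDistr_ext fun φ => ?_
  rw [toDistr_gaussOp, integral_map (by fun_prop)
    (stronglyMeasurable_toDistr_translate v φ).aestronglyMeasurable]
  simp [schwartzTranslate_zero]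

theorem gaussOp_congr {S S' : Matrix (Fin n) (Fin n) ℝ}
    (h : S * S.transpose = S' * S'.transpose) (v : LqSpace n q) : gaussOp S v = gaussOp S' v := by
  rw [← gaussOp_gaussOp (S := S) (S' := 0) (S'' := S') (by simpa using h), gaussOp_zero]

open Classical in
/-- The heat semigroup `B ↦ e^{∑ B_{ij} ∂_i ∂_j}`, indexed by the positive semidefinite matrices:
the Gaussian average for any `S` with `S Sᵀ = B` (see `heatSemigroup_eq_gaussOp`). Matrices that are
not positive semidefinite have no such factor `S`; they are sent to `0`. -/
def heatSemigroup (B : Matrix (Fin n) (Fin n) ℝ) : LqSpace n q →L[ℂ] LqSpace n q :=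
  if h : ∃ S : Matrix (Fin n) (Fin n) ℝ, S * S.transpose = B then gaussOp h.choose else 0

theorem heatSemigroup_eq_gaussOp {S B : Matrix (Fin n) (Fin n) ℝ} (h : S * S.transpose = B)
    (v : LqSpace n q) : heatSemigroup B v = gaussOp S v := by
  have h' : ∃ S : Matrix (Fin n) (Fin n) ℝ, S * S.transpose = B := ⟨S, h⟩
  rw [heatSemigroup, dif_pos h']
  exact gaussOp_congr (h'.choose_spec.trans h.symm) v

open scoped MatrixOrder in
theorem exists_factor {B : Matrix (Fin n) (Fin n) ℝ} (hB : B.PosSemidef) :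
    ∃ S : Matrix (Fin n) (Fin n) ℝ, S * S.transpose = B := by
  obtain ⟨S, hS⟩ := CStarAlgebra.nonneg_iff_eq_star_mul_self.1 hB.nonneg
  refine ⟨S.transpose, ?_⟩
  rw [hS, Matrix.star_eq_conjTranspose, Matrix.conjTranspose_eq_transpose_of_trivial,
    Matrix.transpose_transpose]

theorem norm_heatSemigroup_le (B : Matrix (Fin n) (Fin n) ℝ) (v : LqSpace n q) :
    ‖heatSemigroup B v‖ ≤ ‖v‖ := by
  by_cases h : ∃ S : Matrix (Fin n) (Fin n) ℝ, S * S.transpose = B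
  · rw [heatSemigroup_eq_gaussOp h.choose_spec]
    exact norm_gaussOp_le _ v
  · simp [heatSemigroup, h]

theorem heatSemigroup_zero (v : LqSpace n q) : heatSemigroup 0 v = v := by
  rw [heatSemigroup_eq_gaussOp (S := 0) (by simp), gaussOp_zero]

/-- The semigroup law. -/
theorem heatSemigroup_add {A B : Matrix (Fin n) (Fin n) ℝ} (hA : A.PosSemidef)
    (hB : B.PosSemidef) (v : LqSpace n q) :
    heatSemigroup (A + B) v = heatSemigroup A (heatSemigroup B v) := by
  obtain ⟨S, hS⟩ := exists_factor hA
  obtain ⟨S', hS'⟩ := exists_factor hB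
  obtain ⟨S'', hS''⟩ := exists_factor (hA.add hB)
  rw [heatSemigroup_eq_gaussOp hS, heatSemigroup_eq_gaussOp hS', heatSemigroup_eq_gaussOp hS'',
    gaussOp_gaussOp (S'' := S'') (by rw [hS, hS', hS''])]

theorem heatSemigroup_mem_sobolevInfty (B : Matrix (Fin n) (Fin n) ℝ) {v : LqSpace n q}
    (hv : v ∈ sobolevInfty n q) : heatSemigroup B v ∈ sobolevInfty n q := by
  by_cases h : ∃ S : Matrix (Fin n) (Fin n) ℝ, S * S.transpose = B
  · rw [heatSemigroup_eq_gaussOp h.choose_spec]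
    exact translateAverage_mem_sobolevInfty _ _ hv
  · simp [heatSemigroup, h]

theorem weakDeriv_heatSemigroup (B : Matrix (Fin n) (Fin n) ℝ) {v : LqSpace n q}
    (hv : v ∈ sobolevInfty n q) (m : List (Fin n)) :
    weakDeriv m (heatSemigroup B v) = heatSemigroup B (weakDeriv m v) := by
  by_cases h : ∃ S : Matrix (Fin n) (Fin n) ℝ, S * S.transpose = B
  · rw [heatSemigroup_eq_gaussOp h.choose_spec, heatSemigroup_eq_gaussOp h.choose_spec]
    exact weakDeriv_translateAverage _ _ hv m
  · simp only [heatSemigroup, h, dite_false, zero_apply]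
    exact weakDeriv_eq (by simp)

end Gaussian

/-! ### Gaussian integration by parts and its consequences -/

section IntegrationByParts

variable {n : ℕ} {q : ℝ≥0∞}

theorem integrable_smul_schwartz {Ω : Type*} [MeasurableSpace Ω] {P : Measure Ω} {ρ : Ω → ℝ}
    (hρ : Integrable ρ P) {Y : Ω → EuclideanSpace ℝ (Fin n)} (hY : Measurable Y)
    (ψ : 𝓢(EuclideanSpace ℝ (Fin n), ℂ)) : Integrable (fun τ => ρ τ • ψ (Y τ)) P := by
  refine Integrable.mono' (hρ.norm.mul_const (SchwartzMap.seminorm ℝ 0 0 ψ))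
    (hρ.1.smul (ψ.continuous.measurable.comp hY).aestronglyMeasurable)
    (Eventually.of_forall fun τ => ?_)
  rw [norm_smul]
  exact mul_le_mul_of_nonneg_left (SchwartzMap.norm_le_seminorm ℝ ψ _) (norm_nonneg _)

theorem integrable_inner_mul_gaussDensity (e : EuclideanSpace ℝ (Fin n)) :
    Integrable fun z => -(1 / 2) * inner ℝ z e * gaussDensity z := by
  refine Integrable.mono' (integrable_norm_mul_gaussDensity.const_mul ‖e‖) (by fun_prop)
    (Eventually.of_forall fun z => ?_)
  have h0 := gaussDensity_nonneg z
  rw [norm_mul, norm_mul, Real.norm_of_nonneg h0, ← mul_assoc]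
  refine mul_le_mul_of_nonneg_right ?_ h0
  have := norm_inner_le_norm (𝕜 := ℝ) z e
  rw [norm_neg, Real.norm_of_nonneg (by norm_num : (0 : ℝ) ≤ 1 / 2)]
  linarith [norm_nonneg (inner ℝ z e)]

/-- Gaussian integration by parts: the factor `-⟨z, e⟩ / 2` is the logarithmic derivative of the
Gaussian density in the direction `e`. -/
theorem integral_inner_mul_gaussDensity_smul (A : EuclideanSpace ℝ (Fin n) →L[ℝ]
    EuclideanSpace ℝ (Fin n)) (ψ : 𝓢(EuclideanSpace ℝ (Fin n), ℂ))
    (x e : EuclideanSpace ℝ (Fin n)) :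
    ∫ z, (-(1 / 2) * inner ℝ z e * gaussDensity z) • ψ (x + A z) =
      -∫ z, gaussDensity z • (∂_{A e} ψ) (x + A z) := by
  have hm : Measurable fun z => x + A z := by fun_prop
  have h := integral_bilinear_hasLineDerivAt_right_eq_neg_left_of_integrable
    (μ := (volume : Measure (EuclideanSpace ℝ (Fin n)))) (v := e)
    (B := ContinuousLinearMap.lsmul ℝ ℝ (E := ℂ))
    (f := gaussDensity) (f' := fun z => -(1 / 2) * inner ℝ z e * gaussDensity z)
    (g := fun z => ψ (x + A z)) (g' := fun z => (∂_{A e} ψ) (x + A z))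
    (integrable_smul_schwartz (integrable_inner_mul_gaussDensity e) hm ψ)
    (integrable_smul_schwartz integrable_gaussDensity hm _)
    (integrable_smul_schwartz integrable_gaussDensity hm ψ)
    (fun z _ => hasLineDerivAt_gaussDensity z e) (fun z _ => by
      have h1 : HasFDerivAt (fun z => x + A z) A z := A.hasFDerivAt.const_add x
      have h2 := ((ψ.hasFDerivAt (x + A z)).comp z h1).hasLineDerivAt e
      rwa [ContinuousLinearMap.comp_apply, ← SchwartzMap.lineDerivOp_apply_eq_fderiv] at h2)
  simp only [ContinuousLinearMap.lsmul_apply] at h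
  rw [h, neg_neg]

/-- The second order operator `∑ B_{ij} ∂_i ∂_j` on Schwartz functions. -/
def schwartzDiffusion (B : Matrix (Fin n) (Fin n) ℝ) (φ : 𝓢(EuclideanSpace ℝ (Fin n), ℂ)) :
    𝓢(EuclideanSpace ℝ (Fin n), ℂ) :=
  ∑ i, ∑ j, B i j • ∂_{EuclideanSpace.single j (1 : ℝ)} (∂_{EuclideanSpace.single i (1 : ℝ)} φ)

/-- The operator `∑ (S Sᵀ)_{ij} ∂_i ∂_j` is the sum of the squares of the derivatives along the
columns of `S`. -/
theorem sum_lineDeriv_lineDeriv (S : Matrix (Fin n) (Fin n) ℝ)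
    (φ : 𝓢(EuclideanSpace ℝ (Fin n), ℂ)) :
    ∑ k, ∂_{Matrix.toEuclideanCLM (𝕜 := ℝ) S (EuclideanSpace.single k (1 : ℝ))}
      (∂_{Matrix.toEuclideanCLM (𝕜 := ℝ) S (EuclideanSpace.single k (1 : ℝ))} φ) =
    schwartzDiffusion (S * S.transpose) φ := by
  have h1 : ∀ k, Matrix.toEuclideanCLM (𝕜 := ℝ) S (EuclideanSpace.single k (1 : ℝ)) =
      ∑ i, S i k • EuclideanSpace.single i (1 : ℝ) := by
    intro k
    ext l
    simp [Pi.single_apply]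
  unfold schwartzDiffusion
  simp only [h1, LineDeriv.lineDerivOp_left_sum, LineDeriv.lineDerivOp_left_smul,
    LineDeriv.lineDerivOp_sum, LineDeriv.lineDerivOp_smul, Matrix.mul_apply,
    Matrix.transpose_apply, Finset.smul_sum, Finset.sum_smul, smul_smul]
  rw [Finset.sum_comm]
  refine (Finset.sum_congr rfl fun j _ => Finset.sum_comm).trans ?_
  rw [Finset.sum_comm]

/-- The derivative in `r` of the Gaussian average of covariance `r² S Sᵀ`: writing `S z` in
coordinates as `∑ ⟨z, e_k⟩ S e_k` and integrating by parts turns one derivative of `φ` along `S z`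
into two derivatives along the columns of `S`. -/
theorem integral_gaussDensity_smul_fderiv (S : Matrix (Fin n) (Fin n) ℝ)
    (φ : 𝓢(EuclideanSpace ℝ (Fin n), ℂ)) (x : EuclideanSpace ℝ (Fin n)) (r : ℝ) :
    ∫ z, gaussDensity z • fderiv ℝ φ (x + r • Matrix.toEuclideanCLM (𝕜 := ℝ) S z)
        (Matrix.toEuclideanCLM (𝕜 := ℝ) S z) =
      (2 * r) • ∫ z, gaussDensity z • schwartzDiffusion (S * S.transpose) φ
        (x + r • Matrix.toEuclideanCLM (𝕜 := ℝ) S z) := by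
  set L := Matrix.toEuclideanCLM (𝕜 := ℝ) S with hL
  set e : Fin n → EuclideanSpace ℝ (Fin n) := fun k => EuclideanSpace.single k (1 : ℝ) with he
  have hm : Measurable fun z => x + r • L z := by fun_prop
  have h1 : ∀ z, gaussDensity z • fderiv ℝ φ (x + r • L z) (L z) =
      ∑ k, (-2 : ℝ) • ((-(1 / 2) * inner ℝ z (e k) * gaussDensity z) •
        (∂_{L (e k)} φ) (x + (r • L) z)) := by
    intro z
    -- expand `L z` along the images of the basis vectors
    have hz : L z = ∑ k, inner ℝ z (e k) • L (e k) := by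
      conv_lhs => rw [← (EuclideanSpace.basisFun (Fin n) ℝ).sum_repr z]
      simp [he, map_sum, EuclideanSpace.inner_single_right]
    rw [show fderiv ℝ φ (x + r • L z) (L z) =
      fderiv ℝ φ (x + r • L z) (∑ k, inner ℝ z (e k) • L (e k)) by rw [← hz], map_sum,
      Finset.smul_sum]
    refine Finset.sum_congr rfl fun k _ => ?_
    rw [map_smul, smul_smul, smul_smul, SchwartzMap.lineDerivOp_apply_eq_fderiv]
    congr 1
    ring
  have hint : ∀ k, Integrable fun z => (-2 : ℝ) • ((-(1 / 2) * inner ℝ z (e k) * gaussDensity z) •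
        (∂_{L (e k)} φ) (x + (r • L) z)) := fun k =>
    (integrable_smul_schwartz (integrable_inner_mul_gaussDensity (e k))
      (Y := fun z => x + (r • L) z) (by fun_prop) (∂_{L (e k)} φ)).smul (-2 : ℝ)
  simp only [h1]
  rw [integral_finsetSum _ fun k _ => hint k, ← sum_lineDeriv_lineDeriv]
  have h2 : ∀ z, gaussDensity z • (∑ k, ∂_{L (e k)} (∂_{L (e k)} φ)) (x + r • L z) =
      ∑ k, gaussDensity z • (∂_{L (e k)} (∂_{L (e k)} φ)) (x + r • L z) := by
    intro z
    rw [sum_apply, Finset.smul_sum]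
  change _ = (2 * r) • ∫ z, gaussDensity z • (∑ k, ∂_{L (e k)} (∂_{L (e k)} φ)) (x + r • L z)
  simp only [h2]
  rw [integral_finsetSum _ fun k _ =>
    integrable_smul_schwartz integrable_gaussDensity hm _, Finset.smul_sum]
  refine Finset.sum_congr rfl fun k _ => ?_
  rw [integral_smul, integral_inner_mul_gaussDensity_smul]
  simp only [_root_.smul_apply, LineDeriv.lineDerivOp_left_smul,
    smul_comm (gaussDensity _) r, integral_smul]
  rw [smul_neg, smul_smul, neg_mul, neg_smul, neg_neg]

/-- The heat equation for Gaussian averages of a Schwartz function, integrated in the scale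
parameter `r ∈ [0, 1]` of the covariance `r² S Sᵀ`. -/
theorem integral_gaussDensity_smul_sub (S : Matrix (Fin n) (Fin n) ℝ)
    (φ : 𝓢(EuclideanSpace ℝ (Fin n), ℂ)) (x : EuclideanSpace ℝ (Fin n)) :
    (∫ z, gaussDensity z • φ (x + Matrix.toEuclideanCLM (𝕜 := ℝ) S z)) - φ x =
      ∫ r in (0 : ℝ)..1, (2 * r) • ∫ z, gaussDensity z • schwartzDiffusion (S * S.transpose) φ
        (x + r • Matrix.toEuclideanCLM (𝕜 := ℝ) S z) := by
  set L := Matrix.toEuclideanCLM (𝕜 := ℝ) S with hL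
  set ψ := schwartzDiffusion (S * S.transpose) φ with hψ
  have hd : ∀ r : ℝ, HasDerivAt (fun r : ℝ => ∫ z, gaussDensity z • φ (x + r • L z))
      ((2 * r) • ∫ z, gaussDensity z • ψ (x + r • L z)) r := by
    intro r
    rw [hψ, hL, ← integral_gaussDensity_smul_fderiv, ← hL]
    refine (hasDerivAt_integral_of_dominated_loc_of_deriv_le (s := univ) Filter.univ_mem
      (F := fun r z => gaussDensity z • φ (x + r • L z))
      (F' := fun r z => gaussDensity z • fderiv ℝ φ (x + r • L z) (L z))
      (bound := fun z => SchwartzMap.seminorm ℝ 0 0 (SchwartzMap.fderivCLM ℝ _ _ φ) * ‖L‖ *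
        (‖z‖ * gaussDensity z)) ?_ ?_ ?_ ?_ ?_ ?_).2
    · exact Eventually.of_forall fun r =>
        (integrable_smul_schwartz integrable_gaussDensity (by fun_prop) φ).1
    · exact integrable_smul_schwartz integrable_gaussDensity (by fun_prop) φ
    · have hc : Continuous fun z => fderiv ℝ φ (x + r • L z) (L z) :=
        ((SchwartzMap.fderivCLM ℝ _ _ φ).continuous.comp (by fun_prop :
          Continuous fun z => x + r • L z)).clm_apply L.continuous
      exact (continuous_gaussDensity.smul hc).aestronglyMeasurable
    · refine Eventually.of_forall fun z r _ => ?_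
      have h1 := SchwartzMap.norm_le_seminorm ℝ (SchwartzMap.fderivCLM ℝ _ _ φ) (x + r • L z)
      rw [SchwartzMap.fderivCLM_apply] at h1
      rw [norm_smul, Real.norm_of_nonneg (gaussDensity_nonneg z)]
      calc _ ≤ gaussDensity z * (SchwartzMap.seminorm ℝ 0 0 (SchwartzMap.fderivCLM ℝ _ _ φ) *
            (‖L‖ * ‖z‖)) := by
            refine mul_le_mul_of_nonneg_left ?_ (gaussDensity_nonneg z)
            exact (ContinuousLinearMap.le_opNorm _ _).trans
              (mul_le_mul h1 (L.le_opNorm z) (norm_nonneg _) (apply_nonneg _ _))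
        _ = _ := by ring
    · exact integrable_norm_mul_gaussDensity.const_mul _
    · refine Eventually.of_forall fun z r _ => ?_
      have h1 : HasDerivAt (fun r : ℝ => x + r • L z) (L z) r := by
        simpa using ((hasDerivAt_id r).smul_const (L z)).const_add x
      exact ((φ.hasFDerivAt (x + r • L z)).comp_hasDerivAt r h1).const_smul (gaussDensity z)
  have hc : Continuous fun r : ℝ => (2 * r) • ∫ z, gaussDensity z • ψ (x + r • L z) := by
    refine (by fun_prop : Continuous fun r : ℝ => 2 * r).smul ?_
    refine continuous_of_dominated (bound := fun z =>
      gaussDensity z * SchwartzMap.seminorm ℝ 0 0 ψ) (fun r =>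
      (integrable_smul_schwartz integrable_gaussDensity (by fun_prop) ψ).1) (fun r => ?_)
      (integrable_gaussDensity.mul_const _) (Eventually.of_forall fun z => ?_)
    · refine Eventually.of_forall fun z => ?_
      rw [norm_smul, Real.norm_of_nonneg (gaussDensity_nonneg z)]
      exact mul_le_mul_of_nonneg_left (SchwartzMap.norm_le_seminorm ℝ ψ _) (gaussDensity_nonneg z)
    · exact (continuous_const (y := gaussDensity z)).smul (ψ.continuous.comp
        (by fun_prop : Continuous fun r : ℝ => x + r • L z))
  rw [intervalIntegral.integral_eq_sub_of_hasDerivAt (fun r _ => hd r) (hc.intervalIntegrable _ _)]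
  congr 1
  · simp
  · simp only [zero_smul, add_zero]
    rw [integral_smul_const, integral_gaussDensity, one_smul]

end IntegrationByParts

/-! ### The generator of the heat semigroup -/

section Generator

variable {n : ℕ} {q : ℝ≥0∞}

theorem lineDeriv_comm (e e' : EuclideanSpace ℝ (Fin n)) (φ : 𝓢(EuclideanSpace ℝ (Fin n), ℂ)) :
    ∂_{e} (∂_{e'} φ) = ∂_{e'} (∂_{e} φ) := by
  ext x
  have h1 : ∀ e e' : EuclideanSpace ℝ (Fin n),
      (∂_{e} (∂_{e'} φ)) x = fderiv ℝ (fderiv ℝ φ) x e e' := by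
    intro e e'
    rw [SchwartzMap.lineDerivOp_apply_eq_fderiv]
    have h2 : ⇑(∂_{e'} φ : 𝓢(EuclideanSpace ℝ (Fin n), ℂ)) = fun y => fderiv ℝ φ y e' :=
      funext fun y => SchwartzMap.lineDerivOp_apply_eq_fderiv e' φ y
    rw [h2]
    have h3 : DifferentiableAt ℝ (fderiv ℝ φ) x :=
      ((φ.smooth 2).fderiv_right (m := 1) (by norm_num)).differentiable (by norm_num) x
    rw [fderiv_clm_apply h3 (differentiableAt_const _)]
    simp
  rw [h1, h1]
  exact (φ.smooth 2).contDiffAt.isSymmSndFDerivAt (by simp) e e'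

theorem distrDeriv_two_apply (i j : Fin n) (T : 𝓢'(EuclideanSpace ℝ (Fin n), ℂ))
    (φ : 𝓢(EuclideanSpace ℝ (Fin n), ℂ)) : distrDeriv [i, j] T φ =
      T (∂_{EuclideanSpace.single j (1 : ℝ)} (∂_{EuclideanSpace.single i (1 : ℝ)} φ)) := by
  show T (-∂_{EuclideanSpace.single j (1 : ℝ)} (-∂_{EuclideanSpace.single i (1 : ℝ)} φ)) = _
  rw [LineDeriv.lineDerivOp_neg, neg_neg]

/-- Distributional partial derivatives commute. -/
theorem distrDeriv_perm {m m' : List (Fin n)} (h : m.Perm m')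
    (T : 𝓢'(EuclideanSpace ℝ (Fin n), ℂ)) : distrDeriv m T = distrDeriv m' T := by
  induction h with
  | nil => rfl
  | cons i _ ih =>
    show ∂_{EuclideanSpace.single i (1 : ℝ)} (distrDeriv _ T) =
      ∂_{EuclideanSpace.single i (1 : ℝ)} (distrDeriv _ T)
    rw [ih]
  | swap i j l =>
    ext φ
    have h1 := distrDeriv_two_apply i j (distrDeriv l T) φ
    have h2 := distrDeriv_two_apply j i (distrDeriv l T) φ
    rw [lineDeriv_comm, ← h1] at h2
    exact h2
  | trans _ _ ih1 ih2 => rw [ih1, ih2]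

variable [Fact (1 ≤ q)]

theorem weakDeriv_perm {m m' : List (Fin n)} (h : m.Perm m') {v : LqSpace n q}
    (hv : v ∈ sobolevInfty n q) : weakDeriv m v = weakDeriv m' v :=
  weakDeriv_eq (by rw [toDistr_weakDeriv hv, distrDeriv_perm h])

theorem real_smul_eq_complex_smul {V : Type*} [AddCommGroup V] [Module ℝ V] [Module ℂ V]
    [IsScalarTower ℝ ℂ V] (c : ℝ) (w : V) : c • w = (c : ℂ) • w :=
  (RCLike.real_smul_eq_coe_smul (K := ℂ) c w)

/-- `∂_x^m ∑ B_{ij} ∂_i ∂_j v`, the operator `∑ B_{ij} ∂_i ∂_j` combined with the derivative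
`∂_x^m`. -/
def diffusionAt (B : Matrix (Fin n) (Fin n) ℝ) (m : List (Fin n)) (v : LqSpace n q) :
    LqSpace n q := ∑ i, ∑ j, B i j • weakDeriv (m ++ [i, j]) v

theorem sum_sum_smul_mem_sobolevInfty (B : Matrix (Fin n) (Fin n) ℝ)
    {w : Fin n → Fin n → LqSpace n q} (hw : ∀ i j, w i j ∈ sobolevInfty n q) :
    ∑ i, ∑ j, B i j • w i j ∈ sobolevInfty n q :=
  Submodule.sum_mem _ fun i _ => Submodule.sum_mem _ fun j _ => by
    rw [real_smul_eq_complex_smul]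
    exact Submodule.smul_mem _ _ (hw i j)

theorem diffusionAt_mem (B : Matrix (Fin n) (Fin n) ℝ) (m : List (Fin n)) {v : LqSpace n q}
    (hv : v ∈ sobolevInfty n q) : diffusionAt B m v ∈ sobolevInfty n q :=
  sum_sum_smul_mem_sobolevInfty B fun _ _ => weakDeriv_mem hv _

theorem diffusionAt_weakDeriv (B : Matrix (Fin n) (Fin n) ℝ) (m : List (Fin n))
    {v : LqSpace n q} (hv : v ∈ sobolevInfty n q) :
    diffusionAt B [] (weakDeriv m v) = diffusionAt B m v := by
  refine Finset.sum_congr rfl fun i _ => Finset.sum_congr rfl fun j _ => ?_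
  rw [weakDeriv_weakDeriv hv, weakDeriv_perm _ hv]
  exact List.perm_append_comm

theorem diffusionAt_smul (c : ℝ) (B : Matrix (Fin n) (Fin n) ℝ) (m : List (Fin n))
    (v : LqSpace n q) : diffusionAt (c • B) m v = c • diffusionAt B m v := by
  simp [diffusionAt, Finset.smul_sum, smul_smul]

theorem norm_diffusionAt_le {B : Matrix (Fin n) (Fin n) ℝ} {η : ℝ} (hB : ∀ i j, |B i j| ≤ η)
    (m : List (Fin n)) {v : LqSpace n q} {M : ℝ} (hM : ∀ i j, ‖weakDeriv (m ++ [i, j]) v‖ ≤ M) :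
    ‖diffusionAt B m v‖ ≤ n ^ 2 * η * M := by
  calc ‖diffusionAt B m v‖ ≤ ∑ i : Fin n, ∑ j : Fin n, η * M := by
        refine norm_sum_le_of_le _ fun i _ => norm_sum_le_of_le _ fun j _ => ?_
        rw [norm_smul]
        exact mul_le_mul (hB i j) (hM i j) (norm_nonneg _) ((abs_nonneg _).trans (hB i j))
    _ = _ := by simp; ring

theorem map_sum_sum_smul (T : LqSpace n q →L[ℂ] LqSpace n q) (B : Matrix (Fin n) (Fin n) ℝ)
    (w : Fin n → Fin n → LqSpace n q) :
    T (∑ i, ∑ j, B i j • w i j) = ∑ i, ∑ j, B i j • T (w i j) := by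
  simp only [map_sum, real_smul_eq_complex_smul, map_smul]

theorem toDistr_schwartzDiffusion (B : Matrix (Fin n) (Fin n) ℝ) {v : LqSpace n q}
    (hv : v ∈ sobolevInfty n q) (φ : 𝓢(EuclideanSpace ℝ (Fin n), ℂ)) :
    toDistr v (schwartzDiffusion B φ) = toDistr (diffusionAt B [] v) φ := by
  have h1 : ∀ (c : ℝ) (ψ : 𝓢(EuclideanSpace ℝ (Fin n), ℂ)), c • ψ = (c : ℂ) • ψ := fun c ψ => by
    ext x; simp
  simp only [schwartzDiffusion, diffusionAt, map_sum, h1, real_smul_eq_complex_smul, map_smul,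
    List.nil_append, toDistr_weakDeriv hv, ← distrDeriv_two_apply]
  simp [sum_apply]

theorem integrable_average_mul {Ω : Type*} [MeasurableSpace Ω]
    {P : Measure Ω} {ρ : Ω → ℝ} {Y : Ω → EuclideanSpace ℝ (Fin n)}
    [SFinite P] (hρ : Integrable ρ P) (hY : Measurable Y)
    (v : LqSpace n q) (φ : 𝓢(EuclideanSpace ℝ (Fin n), ℂ)) :
    Integrable fun x => (∫ τ, ρ τ • φ (x + Y τ) ∂P) * v x := by
  refine (integrable_prod_translate hρ hY v φ).integral_prod_left.congr
    (Eventually.of_forall fun x => ?_)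
  beta_reduce
  rw [← integral_mul_const]
  refine integral_congr_ae (Eventually.of_forall fun τ => ?_)
  simp [mul_assoc]

theorem integrable_scaleDensity : Integrable
    (fun x : ℝ × EuclideanSpace ℝ (Fin n) => 2 * x.1 * gaussDensity x.2)
    ((volume.restrict (Ioc (0 : ℝ) 1)).prod volume) :=
  Integrable.mul_prod (f := fun r : ℝ => 2 * r)
    ((by fun_prop : Continuous fun r : ℝ => 2 * r).integrableOn_Ioc) integrable_gaussDensity

/-- The mean `∫₀¹ 2r e^{r² ∑ B_{ij} ∂_i ∂_j} dr` of the heat semigroup along the ray of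
`B = S Sᵀ`. -/
def heatMean (S : Matrix (Fin n) (Fin n) ℝ) : LqSpace n q →L[ℂ] LqSpace n q :=
  translateAverage (integrable_scaleDensity (n := n))
    (Y := fun x => x.1 • Matrix.toEuclideanCLM (𝕜 := ℝ) S x.2) (by fun_prop)

theorem norm_heatMean_le (S : Matrix (Fin n) (Fin n) ℝ) (v : LqSpace n q) :
    ‖heatMean S v‖ ≤ ‖v‖ := by
  refine (norm_translateAverage_le _ _ v).trans_eq ?_
  have h1 : ∫ x : ℝ × EuclideanSpace ℝ (Fin n), ‖2 * x.1 * gaussDensity x.2‖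
      ∂((volume.restrict (Ioc (0 : ℝ) 1)).prod volume) = 1 := by
    simp only [norm_mul (2 * _ : ℝ), Real.norm_of_nonneg (gaussDensity_nonneg _)]
    rw [integral_prod_mul (fun r : ℝ => ‖2 * r‖) gaussDensity, integral_gaussDensity, mul_one]
    rw [setIntegral_congr_fun (g := fun r => 2 * r) measurableSet_Ioc
      (fun r hr => Real.norm_of_nonneg (by have := hr.1; positivity)),
      ← intervalIntegral.integral_of_le zero_le_one, intervalIntegral.integral_const_mul,
      integral_id]
    norm_num
  rw [h1, one_mul]

theorem heatMean_mem_sobolevInfty (S : Matrix (Fin n) (Fin n) ℝ) {v : LqSpace n q}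
    (hv : v ∈ sobolevInfty n q) : heatMean S v ∈ sobolevInfty n q :=
  translateAverage_mem_sobolevInfty _ _ hv

theorem weakDeriv_heatMean (S : Matrix (Fin n) (Fin n) ℝ) {v : LqSpace n q}
    (hv : v ∈ sobolevInfty n q) (m : List (Fin n)) :
    weakDeriv m (heatMean S v) = heatMean S (weakDeriv m v) :=
  weakDeriv_translateAverage _ _ hv m

/-- The heat equation, integrated along the ray of `B`. It is transposed to test functions, where
it is the formula for Gaussian averages of Schwartz functions. -/
theorem heatSemigroup_sub_eq {S B : Matrix (Fin n) (Fin n) ℝ} (h : S * S.transpose = B)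
    {w : LqSpace n q} (hw : w ∈ sobolevInfty n q) :
    heatSemigroup B w - w = heatMean S (diffusionAt B [] w) := by
  rw [heatSemigroup_eq_gaussOp h]
  refine toDistr_ext fun φ => ?_
  -- the operator is moved onto the mean, and from there onto the test function
  have h1 : heatMean S (diffusionAt B [] w) = diffusionAt B [] (heatMean S w) := by
    rw [diffusionAt, map_sum_sum_smul]
    refine Finset.sum_congr rfl fun i _ => Finset.sum_congr rfl fun j _ => ?_
    rw [weakDeriv_heatMean S hw]
  rw [h1, ← toDistr_schwartzDiffusion B (heatMean_mem_sobolevInfty S hw)]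
  rw [heatMean, toDistr_translateAverage', map_sub, sub_apply, gaussOp,
    toDistr_translateAverage', toDistr_apply]
  have h2 : (∫ x, φ x • w x) = ∫ x, φ x * w x := rfl
  have h3 : Integrable fun x => φ x * w x := integrable_schwartz_smul w φ
  rw [h2, ← integral_sub (integrable_average_mul integrable_gaussDensity (by fun_prop) w φ) h3]
  refine integral_congr_ae (Eventually.of_forall fun x => ?_)
  beta_reduce
  rw [← sub_mul, integral_gaussDensity_smul_sub, h,
    integral_prod _ (integrable_smul_schwartz integrable_scaleDensity (by fun_prop) _),
    intervalIntegral.integral_of_le zero_le_one]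
  congr 1
  refine integral_congr_ae (Eventually.of_forall fun r => ?_)
  beta_reduce
  rw [← integral_smul]
  simp only [smul_smul]

/-- First order expansion of the heat semigroup at `B = 0`. -/
theorem norm_heatSemigroup_sub_le {B : Matrix (Fin n) (Fin n) ℝ} (hB : B.PosSemidef)
    {w : LqSpace n q} (hw : w ∈ sobolevInfty n q) :
    ‖heatSemigroup B w - w‖ ≤ ‖diffusionAt B [] w‖ := by
  obtain ⟨S, hS⟩ := exists_factor hB
  rw [heatSemigroup_sub_eq hS hw]
  exact norm_heatMean_le S _

theorem norm_heatSemigroup_sub_heatSemigroup_le {A B : Matrix (Fin n) (Fin n) ℝ}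
    (hB : B.PosSemidef) (hAB : (A - B).PosSemidef) {w : LqSpace n q}
    (hw : w ∈ sobolevInfty n q) :
    ‖heatSemigroup A w - heatSemigroup B w‖ ≤ ‖diffusionAt (A - B) [] w‖ := by
  have h1 : heatSemigroup A w = heatSemigroup B (heatSemigroup (A - B) w) := by
    rw [← heatSemigroup_add hB hAB, add_sub_cancel]
  rw [h1, ← map_sub]
  exact (norm_heatSemigroup_le _ _).trans (norm_heatSemigroup_sub_le hAB hw)

theorem norm_heatSemigroup_smul_sub_le {B : Matrix (Fin n) (Fin n) ℝ} (hB : B.PosSemidef)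
    {w : LqSpace n q} (hw : w ∈ sobolevInfty n q) {x y : ℝ} (hx : 0 ≤ x) (hy : 0 ≤ y) :
    ‖heatSemigroup (x • B) w - heatSemigroup (y • B) w‖ ≤ |x - y| * ‖diffusionAt B [] w‖ := by
  wlog h : y ≤ x generalizing x y
  · rw [norm_sub_rev, abs_sub_comm]
    exact this hy hx (le_of_not_ge h)
  have h1 : x • B - y • B = (x - y) • B := (sub_smul _ _ _).symm
  have h2 := norm_heatSemigroup_sub_heatSemigroup_le (A := x • B) (B := y • B) (hB.smul hy)
    (by rw [h1]; exact hB.smul (sub_nonneg.2 h)) hw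
  rw [h1, diffusionAt_smul, norm_smul] at h2
  exact h2

/-- Second order expansion of the heat semigroup at `B = 0`. -/
theorem norm_heatSemigroup_sub_sub_le {B : Matrix (Fin n) (Fin n) ℝ} (hB : B.PosSemidef)
    {w : LqSpace n q} (hw : w ∈ sobolevInfty n q) :
    ‖heatSemigroup B w - w - diffusionAt B [] w‖ ≤ ‖diffusionAt B [] (diffusionAt B [] w)‖ := by
  obtain ⟨S, hS⟩ := exists_factor hB
  rw [heatSemigroup_sub_eq hS hw]
  have hw' : diffusionAt B [] w ∈ sobolevInfty n q := diffusionAt_mem B [] hw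
  generalize diffusionAt B [] w = u at hw'
  have hcont : Continuous fun r : ℝ => heatSemigroup (r ^ 2 • B) u := by
    rw [continuous_iff_continuousAt]
    intro r
    rw [ContinuousAt, tendsto_iff_norm_sub_tendsto_zero]
    refine squeeze_zero (fun _ => norm_nonneg _)
      (fun x => norm_heatSemigroup_smul_sub_le hB hw' (sq_nonneg x) (sq_nonneg r)) ?_
    have : Continuous fun x : ℝ => |x ^ 2 - r ^ 2| * ‖diffusionAt B [] u‖ := by fun_prop
    simpa using this.tendsto r
  have hc : Continuous fun r : ℝ => (2 * r) • heatSemigroup (r ^ 2 • B) u :=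
    (by fun_prop : Continuous fun r : ℝ => 2 * r).smul hcont
  -- the mean is also a Bochner integral of the semigroup, so `heatMean S u - u` can be estimated by
  -- the first order expansion
  have hmean : heatMean S u = ∫ r in (0 : ℝ)..1, (2 * r) • heatSemigroup (r ^ 2 • B) u := by
    refine toDistr_ext fun φ => ?_
    have h1 := ((pairing (q := q) φ).restrictScalars ℝ).intervalIntegral_comp_comm
      (hc.intervalIntegrable (μ := volume) 0 1)
    have h2 : toDistr (∫ r in (0 : ℝ)..1, (2 * r) • heatSemigroup (r ^ 2 • B) u) φ =
      ∫ r in (0 : ℝ)..1, toDistr ((2 * r) • heatSemigroup (r ^ 2 • B) u) φ := h1.symm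
    rw [h2, heatMean, toDistr_translateAverage, integral_prod _ ?_,
      intervalIntegral.integral_of_le zero_le_one]
    · refine integral_congr_ae (Eventually.of_forall fun r => ?_)
      beta_reduce
      have hS' : (r • S) * (r • S).transpose = r ^ 2 • B := by
        rw [← hS, Matrix.transpose_smul, Matrix.smul_mul, Matrix.mul_smul, smul_smul, sq]
      rw [heatSemigroup_eq_gaussOp hS', real_smul_eq_complex_smul, map_smul,
        _root_.smul_apply, gaussOp, toDistr_translateAverage, ← real_smul_eq_complex_smul,
        ← integral_smul]
      simp only [smul_smul, map_smul, _root_.smul_apply]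
    · obtain ⟨C, hC0, hC⟩ := exists_norm_toDistr_translate_le (q := q) φ
      refine Integrable.mono' (integrable_scaleDensity.norm.mul_const (C * ‖u‖))
        (integrable_scaleDensity.1.smul
          ((stronglyMeasurable_toDistr_translate u φ).comp_measurable
            (by fun_prop)).aestronglyMeasurable) (Eventually.of_forall fun x => ?_)
      rw [norm_smul]
      refine mul_le_mul_of_nonneg_left ?_ (norm_nonneg _)
      simp only [toDistr_apply, schwartzTranslate_apply]
      exact (norm_integral_le_integral_norm _).trans (hC u _)
  have hu : u = ∫ r in (0 : ℝ)..1, (2 * r) • u := by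
    rw [intervalIntegral.integral_smul_const, intervalIntegral.integral_const_mul, integral_id]
    norm_num
  have hc' : Continuous fun r : ℝ => (2 * r) • u := by fun_prop
  have hsub : heatMean S u - u =
      ∫ r in (0 : ℝ)..1, ((2 * r) • heatSemigroup (r ^ 2 • B) u - (2 * r) • u) := by
    rw [intervalIntegral.integral_sub (hc.intervalIntegrable _ _) (hc'.intervalIntegrable _ _),
      ← hmean, ← hu]
  rw [hsub]
  have hle : ∀ r ∈ Ioc (0 : ℝ) 1, ‖(2 * r) • heatSemigroup (r ^ 2 • B) u - (2 * r) • u‖ ≤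
      2 * r * ‖diffusionAt B [] u‖ := by
    intro r hr
    have h0 : 0 ≤ r := hr.1.le
    rw [← smul_sub, norm_smul, Real.norm_of_nonneg (by positivity)]
    refine mul_le_mul_of_nonneg_left ?_ (by positivity)
    have := norm_heatSemigroup_smul_sub_le hB hw' (sq_nonneg r) le_rfl
    rw [zero_smul, heatSemigroup_zero, sub_zero, abs_of_nonneg (sq_nonneg r)] at this
    refine this.trans (mul_le_of_le_one_left (norm_nonneg _) ?_)
    nlinarith [hr.2]
  calc _ ≤ ∫ r in (0 : ℝ)..1, 2 * r * ‖diffusionAt B [] u‖ :=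
        intervalIntegral.norm_integral_le_of_norm_le zero_le_one
          (Eventually.of_forall hle)
          ((by fun_prop : Continuous fun r : ℝ => 2 * r * ‖diffusionAt B [] u‖).intervalIntegrable
            _ _)
    _ = _ := by
      rw [intervalIntegral.integral_mul_const, intervalIntegral.integral_const_mul, integral_id]
      norm_num

end Generator

/-! ### Smoothing and dependence on the covariance matrix -/

section Smoothing

variable {n : ℕ} {q : ℝ≥0∞} [Fact (1 ≤ q)]

/-- The constant in the gradient bound `‖∂_i e^{bΔ} v‖_q ≤ C b^{-1/2} ‖v‖_q`. -/
def gradConst (n : ℕ) : ℝ := ∫ z : EuclideanSpace ℝ (Fin n), ‖z‖ * gaussDensity z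

theorem gradConst_nonneg (n : ℕ) : 0 ≤ gradConst n :=
  integral_nonneg fun z => mul_nonneg (norm_nonneg z) (gaussDensity_nonneg z)

theorem scalar_factor {b : ℝ} (hb : 0 ≤ b) : (√b • (1 : Matrix (Fin n) (Fin n) ℝ)) *
    (√b • (1 : Matrix (Fin n) (Fin n) ℝ)).transpose = b • 1 := by
  rw [Matrix.transpose_smul, Matrix.transpose_one, Matrix.smul_mul, Matrix.mul_smul, one_mul,
    smul_smul, Real.mul_self_sqrt hb]

/-- The gradient bound: by Gaussian integration by parts the derivative is the average of translates
with weight `-⟨z, e_i⟩ g(z) / (2 √b)`. No smoothness of `v` is needed. -/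
theorem exists_lineDeriv_heatSemigroup {b : ℝ} (hb : 0 < b) (i : Fin n) (v : LqSpace n q) :
    ∃ w : LqSpace n q, toDistr w = distrDeriv [i] (toDistr (heatSemigroup (b • 1) v)) ∧
      ‖w‖ ≤ gradConst n / √b * ‖v‖ := by
  have hb' : 0 < √b := Real.sqrt_pos.2 hb
  have hρ : Integrable fun z : EuclideanSpace ℝ (Fin n) => (√b)⁻¹ *
      (-(1 / 2) * inner ℝ z (EuclideanSpace.single i (1 : ℝ)) * gaussDensity z) :=
    (integrable_inner_mul_gaussDensity _).const_mul _
  have hY : Measurable fun z : EuclideanSpace ℝ (Fin n) =>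
    Matrix.toEuclideanCLM (𝕜 := ℝ) (√b • (1 : Matrix (Fin n) (Fin n) ℝ)) z := by fun_prop
  refine ⟨translateAverage hρ hY v, ?_, ?_⟩
  · ext φ
    have h1 : distrDeriv [i] (toDistr (heatSemigroup (b • 1) v)) φ =
      toDistr (heatSemigroup (b • 1) v) (-∂_{EuclideanSpace.single i (1 : ℝ)} φ) := rfl
    rw [h1, heatSemigroup_eq_gaussOp (scalar_factor hb.le), map_neg, gaussOp,
      toDistr_translateAverage', toDistr_translateAverage', ← integral_neg]
    refine integral_congr_ae (Eventually.of_forall fun x => ?_)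
    beta_reduce
    rw [← neg_mul]
    congr 1
    simp only [← smul_smul ((√b)⁻¹)]
    rw [integral_smul, integral_inner_mul_gaussDensity_smul]
    have h2 : Matrix.toEuclideanCLM (𝕜 := ℝ) (√b • (1 : Matrix (Fin n) (Fin n) ℝ))
        (EuclideanSpace.single i (1 : ℝ)) = √b • EuclideanSpace.single i (1 : ℝ) := by
      rw [map_smul, map_one]; rfl
    rw [h2, smul_neg, ← integral_smul]
    congr 1
    refine integral_congr_ae (Eventually.of_forall fun z => ?_)
    beta_reduce
    rw [LineDeriv.lineDerivOp_left_smul, _root_.smul_apply, smul_comm (gaussDensity z),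
      smul_smul, inv_mul_cancel₀ hb'.ne', one_smul]
  · refine (norm_translateAverage_le hρ hY v).trans ?_
    refine mul_le_mul_of_nonneg_right ?_ (norm_nonneg _)
    rw [gradConst, div_eq_inv_mul _ (√b), ← integral_const_mul]
    refine integral_mono hρ.norm (integrable_norm_mul_gaussDensity.const_mul _) fun z => ?_
    have h0 := gaussDensity_nonneg z
    beta_reduce
    rw [norm_mul, norm_mul, norm_mul, Real.norm_of_nonneg h0,
      Real.norm_of_nonneg (inv_nonneg.2 hb'.le), norm_neg,
      Real.norm_of_nonneg (by norm_num : (0 : ℝ) ≤ 1 / 2)]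
    refine mul_le_mul_of_nonneg_left (mul_le_mul_of_nonneg_right ?_ h0) (inv_nonneg.2 hb'.le)
    have := norm_inner_le_norm (𝕜 := ℝ) z (EuclideanSpace.single i (1 : ℝ))
    rw [PiLp.norm_single, norm_one, mul_one] at this
    linarith [norm_nonneg (inner ℝ z (EuclideanSpace.single i (1 : ℝ)))]

theorem posSemidef_smul_one {b : ℝ} (hb : 0 ≤ b) :
    (b • (1 : Matrix (Fin n) (Fin n) ℝ)).PosSemidef := Matrix.PosSemidef.one.smul hb

/-- Each of the derivatives uses up a factor `e^{bΔ}` of the heat semigroup. -/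
theorem exists_distrDeriv_heatSemigroup_aux {b : ℝ} (hb : 0 < b) (m : List (Fin n))
    (v : LqSpace n q) :
    ∃ w : LqSpace n q,
      toDistr w = distrDeriv m (toDistr (heatSemigroup ((m.length * b) • 1) v)) ∧
      ‖w‖ ≤ (gradConst n / √b) ^ m.length * ‖v‖ := by
  induction m with
  | nil => exact ⟨v, by simp [distrDeriv, heatSemigroup_zero], by simp⟩
  | cons i m ih =>
    obtain ⟨w, hw, hwn⟩ := ih
    obtain ⟨w', hw', hwn'⟩ := exists_lineDeriv_heatSemigroup hb i w
    refine ⟨w', ?_, ?_⟩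
    · have h1 : (((i :: m).length * b : ℝ) • (1 : Matrix (Fin n) (Fin n) ℝ)) =
          b • 1 + (m.length * b : ℝ) • 1 := by
        rw [← add_smul]; congr 1; simp; ring
      rw [h1, heatSemigroup_add (posSemidef_smul_one hb.le)
        (posSemidef_smul_one (by positivity)), hw',
        show i :: m = [i] ++ m from rfl, distrDeriv_append]
      congr 1
      rw [heatSemigroup_eq_gaussOp (scalar_factor hb.le),
        heatSemigroup_eq_gaussOp (scalar_factor hb.le)]
      exact toDistr_translateAverage_of_distrDeriv _ _ hw
    · have h0 : 0 ≤ gradConst n / √b := div_nonneg (gradConst_nonneg n) (Real.sqrt_nonneg _)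
      calc ‖w'‖ ≤ gradConst n / √b * ((gradConst n / √b) ^ m.length * ‖v‖) :=
            hwn'.trans (mul_le_mul_of_nonneg_left hwn h0)
        _ = _ := by rw [List.length_cons, pow_succ]; ring

/-- The constant in the smoothing estimate `‖∂_x^m T_A v‖_q ≤ C c^{-|m|/2} ‖v‖_q`, where `T_A` is
the heat semigroup and `A ≥ c`. It depends on the order `k = |m|` only. -/
def smoothingConst (n k : ℕ) : ℝ := (gradConst n * √k) ^ k

theorem smoothingConst_nonneg (n k : ℕ) : 0 ≤ smoothingConst n k :=
  pow_nonneg (mul_nonneg (gradConst_nonneg n) (Real.sqrt_nonneg _)) _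

theorem heatSemigroup_eq_of_sub {A : Matrix (Fin n) (Fin n) ℝ} {c : ℝ} (hc : 0 ≤ c)
    (hA : (A - c • 1).PosSemidef) (v : LqSpace n q) :
    heatSemigroup A v = heatSemigroup (A - c • 1) (heatSemigroup (c • 1) v) := by
  rw [← heatSemigroup_add hA (posSemidef_smul_one hc), sub_add_cancel]

/-- The smoothing estimate: `T_A = T_{A - c} e^{cΔ}`, the first factor is a contraction, and the
second one is divided evenly among the derivatives. -/
theorem exists_distrDeriv_heatSemigroup {A : Matrix (Fin n) (Fin n) ℝ} {c : ℝ} (hc : 0 < c)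
    (hA : (A - c • 1).PosSemidef) (m : List (Fin n)) (v : LqSpace n q) :
    ∃ w : LqSpace n q, toDistr w = distrDeriv m (toDistr (heatSemigroup A v)) ∧
      ‖w‖ ≤ smoothingConst n m.length * (1 / √c) ^ m.length * ‖v‖ := by
  rcases Nat.eq_zero_or_pos m.length with h0 | h0
  · refine ⟨heatSemigroup A v, ?_, ?_⟩
    · rw [List.length_eq_zero_iff.1 h0]; rfl
    · simpa [h0, smoothingConst] using norm_heatSemigroup_le A v
  · have h0' : (0 : ℝ) < m.length := by exact_mod_cast h0
    obtain ⟨w, hw, hwn⟩ := exists_distrDeriv_heatSemigroup_aux (b := c / m.length)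
      (by positivity) m v
    rw [mul_div_cancel₀ _ h0'.ne'] at hw
    refine ⟨heatSemigroup (A - c • 1) w, ?_, ?_⟩
    · rw [heatSemigroup_eq_of_sub hc.le hA]
      obtain ⟨S, hS⟩ := exists_factor hA
      rw [heatSemigroup_eq_gaussOp hS, heatSemigroup_eq_gaussOp hS]
      exact toDistr_translateAverage_of_distrDeriv _ _ hw
    · refine (norm_heatSemigroup_le _ w).trans (hwn.trans_eq ?_)
      rw [smoothingConst, ← mul_pow, Real.sqrt_div hc.le]
      congr 2
      have : 0 < √c := Real.sqrt_pos.2 hc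
      field_simp

theorem heatSemigroup_mem_sobolevInfty_of_pos {A : Matrix (Fin n) (Fin n) ℝ} {c : ℝ}
    (hc : 0 < c) (hA : (A - c • 1).PosSemidef) (v : LqSpace n q) :
    heatSemigroup A v ∈ sobolevInfty n q := fun m =>
  let ⟨w, hw, _⟩ := exists_distrDeriv_heatSemigroup hc hA m v
  ⟨w, hw⟩

theorem norm_weakDeriv_heatSemigroup_le {A : Matrix (Fin n) (Fin n) ℝ} {c : ℝ} (hc : 0 < c)
    (hA : (A - c • 1).PosSemidef) (m : List (Fin n)) (v : LqSpace n q) :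
    ‖weakDeriv m (heatSemigroup A v)‖ ≤
      smoothingConst n m.length * (1 / √c) ^ m.length * ‖v‖ := by
  obtain ⟨w, hw, hwn⟩ := exists_distrDeriv_heatSemigroup hc hA m v
  rwa [weakDeriv_eq hw]

theorem posSemidef_of_forall {A : Matrix (Fin n) (Fin n) ℝ} (hA : A.IsSymm)
    (h : ∀ x : Fin n → ℝ, 0 ≤ x ⬝ᵥ A.mulVec x) : A.PosSemidef := by
  refine Matrix.PosSemidef.of_dotProduct_mulVec_nonneg ?_ (fun x => by simpa using h x)
  rw [Matrix.IsHermitian, Matrix.conjTranspose_eq_transpose_of_trivial]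
  exact hA

theorem abs_dotProduct_mulVec_le {B : Matrix (Fin n) (Fin n) ℝ} {η : ℝ}
    (hB : ∀ i j, |B i j| ≤ η) (x : Fin n → ℝ) : |x ⬝ᵥ B.mulVec x| ≤ n * η * (x ⬝ᵥ x) := by
  have h1 : ∀ i j, |x i * (B i j * x j)| ≤ η * ((x i ^ 2 + x j ^ 2) / 2) := by
    intro i j
    rw [abs_mul, abs_mul]
    have h2 : |x i| * |x j| ≤ (x i ^ 2 + x j ^ 2) / 2 := by
      nlinarith [sq_nonneg (|x i| - |x j|), sq_abs (x i), sq_abs (x j)]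
    calc _ = |B i j| * (|x i| * |x j|) := by ring
      _ ≤ _ := mul_le_mul (hB i j) h2 (by positivity) ((abs_nonneg _).trans (hB i j))
  calc |x ⬝ᵥ B.mulVec x| = |∑ i, ∑ j, x i * (B i j * x j)| := by
        simp [dotProduct, Matrix.mulVec, Finset.mul_sum]
    _ ≤ ∑ i, ∑ j, η * ((x i ^ 2 + x j ^ 2) / 2) :=
        (Finset.abs_sum_le_sum_abs _ _).trans (Finset.sum_le_sum fun i _ =>
          (Finset.abs_sum_le_sum_abs _ _).trans (Finset.sum_le_sum fun j _ => h1 i j))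
    _ = _ := by
        simp only [← Finset.mul_sum, ← Finset.sum_div, Finset.sum_add_distrib, Finset.sum_const,
          Finset.card_univ, Fintype.card_fin, nsmul_eq_mul, dotProduct, ← sq]
        ring

/-- Comparison of `A ≤ D`: here `T_D = T_{D - A} T_A`, and the first order expansion of `T_{D - A}`
is applied to the smooth function `T_A v`. -/
theorem norm_heatSemigroup_sub_le_of_le {A D : Matrix (Fin n) (Fin n) ℝ} {c η : ℝ}
    (hc : 0 < c) (hA : (A - c • 1).PosSemidef) (hDA : (D - A).PosSemidef)
    (hη : ∀ i j, |(D - A) i j| ≤ η) (v : LqSpace n q) :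
    ‖heatSemigroup D v - heatSemigroup A v‖ ≤
      n ^ 2 * η * (smoothingConst n 2 * (1 / c) * ‖v‖) := by
  have hA' : A.PosSemidef := by
    simpa using hA.add (posSemidef_smul_one hc.le)
  have h1 : heatSemigroup D v = heatSemigroup (D - A) (heatSemigroup A v) := by
    rw [← heatSemigroup_add hDA hA', sub_add_cancel]
  rw [h1]
  refine (norm_heatSemigroup_sub_le hDA (heatSemigroup_mem_sobolevInfty_of_pos hc hA v)).trans
    (norm_diffusionAt_le hη [] fun i j => ?_)
  have := norm_weakDeriv_heatSemigroup_le hc hA [i, j] v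
  simpa [Real.sq_sqrt hc.le] using this

/-- Lipschitz dependence of the heat semigroup on the covariance matrix, away from the singular
matrices. Both matrices are compared with a common upper bound `D`. -/
theorem norm_heatSemigroup_sub_heatSemigroup_le_of_abs {A A' : Matrix (Fin n) (Fin n) ℝ}
    {c η : ℝ} (hc : 0 < c) (hA : (A - c • 1).PosSemidef) (hA' : (A' - c • 1).PosSemidef)
    (hη0 : 0 ≤ η) (hη : ∀ i j, |(A - A') i j| ≤ η) (v : LqSpace n q) :
    ‖heatSemigroup A v - heatSemigroup A' v‖ ≤
      n ^ 2 * (2 * n + 1) * smoothingConst n 2 * (η / c) * ‖v‖ := by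
  -- `n η` bounds the quadratic form of `A - A'`, so that `A ≤ D` and `A' ≤ D`
  set D := A + (n * η) • (1 : Matrix (Fin n) (Fin n) ℝ) with hD
  have hsymm : ∀ {B : Matrix (Fin n) (Fin n) ℝ}, (B - c • 1).PosSemidef → B.IsSymm := by
    intro B hB
    have h1 : B.PosSemidef := by simpa using hB.add (posSemidef_smul_one hc.le)
    have h2 := h1.isHermitian
    rwa [Matrix.IsHermitian, Matrix.conjTranspose_eq_transpose_of_trivial] at h2
  have hDA : D - A = (n * η) • (1 : Matrix (Fin n) (Fin n) ℝ) := by rw [hD]; abel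
  have hDA' : D - A' = (A - A') + (n * η) • (1 : Matrix (Fin n) (Fin n) ℝ) := by rw [hD]; abel
  have hone : ∀ i j, |((n * η) • (1 : Matrix (Fin n) (Fin n) ℝ)) i j| ≤ n * η := by
    intro i j
    rw [Matrix.smul_apply, smul_eq_mul, abs_mul, abs_of_nonneg (by positivity : 0 ≤ n * η)]
    refine mul_le_of_le_one_right (by positivity) ?_
    rw [Matrix.one_apply]
    split_ifs <;> simp
  have h1 := norm_heatSemigroup_sub_le_of_le (D := D) hc hA
    (by rw [hDA]; exact posSemidef_smul_one (by positivity)) (by rw [hDA]; exact hone) v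
  have h2 := norm_heatSemigroup_sub_le_of_le (D := D) (η := η + n * η) hc hA' (by
      refine posSemidef_of_forall ?_ fun x => ?_
      · rw [hDA']
        exact ((hsymm hA).sub (hsymm hA')).add (Matrix.isSymm_one.smul _)
      · rw [hDA', Matrix.add_mulVec, dotProduct_add, Matrix.smul_mulVec, Matrix.one_mulVec,
          dotProduct_smul, smul_eq_mul]
        linarith [(abs_le.1 (abs_dotProduct_mulVec_le hη x)).1])
    (fun i j => by
      rw [hDA', Matrix.add_apply]
      exact (abs_add_le _ _).trans (add_le_add (hη i j) (hone i j))) v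
  calc _ ≤ ‖heatSemigroup D v - heatSemigroup A v‖ + ‖heatSemigroup D v - heatSemigroup A' v‖ := by
        rw [show heatSemigroup A v - heatSemigroup A' v =
          (heatSemigroup D v - heatSemigroup A' v) - (heatSemigroup D v - heatSemigroup A v) by
            abel, add_comm]
        exact norm_sub_le _ _
    _ ≤ _ := add_le_add h1 h2
    _ = _ := by ring

/-- Lipschitz dependence of the spatial derivatives on the covariance matrix. -/
theorem norm_weakDeriv_sub_heatSemigroup_le {A A' : Matrix (Fin n) (Fin n) ℝ}
    {c η : ℝ} (hc : 0 < c) (hA : (A - c • 1).PosSemidef) (hA' : (A' - c • 1).PosSemidef)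
    (hη0 : 0 ≤ η) (hη : ∀ i j, |(A - A') i j| ≤ η) (m : List (Fin n)) (v : LqSpace n q) :
    ‖weakDeriv m (heatSemigroup A v) - weakDeriv m (heatSemigroup A' v)‖ ≤
      n ^ 2 * (2 * n + 1) * smoothingConst n 2 * (η / (c / 2)) *
        (smoothingConst n m.length * (1 / √(c / 2)) ^ m.length * ‖v‖) := by
  -- half of the ellipticity constant pays for the derivatives, the other half for the comparison
  have hc2 : 0 < c / 2 := by positivity
  have hs : ∀ {B : Matrix (Fin n) (Fin n) ℝ}, B - (c / 2) • 1 - (c / 2) • 1 = B - c • 1 := by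
    intro B
    rw [sub_sub, ← add_smul, add_halves]
  have hl : ∀ {B : Matrix (Fin n) (Fin n) ℝ}, (B - c • 1).PosSemidef →
      (B - (c / 2) • 1).PosSemidef := fun {B} hB => by
    have := hB.add (posSemidef_smul_one hc2.le)
    rwa [← hs, sub_add_cancel] at this
  set w := heatSemigroup ((c / 2) • 1) v with hw
  have hw0 : (((c / 2) • 1 : Matrix (Fin n) (Fin n) ℝ) - (c / 2) • 1).PosSemidef := by
    rw [sub_self]; exact Matrix.PosSemidef.zero
  have hwmem : w ∈ sobolevInfty n q := heatSemigroup_mem_sobolevInfty_of_pos hc2 hw0 v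
  rw [heatSemigroup_eq_of_sub hc2.le (hl hA), heatSemigroup_eq_of_sub hc2.le (hl hA'), ← hw,
    weakDeriv_heatSemigroup _ hwmem, weakDeriv_heatSemigroup _ hwmem]
  refine (norm_heatSemigroup_sub_heatSemigroup_le_of_abs hc2 (by rwa [hs]) (by rwa [hs]) hη0
    (by simpa using hη) _).trans ?_
  refine mul_le_mul_of_nonneg_left (norm_weakDeriv_heatSemigroup_le hc2 hw0 m v) ?_
  have := smoothingConst_nonneg n 2
  positivity

end Smoothing

/-! ### Heat operators, strong continuity and positivity -/

section HeatOp

variable {n : ℕ} {q : ℝ≥0∞}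

/-- The linear change of variables `y = S z`. -/
theorem integral_comp_toEuclideanCLM {S : Matrix (Fin n) (Fin n) ℝ} (hS : S.det ≠ 0)
    {F : Type*} [NormedAddCommGroup F] [NormedSpace ℝ F] (g : EuclideanSpace ℝ (Fin n) → F) :
    ∫ y, g y = ∫ z, |S.det| • g (Matrix.toEuclideanCLM (𝕜 := ℝ) S z) := by
  set L := Matrix.toEuclideanCLM (𝕜 := ℝ) S with hL
  set L' := Matrix.toEuclideanCLM (𝕜 := ℝ) S⁻¹ with hL'
  have hu : IsUnit S.det := isUnit_iff_ne_zero.2 hS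
  have h1 : ∀ z, L' (L z) = z := fun z => by
    have : (L' * L) z = z := by
      rw [hL, hL', ← map_mul, Matrix.nonsing_inv_mul _ hu, map_one]; rfl
    exact this
  have h2 : ∀ z, L (L' z) = z := fun z => by
    have : (L * L') z = z := by
      rw [hL, hL', ← map_mul, Matrix.mul_nonsing_inv _ hu, map_one]; rfl
    exact this
  have hdet : L.det = S.det := by
    rw [ContinuousLinearMap.det, hL, Matrix.coe_toEuclideanCLM_eq_toEuclideanLin,
      Matrix.toEuclideanLin_eq_toLin_orthonormal, LinearMap.det_toLin]
  have := integral_image_eq_integral_abs_det_fderiv_smul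
    (volume : Measure (EuclideanSpace ℝ (Fin n))) (s := univ) MeasurableSet.univ
    (f := L) (f' := fun _ => L) (fun z _ => L.hasFDerivAt.hasFDerivWithinAt)
    (fun z _ z' _ h => by rw [← h1 z, ← h1 z', h]) g
  have hsurj : Function.Surjective L := fun z => ⟨L' z, h2 z⟩
  rw [image_univ, hsurj.range_eq, Measure.restrict_univ, hdet] at this
  exact this

/-- The change of variables `x = S z` with `S Sᵀ = A(t) - A(s)` turns the heat kernel into the
standard Gaussian density. -/
theorem abs_det_mul_heatKernel {a : ℝ → Matrix (Fin n) (Fin n) ℝ} {s t : ℝ}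
    {S : Matrix (Fin n) (Fin n) ℝ} (hS : S.det ≠ 0)
    (h : S * S.transpose = diffusionIntegral a t - diffusionIntegral a s)
    (z : EuclideanSpace ℝ (Fin n)) :
    |S.det| * heatKernel a s t (Matrix.toEuclideanCLM (𝕜 := ℝ) S z) = gaussDensity z := by
  have hu : IsUnit S.det := isUnit_iff_ne_zero.2 hS
  have h1 : (Matrix.toEuclideanCLM (𝕜 := ℝ) S z).ofLp ⬝ᵥ (S * S.transpose)⁻¹.mulVec
      (Matrix.toEuclideanCLM (𝕜 := ℝ) S z).ofLp = ‖z‖ ^ 2 := by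
    rw [Matrix.ofLp_toEuclideanCLM, Matrix.mulVec_mulVec, Matrix.mul_inv_rev, Matrix.mul_assoc,
      Matrix.nonsing_inv_mul _ hu, Matrix.mul_one, dotProduct_comm, Matrix.dotProduct_mulVec,
      ← Matrix.mulVec_transpose, Matrix.mulVec_mulVec,
      Matrix.mul_nonsing_inv _ (by rwa [Matrix.det_transpose]), Matrix.one_mulVec,
      EuclideanSpace.real_norm_sq_eq]
    simp [dotProduct, sq]
  rw [heatKernel, ← h, h1, gaussDensity, Matrix.det_mul, Matrix.det_transpose,
    Real.sqrt_mul (by positivity), Real.sqrt_mul_self_eq_abs]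
  have : |S.det| ≠ 0 := abs_ne_zero.2 hS
  field_simp

theorem zero_mem_nonnegLq : (0 : LqSpace n q) ∈ nonnegLq n q :=
  show ∀ᵐ x, 0 ≤ ((0 : LqSpace n q) x).re ∧ ((0 : LqSpace n q) x).im = 0 by
    filter_upwards [Lp.coeFn_zero ℂ q (volume : Measure (EuclideanSpace ℝ (Fin n)))] with x hx
    rw [hx]
    simp

theorem add_mem_nonnegLq {v w : LqSpace n q} (hv : v ∈ nonnegLq n q) (hw : w ∈ nonnegLq n q) :
    v + w ∈ nonnegLq n q := by
  filter_upwards [hv, hw, Lp.coeFn_add v w] with x h1 h2 h3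
  rw [h3]
  simp [h1.2, h2.2, add_nonneg h1.1 h2.1]

theorem smul_mem_nonnegLq {v : LqSpace n q} (hv : v ∈ nonnegLq n q) {c : ℝ} (hc : 0 ≤ c) :
    c • v ∈ nonnegLq n q := by
  filter_upwards [hv, Lp.coeFn_smul c v] with x h1 h3
  rw [h3]
  simp [h1.2, mul_nonneg hc h1.1]

variable [Fact (1 ≤ q)]

/-- Convolution with the heat kernel is the heat semigroup. -/
theorem heatOp_eq_heatSemigroup {a : ℝ → Matrix (Fin n) (Fin n) ℝ} {s t : ℝ} (hst : s ≠ t)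
    (hA : (diffusionIntegral a t - diffusionIntegral a s).PosDef) (v : LqSpace n q) :
    heatOp a s t v = heatSemigroup (diffusionIntegral a t - diffusionIntegral a s) v := by
  obtain ⟨S, hS⟩ := exists_factor hA.posSemidef
  have hdet : S.det ≠ 0 := by
    intro h0
    have h1 := hA.det_pos
    rw [← hS, Matrix.det_mul, h0, zero_mul] at h1
    exact lt_irrefl _ h1
  have hconv : (heatKernel a s t ⋆[ContinuousLinearMap.lsmul ℝ ℝ, volume] (v : _ → ℂ)) =
      fun x => ∫ z, gaussDensity z • v (x - Matrix.toEuclideanCLM (𝕜 := ℝ) S z) := by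
    funext x
    rw [convolution_def, integral_comp_toEuclideanCLM hdet]
    refine integral_congr_ae (Eventually.of_forall fun z => ?_)
    beta_reduce
    rw [ContinuousLinearMap.lsmul_apply, smul_smul, abs_det_mul_heatKernel hdet hS]
  have hmem : MemLp (heatKernel a s t ⋆[ContinuousLinearMap.lsmul ℝ ℝ, volume] (v : _ → ℂ)) q
      volume := by
    rw [hconv]
    exact (memLp_average integrable_gaussDensity
      (Y := fun z => Matrix.toEuclideanCLM (𝕜 := ℝ) S z) (by fun_prop) v).1
  rw [heatOp, if_neg hst, dif_pos hmem, heatSemigroup_eq_gaussOp hS]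
  refine Lp.ext ?_
  refine hmem.coeFn_toLp.trans ?_
  rw [hconv]
  exact (coeFn_translateAverage integrable_gaussDensity
      (Y := fun z => Matrix.toEuclideanCLM (𝕜 := ℝ) S z) (by fun_prop) v).symm

theorem schwartz_mem_sobolevInfty (φ : 𝓢(EuclideanSpace ℝ (Fin n), ℂ)) :
    (φ.toLp q volume : LqSpace n q) ∈ sobolevInfty n q := by
  intro m
  suffices h : ∃ ψ : 𝓢(EuclideanSpace ℝ (Fin n), ℂ),
      toDistr (ψ.toLp q volume : LqSpace n q) = distrDeriv m (toDistr (φ.toLp q volume)) by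
    obtain ⟨ψ, hψ⟩ := h
    exact ⟨_, hψ⟩
  have h1 : ∀ ψ : 𝓢(EuclideanSpace ℝ (Fin n), ℂ), toDistr (ψ.toLp q volume : LqSpace n q) =
      ψ.toTemperedDistributionCLM _ _ volume := fun ψ => Lp.toTemperedDistribution_toLp_eq ψ
  induction m with
  | nil => exact ⟨φ, rfl⟩
  | cons i m ih =>
    obtain ⟨ψ, hψ⟩ := ih
    refine ⟨∂_{EuclideanSpace.single i (1 : ℝ)} ψ, ?_⟩
    show _ = ∂_{EuclideanSpace.single i (1 : ℝ)} (distrDeriv m (toDistr (φ.toLp q volume)))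
    rw [← hψ, h1, h1]
    exact (TemperedDistribution.lineDerivOp_toTemperedDistributionCLM_eq ψ _).symm

theorem norm_toEuclideanCLM_le (S : Matrix (Fin n) (Fin n) ℝ) (z : EuclideanSpace ℝ (Fin n)) :
    ‖Matrix.toEuclideanCLM (𝕜 := ℝ) S z‖ ≤ √((S * S.transpose).trace) * ‖z‖ := by
  have htr : (S * S.transpose).trace = ∑ i, ∑ j, S i j ^ 2 := by
    simp [Matrix.trace, Matrix.mul_apply, sq]
  rw [htr]
  have h := Real.sq_sqrt (show 0 ≤ ∑ i, ∑ j, S i j ^ 2 by positivity)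
  refine (sq_le_sq₀ (norm_nonneg _) (by positivity)).1 ?_
  rw [mul_pow, h, EuclideanSpace.real_norm_sq_eq, EuclideanSpace.real_norm_sq_eq, Finset.sum_mul]
  refine Finset.sum_le_sum fun i _ => ?_
  rw [Matrix.ofLp_toEuclideanCLM]
  exact Finset.sum_mul_sq_le_sq_mul_sq Finset.univ (fun j => S i j) (fun j => z.ofLp j)

/-- Modulus-of-continuity bound for Gaussian averages of bounded uniformly continuous functions. -/
theorem norm_heatSemigroup_sub_le_of_uniformContinuous (hq : q = ⊤) {v : LqSpace n q}
    {g : EuclideanSpace ℝ (Fin n) → ℂ} (hg : UniformContinuous g) (hv : v =ᵐ[volume] g)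
    {ε : ℝ} (hε : 0 < ε) : ∃ C, 0 ≤ C ∧ ∀ B : Matrix (Fin n) (Fin n) ℝ, B.PosSemidef →
      ‖heatSemigroup B v - v‖ ≤ ε + C * √B.trace := by
  subst hq
  obtain ⟨δ, hδ, hgδ⟩ := Metric.uniformContinuous_iff.1 hg ε hε
  refine ⟨2 * ‖v‖ / δ * gradConst n, mul_nonneg (by positivity) (gradConst_nonneg n),
    fun B hB => ?_⟩
  obtain ⟨S, hS⟩ := exists_factor hB
  set L := Matrix.toEuclideanCLM (𝕜 := ℝ) S with hL
  have hY : Measurable fun z => L z := by fun_prop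
  rw [heatSemigroup_eq_gaussOp hS]
  have hbd : ∀ᵐ x, ‖v x‖ ≤ ‖v‖ := by
    have hfin : eLpNormEssSup (v : _ → ℂ) (volume : Measure (EuclideanSpace ℝ (Fin n))) ≠ ⊤ := by
      have := (Lp.memLp v).2.ne
      rwa [eLpNorm_exponent_top] at this
    filter_upwards [enorm_ae_le_eLpNormEssSup (v : _ → ℂ) volume] with x hx
    rw [Lp.norm_def, eLpNorm_exponent_top, ← toReal_enorm]
    exact ENNReal.toReal_mono hfin hx
  have h0 : 0 ≤ ε + 2 * ‖v‖ / δ * gradConst n * √B.trace := by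
    have := gradConst_nonneg n
    positivity
  rw [Lp.norm_def, eLpNorm_exponent_top]
  refine ENNReal.toReal_le_of_le_ofReal h0 (eLpNormEssSup_le_of_ae_bound ?_)
  have hint1 := integrable_norm_mul_gaussDensity (n := n)
  filter_upwards [Lp.coeFn_sub (gaussOp S v) v,
    coeFn_translateAverage integrable_gaussDensity hY v, hbd, hv,
    ae_integrable_average integrable_gaussDensity hY v,
    Measure.ae_ae_of_ae_prod ((quasiMeasurePreserving_sub (P := volume) hY).ae hbd),
    ae_ae_eq_translate (P := volume) hY hv] with x h1 h2 h3 h4 h5 h6 h7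
  have h2' : (gaussOp S v : _ → ℂ) x = ∫ z, gaussDensity z • v (x - L z) := h2
  have hvx : v x = ∫ z : EuclideanSpace ℝ (Fin n), gaussDensity z • v x := by
    rw [integral_smul_const, integral_gaussDensity, one_smul]
  rw [h1, Pi.sub_apply, h2', hvx, ← integral_sub h5 (integrable_gaussDensity.smul_const _)]
  have hle : ∀ᵐ z, ‖gaussDensity z • v (x - L z) - gaussDensity z • v x‖ ≤
      ε * gaussDensity z + 2 * ‖v‖ / δ * √B.trace * (‖z‖ * gaussDensity z) := by
    filter_upwards [h6, h7] with z h8 h9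
    have hz0 := gaussDensity_nonneg z
    rw [← smul_sub, norm_smul, Real.norm_of_nonneg hz0]
    -- uniform continuity for `‖L z‖ < δ`; otherwise `2 ‖v‖ ≤ 2 ‖v‖ ‖L z‖ / δ`
    have hz1 : ‖v (x - L z) - v x‖ ≤ ε + 2 * ‖v‖ / δ * (√B.trace * ‖z‖) := by
      rcases lt_or_ge ‖L z‖ δ with hlt | hge
      · rw [h9, h4, ← dist_eq_norm]
        have : dist (x - L z) x < δ := by simpa [dist_eq_norm] using hlt
        have h10 : 0 ≤ 2 * ‖v‖ / δ * (√B.trace * ‖z‖) := by positivity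
        linarith [hgδ this]
      · have h10 : ‖v (x - L z) - v x‖ ≤ 2 * ‖v‖ := by
          linarith [norm_sub_le (v (x - L z)) (v x)]
        have h11 : δ ≤ √B.trace * ‖z‖ := by
          rw [← hS]; exact hge.trans (norm_toEuclideanCLM_le S z)
        have h12 : 2 * ‖v‖ / δ * δ ≤ 2 * ‖v‖ / δ * (√B.trace * ‖z‖) :=
          mul_le_mul_of_nonneg_left h11 (by positivity)
        rw [div_mul_cancel₀ _ hδ.ne'] at h12
        linarith
    calc _ ≤ gaussDensity z * (ε + 2 * ‖v‖ / δ * (√B.trace * ‖z‖)) :=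
          mul_le_mul_of_nonneg_left hz1 hz0
      _ = _ := by ring
  have hbound := (integrable_gaussDensity (n := n)).const_mul ε |>.add
    (hint1.const_mul (2 * ‖v‖ / δ * √B.trace))
  refine (norm_integral_le_of_norm_le hbound hle).trans_eq ?_
  simp only [Pi.add_apply]
  rw [integral_add ((integrable_gaussDensity (n := n)).const_mul ε)
    (hint1.const_mul (2 * ‖v‖ / δ * √B.trace)), integral_const_mul, integral_const_mul,
    integral_gaussDensity, gradConst]
  ring

/-- Strong continuity of the heat semigroup at `B = 0` on the admissible initial data: for `q < ∞`
Schwartz functions are dense, for `q = ∞` uniform continuity takes the place of density. -/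
theorem tendsto_heatSemigroup {v : LqSpace n q} (hv : v ∈ initialData n q) {ι : Type*}
    {l : Filter ι} {B : ι → Matrix (Fin n) (Fin n) ℝ} (hB : ∀ᶠ x in l, (B x).PosSemidef)
    (hlim : ∀ i j, Tendsto (fun x => B x i j) l (𝓝 0)) :
    Tendsto (fun x => heatSemigroup (B x) v) l (𝓝 v) := by
  rw [Metric.tendsto_nhds]
  intro ε hε
  rcases eq_or_ne q ⊤ with hq | hq
  · obtain ⟨g, hg, hvg⟩ := hv hq
    obtain ⟨C, hC0, hC⟩ := norm_heatSemigroup_sub_le_of_uniformContinuous hq hg hvg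
      (half_pos hε)
    have h1 : Tendsto (fun x => ε / 2 + C * √(B x).trace) l (𝓝 (ε / 2 + C * √0)) := by
      refine (Tendsto.const_mul C ?_).const_add _
      refine (Real.continuous_sqrt.tendsto 0).comp ?_
      have := tendsto_finsetSum Finset.univ fun i (_ : i ∈ Finset.univ) => hlim i i
      simpa [Matrix.trace] using this
    have h2 : ε / 2 + C * √0 < ε := by simp; linarith
    filter_upwards [hB, h1.eventually (gt_mem_nhds h2)] with x hx1 hx2
    rw [dist_eq_norm]
    exact (hC _ hx1).trans_lt hx2
  · obtain ⟨φ, hφ⟩ := (SchwartzMap.denseRange_toLpCLM (E := EuclideanSpace ℝ (Fin n)) (F := ℂ)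
      (μ := volume) hq).exists_dist_lt v (by positivity : 0 < ε / 3)
    set w : LqSpace n q := φ.toLp q volume with hw
    have hφ' : ‖v - w‖ < ε / 3 := by rwa [dist_eq_norm] at hφ
    have hwm : w ∈ sobolevInfty n q := schwartz_mem_sobolevInfty φ
    have h1 : Tendsto (fun x => ‖diffusionAt (B x) [] w‖) l (𝓝 0) := by
      have : Tendsto (fun x => diffusionAt (B x) [] w) l (𝓝 (∑ i : Fin n, ∑ j : Fin n,
          (0 : ℝ) • weakDeriv ([] ++ [i, j]) w)) :=
        tendsto_finsetSum _ fun i _ => tendsto_finsetSum _ fun j _ =>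
          (hlim i j).smul_const _
      simpa using this.norm
    filter_upwards [hB, h1.eventually (gt_mem_nhds (by positivity : 0 < ε / 3))] with x hx1 hx2
    rw [dist_eq_norm]
    have h3 : heatSemigroup (B x) v - v = heatSemigroup (B x) (v - w) +
        (heatSemigroup (B x) w - w) - (v - w) := by rw [map_sub]; abel
    rw [h3]
    have h4 := norm_heatSemigroup_le (B x) (v - w)
    have h5 := norm_heatSemigroup_sub_le hx1 hwm
    have h6 := norm_sub_le (heatSemigroup (B x) (v - w) + (heatSemigroup (B x) w - w)) (v - w)
    have h7 := norm_add_le (heatSemigroup (B x) (v - w)) (heatSemigroup (B x) w - w)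
    linarith

theorem heatSemigroup_nonneg (B : Matrix (Fin n) (Fin n) ℝ) {v : LqSpace n q}
    (hv : v ∈ nonnegLq n q) : heatSemigroup B v ∈ nonnegLq n q := by
  by_cases h : ∃ S : Matrix (Fin n) (Fin n) ℝ, S * S.transpose = B
  · obtain ⟨S, hS⟩ := h
    rw [heatSemigroup_eq_gaussOp hS]
    have hY : Measurable fun z => Matrix.toEuclideanCLM (𝕜 := ℝ) S z := by fun_prop
    have hv' : ∀ᵐ x, 0 ≤ (v x).re ∧ (v x).im = 0 := hv
    show ∀ᵐ x, 0 ≤ (gaussOp S v x).re ∧ (gaussOp S v x).im = 0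
    filter_upwards [coeFn_translateAverage integrable_gaussDensity hY v,
      ae_integrable_average integrable_gaussDensity hY v,
      Measure.ae_ae_of_ae_prod ((quasiMeasurePreserving_sub (P := volume) hY).ae hv')]
      with x h1 h2 h3
    have h1' : (gaussOp S v : _ → ℂ) x =
      ∫ z, gaussDensity z • v (x - Matrix.toEuclideanCLM (𝕜 := ℝ) S z) := h1
    rw [h1']
    constructor
    · have := Complex.reCLM.integral_comp_comm h2
      rw [Complex.reCLM_apply] at this
      rw [← this]
      refine integral_nonneg_of_ae ?_
      filter_upwards [h3] with z hz
      simpa using mul_nonneg (gaussDensity_nonneg z) hz.1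
    · have := Complex.imCLM.integral_comp_comm h2
      rw [Complex.imCLM_apply] at this
      rw [← this]
      refine integral_eq_zero_of_ae ?_
      filter_upwards [h3] with z hz
      simp [hz.2]
  · simpa [heatSemigroup, h] using zero_mem_nonnegLq

theorem isClosed_nonnegLq : IsClosed (nonnegLq n q) := by
  have h1 : nonnegLq n q = (fun v => Complex.reCLM.compLpL q volume v) ⁻¹' Ici 0 ∩
      (fun v => Complex.imCLM.compLpL q volume v) ⁻¹' {0} := by
    ext v
    simp only [nonnegLq, Set.mem_ofPred_eq, eventually_and, mem_inter_iff, mem_preimage, mem_Ici,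
      mem_singleton_iff]
    refine and_congr ?_ ?_
    · rw [← Lp.coeFn_nonneg]
      have h2 := Complex.reCLM.coeFn_compLpL v
      constructor <;> intro h <;> filter_upwards [h, h2] with x hx hx2
      · rw [hx2]; exact hx
      · rw [hx2] at hx; exact hx
    · rw [Lp.eq_zero_iff_ae_eq_zero]
      have h2 := Complex.imCLM.coeFn_compLpL v
      constructor <;> intro h <;> filter_upwards [h, h2] with x hx hx2
      · rw [hx2]; exact hx
      · rw [hx2] at hx; exact hx
  rw [h1]
  exact (isClosed_Ici.preimage (ContinuousLinearMap.continuous _)).inter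
    (isClosed_singleton.preimage (ContinuousLinearMap.continuous _))

theorem intervalIntegral_mem_nonnegLq {t : ℝ} (ht : 0 ≤ t) {w : ℝ → LqSpace n q}
    (hw : ∀ s ∈ Ioo 0 t, w s ∈ nonnegLq n q) (hint : IntervalIntegrable w volume 0 t) :
    ∫ s in (0 : ℝ)..t, w s ∈ nonnegLq n q := by
  rcases ht.eq_or_lt with rfl | ht0
  · rw [intervalIntegral.integral_same]
    exact zero_mem_nonnegLq
  · rw [intervalIntegral.integral_of_le ht, integral_Ioc_eq_integral_Ioo]
    have hi : IntegrableOn w (Ioo 0 t) :=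
      ((intervalIntegrable_iff_integrableOn_Ioc_of_le ht).1 hint).mono_set Ioo_subset_Ioc_self
    have hconv : Convex ℝ (nonnegLq n q) := fun v hv w hw a b ha hb _ =>
      add_mem_nonnegLq (smul_mem_nonnegLq hv ha) (smul_mem_nonnegLq hw hb)
    -- the average over `(0, t)` lies in the closed convex cone
    have := hconv.set_average_mem isClosed_nonnegLq (t := Ioo 0 t) (μ := volume) (by simp [ht0])
      (by simp) ((ae_restrict_iff' measurableSet_Ioo).2 (Eventually.of_forall hw)) hi
    rw [setAverage_eq] at this
    have h2 := smul_mem_nonnegLq this ht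
    rw [smul_smul] at h2
    simpa [measureReal_def, ht, ht0.ne'] using h2

end HeatOp

/-! ### The evolution family of a time-dependent diffusivity -/

section Evolution

variable {n : ℕ} {q : ℝ≥0∞}

/-- A diffusivity that is continuous on `[0, ∞)`, with `a(t) ≥ κ > 0` as quadratic forms for
`0 < t ≤ T`. -/
structure IsElliptic (a : ℝ → Matrix (Fin n) (Fin n) ℝ) (T κ : ℝ) : Prop where
  pos : 0 < κ
  cont : ∀ i j, ContinuousOn (fun t => a t i j) (Ici 0)
  posSemidef_sub : ∀ t ∈ Ioc 0 T, (a t - κ • 1).PosSemidef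

/-- The increment `A(t) - A(s)` of `A(t) = ∫₀ᵗ a`. -/
def diffusionIncr (a : ℝ → Matrix (Fin n) (Fin n) ℝ) (s t : ℝ) : Matrix (Fin n) (Fin n) ℝ :=
  diffusionIntegral a t - diffusionIntegral a s

theorem diffusionIncr_self (a : ℝ → Matrix (Fin n) (Fin n) ℝ) (t : ℝ) :
    diffusionIncr a t t = 0 := sub_self _

theorem diffusionIncr_add (a : ℝ → Matrix (Fin n) (Fin n) ℝ) (s r t : ℝ) :
    diffusionIncr a r t + diffusionIncr a s r = diffusionIncr a s t := by
  simp [diffusionIncr]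

theorem IsElliptic.mono {a : ℝ → Matrix (Fin n) (Fin n) ℝ} {T T' κ κ' : ℝ}
    (h : IsElliptic a T κ) (hT : T' ≤ T) (hκ0 : 0 < κ') (hκ : κ' ≤ κ) : IsElliptic a T' κ' :=
  ⟨hκ0, h.cont, fun t ht => by
    have := (h.posSemidef_sub t ⟨ht.1, ht.2.trans hT⟩).add
      (posSemidef_smul_one (n := n) (sub_nonneg.2 hκ))
    have e : a t - κ • (1 : Matrix (Fin n) (Fin n) ℝ) + (κ - κ') • 1 = a t - κ' • 1 := by
      rw [sub_smul]; abel
    rwa [e] at this⟩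

variable {a : ℝ → Matrix (Fin n) (Fin n) ℝ}

theorem intervalIntegrable_entry (ha : ∀ i j, ContinuousOn (fun t => a t i j) (Ici 0))
    {s t : ℝ} (hs : 0 ≤ s) (ht : 0 ≤ t) (i j : Fin n) :
    IntervalIntegrable (fun r => a r i j) volume s t :=
  ((ha i j).mono fun _ hx => (le_min hs ht).trans hx.1).intervalIntegrable

theorem diffusionIncr_apply (ha : ∀ i j, ContinuousOn (fun t => a t i j) (Ici 0))
    {s t : ℝ} (hs : 0 ≤ s) (ht : 0 ≤ t) (i j : Fin n) :
    diffusionIncr a s t i j = ∫ r in s..t, a r i j := by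
  rw [diffusionIncr, Matrix.sub_apply, diffusionIntegral, diffusionIntegral, Matrix.of_apply,
    Matrix.of_apply, intervalIntegral.integral_interval_sub_left
      (intervalIntegrable_entry ha le_rfl ht i j) (intervalIntegrable_entry ha le_rfl hs i j)]

theorem dotProduct_diffusionIncr (ha : ∀ i j, ContinuousOn (fun t => a t i j) (Ici 0))
    {s t : ℝ} (hs : 0 ≤ s) (ht : 0 ≤ t) (x : Fin n → ℝ) :
    x ⬝ᵥ (diffusionIncr a s t).mulVec x = ∫ r in s..t, x ⬝ᵥ (a r).mulVec x := by
  simp only [dotProduct, Matrix.mulVec, Finset.mul_sum]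
  have hi : ∀ i j, IntervalIntegrable (fun r => x i * (a r i j * x j)) volume s t := fun i j =>
    ((intervalIntegrable_entry ha hs ht i j).mul_const _).const_mul _
  have hi' : ∀ i, IntervalIntegrable (fun r => ∑ j, x i * (a r i j * x j)) volume s t := fun i => by
    have := IntervalIntegrable.sum (f := fun j r => x i * (a r i j * x j)) Finset.univ
      fun j _ => hi i j
    refine this.congr fun r _ => ?_
    simp
  rw [intervalIntegral.integral_finsetSum fun i _ => hi' i]
  refine Finset.sum_congr rfl fun i _ => ?_
  rw [intervalIntegral.integral_finsetSum fun j _ => hi i j]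
  refine Finset.sum_congr rfl fun j _ => ?_
  rw [intervalIntegral.integral_const_mul, intervalIntegral.integral_mul_const,
    diffusionIncr_apply ha hs ht]

namespace IsElliptic

variable {T κ : ℝ}

theorem isSymm_diffusionIncr (h : IsElliptic a T κ) {s t : ℝ} (hs : 0 ≤ s) (hst : s ≤ t)
    (ht : t ≤ T) : (diffusionIncr a s t).IsSymm := by
  refine Matrix.IsSymm.ext fun i j => ?_
  rw [diffusionIncr_apply h.cont hs (hs.trans hst), diffusionIncr_apply h.cont hs (hs.trans hst)]
  refine intervalIntegral.integral_congr_ae (Eventually.of_forall fun r hr => ?_)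
  rw [uIoc_of_le hst] at hr
  have h1 := (h.posSemidef_sub r ⟨hs.trans_lt hr.1, hr.2.trans ht⟩).add
    (posSemidef_smul_one (n := n) h.pos.le)
  rw [sub_add_cancel] at h1
  simpa using h1.isHermitian.apply i j

/-- `A(t) - A(s) ≥ c` whenever `c ≤ (t - s) κ`. -/
theorem posSemidef_diffusionIncr_sub (h : IsElliptic a T κ) {s t c : ℝ} (hs : 0 ≤ s)
    (hst : s ≤ t) (ht : t ≤ T) (hc : c ≤ (t - s) * κ) :
    (diffusionIncr a s t - c • 1).PosSemidef := by
  refine posSemidef_of_forall ?_ fun x => ?_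
  · exact (h.isSymm_diffusionIncr hs hst ht).sub (Matrix.isSymm_one.smul c)
  · have hcont : ContinuousOn (fun r => x ⬝ᵥ (a r).mulVec x) (Icc s t) := by
      simp only [dotProduct, Matrix.mulVec]
      exact continuousOn_finsetSum _ fun i _ => continuousOn_const.mul
        (continuousOn_finsetSum _ fun j _ =>
          ((h.cont i j).mono fun r hr => hs.trans hr.1).mul continuousOn_const)
    have h0 : 0 ≤ x ⬝ᵥ x := Finset.sum_nonneg fun i _ => mul_self_nonneg _
    have h1 : ∫ _ in s..t, κ * (x ⬝ᵥ x) ≤ ∫ r in s..t, x ⬝ᵥ (a r).mulVec x := by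
      refine intervalIntegral.integral_mono_on_of_le_Ioo hst (by simp)
        (hcont.intervalIntegrable_of_Icc hst) fun r hr => ?_
      have h2 :=
        (h.posSemidef_sub r ⟨hs.trans_lt hr.1, hr.2.le.trans ht⟩).dotProduct_mulVec_nonneg x
      simp only [star_trivial, Matrix.sub_mulVec, Matrix.smul_mulVec, Matrix.one_mulVec,
        dotProduct_sub, dotProduct_smul, smul_eq_mul] at h2
      linarith
    rw [intervalIntegral.integral_const, smul_eq_mul] at h1
    rw [Matrix.sub_mulVec, Matrix.smul_mulVec, Matrix.one_mulVec, dotProduct_sub,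
      dotProduct_smul, smul_eq_mul, dotProduct_diffusionIncr h.cont hs (hs.trans hst)]
    have h3 := mul_le_mul_of_nonneg_right hc h0
    linarith

theorem posSemidef_diffusionIncr (h : IsElliptic a T κ) {s t : ℝ} (hs : 0 ≤ s)
    (hst : s ≤ t) (ht : t ≤ T) : (diffusionIncr a s t).PosSemidef := by
  simpa using h.posSemidef_diffusionIncr_sub (c := 0) hs hst ht
    (mul_nonneg (sub_nonneg.2 hst) h.pos.le)

theorem posDef_diffusionIncr (h : IsElliptic a T κ) {s t : ℝ} (hs : 0 ≤ s)
    (hst : s < t) (ht : t ≤ T) : (diffusionIncr a s t).PosDef := by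
  have h1 := h.posSemidef_diffusionIncr_sub hs hst.le ht le_rfl
  have h2 : ((((t - s) * κ) • 1 : Matrix (Fin n) (Fin n) ℝ)).PosDef :=
    Matrix.PosDef.one.smul (mul_pos (sub_pos.2 hst) h.pos)
  simpa using h2.add_posSemidef h1

theorem abs_diffusionIncr_le (h : ∀ i j, ContinuousOn (fun t => a t i j) (Ici 0)) {s t M : ℝ}
    (hs : 0 ≤ s) (hst : s ≤ t) (i j : Fin n) (hM : ∀ r ∈ Ioc s t, |a r i j| ≤ M) :
    |diffusionIncr a s t i j| ≤ (t - s) * M := by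
  rw [diffusionIncr_apply h hs (hs.trans hst), ← Real.norm_eq_abs]
  refine (intervalIntegral.norm_integral_le_of_norm_le_const (C := M) fun r hr => ?_).trans_eq ?_
  · rw [uIoc_of_le hst] at hr
    exact hM r hr
  · rw [abs_of_nonneg (sub_nonneg.2 hst), mul_comm]

variable [Fact (1 ≤ q)]

theorem heatOp_eq (h : IsElliptic a T κ) {s t : ℝ} (hs : 0 ≤ s) (hst : s ≤ t) (ht : t ≤ T)
    (v : LqSpace n q) : heatOp a s t v = heatSemigroup (diffusionIncr a s t) v := by
  rcases hst.eq_or_lt with rfl | hlt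
  · rw [diffusionIncr_self, heatSemigroup_zero, heatOp, if_pos rfl]
  · exact heatOp_eq_heatSemigroup hlt.ne (h.posDef_diffusionIncr hs hlt ht) v

/-- The evolution law `W_{s,t} = W_{r,t} W_{s,r}`. -/
theorem heatSemigroup_comp (h : IsElliptic a T κ) {s r t : ℝ} (hs : 0 ≤ s) (hsr : s ≤ r)
    (hrt : r ≤ t) (ht : t ≤ T) (v : LqSpace n q) :
    heatSemigroup (diffusionIncr a s t) v =
      heatSemigroup (diffusionIncr a r t) (heatSemigroup (diffusionIncr a s r) v) := by
  rw [← heatSemigroup_add (h.posSemidef_diffusionIncr (hs.trans hsr) hrt ht)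
    (h.posSemidef_diffusionIncr hs hsr (hrt.trans ht)), diffusionIncr_add]

/-- Continuity of `W_{s,t} v` in the starting time `s`, for smooth `v`. -/
theorem norm_heatSemigroup_sub_left_le (h : IsElliptic a T κ) {s r t : ℝ} (hs : 0 ≤ s)
    (hr : 0 ≤ r) (hst : s ≤ t) (hrt : r ≤ t) (ht : t ≤ T) {v : LqSpace n q}
    (hv : v ∈ sobolevInfty n q) :
    ‖heatSemigroup (diffusionIncr a s t) v - heatSemigroup (diffusionIncr a r t) v‖ ≤
      ‖diffusionAt (diffusionIncr a r s) [] v‖ := by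
  have key : ∀ {s r : ℝ}, 0 ≤ s → s ≤ r → r ≤ t →
      ‖heatSemigroup (diffusionIncr a s t) v - heatSemigroup (diffusionIncr a r t) v‖ ≤
      ‖diffusionAt (diffusionIncr a s r) [] v‖ := by
    intro s r hs hsr hrt
    have e : diffusionIncr a s t - diffusionIncr a r t = diffusionIncr a s r := by
      simp [diffusionIncr]
    have := norm_heatSemigroup_sub_heatSemigroup_le (A := diffusionIncr a s t)
      (h.posSemidef_diffusionIncr (hs.trans hsr) hrt ht)
      (by rw [e]; exact h.posSemidef_diffusionIncr hs hsr (hrt.trans ht)) hv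
    rwa [e] at this
  rcases le_total s r with hsr | hrs
  · have e : diffusionIncr a r s = (-1 : ℝ) • diffusionIncr a s r := by simp [diffusionIncr]
    rw [e, diffusionAt_smul, norm_smul, norm_neg, norm_one, one_mul]
    exact key hs hsr hrt
  · rw [norm_sub_rev]
    exact key hr hrs hst

end IsElliptic

theorem tendsto_diffusionIncr (ha : ∀ i j, ContinuousOn (fun t => a t i j) (Ici 0)) {r : ℝ}
    (hr : 0 ≤ r) (i j : Fin n) :
    Tendsto (fun s => diffusionIncr a r s i j) (𝓝[Ici 0] r) (𝓝 0) := by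
  have h0 : IntegrableOn (fun t => a t i j) (uIcc 0 (r + 1)) :=
    ContinuousOn.integrableOn_compact isCompact_uIcc
      ((ha i j).mono (by rw [uIcc_of_le (by linarith)]; exact Icc_subset_Ici_self))
  have h1 := intervalIntegral.continuousOn_primitive_interval h0
  rw [uIcc_of_le (by linarith)] at h1
  have hmem : Icc 0 (r + 1) ∈ 𝓝[Ici 0] r :=
    mem_nhdsWithin.2 ⟨Iio (r + 1), isOpen_Iio, by simp, fun x hx => ⟨hx.2, hx.1.le⟩⟩
  have h2 := (h1 r ⟨hr, by linarith⟩).mono_of_mem_nhdsWithin hmem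
  have h3 := h2.tendsto.sub_const (∫ t in (0 : ℝ)..r, a t i j)
  rw [sub_self] at h3
  refine h3.congr fun s => ?_
  rw [diffusionIncr, Matrix.sub_apply, diffusionIntegral, diffusionIntegral, Matrix.of_apply,
    Matrix.of_apply]

variable [Fact (1 ≤ q)]

theorem tendsto_diffusionAt_diffusionIncr
    (ha : ∀ i j, ContinuousOn (fun t => a t i j) (Ici 0)) {r : ℝ}
    (hr : 0 ≤ r) (m : List (Fin n)) (v : LqSpace n q) :
    Tendsto (fun s => diffusionAt (diffusionIncr a r s) m v) (𝓝[Ici 0] r) (𝓝 0) := by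
  have : Tendsto (fun s => diffusionAt (diffusionIncr a r s) m v) (𝓝[Ici 0] r)
      (𝓝 (∑ i : Fin n, ∑ j : Fin n, (0 : ℝ) • weakDeriv (m ++ [i, j]) v)) :=
    tendsto_finsetSum _ fun i _ => tendsto_finsetSum _ fun j _ =>
      (tendsto_diffusionIncr ha hr i j).smul_const _
  simpa using this

namespace IsElliptic

variable {T κ : ℝ}

/-- The integrand of the Duhamel formula is continuous up to the final time `t`, because `g` takes
smooth values. -/
theorem continuousOn_heatSemigroup (h : IsElliptic a T κ) {t : ℝ} (ht : t ≤ T)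
    {g : ℝ → LqSpace n q} (hg : ContinuousOn g (Ioi 0))
    (hgm : ∀ s, 0 < s → g s ∈ sobolevInfty n q) :
    ContinuousOn (fun s => heatSemigroup (diffusionIncr a s t) (g s)) (Ioc 0 t) := by
  intro r hr
  have h1 : Tendsto (fun s => ‖g s - g r‖ + ‖diffusionAt (diffusionIncr a r s) [] (g r)‖)
      (𝓝[Ioc 0 t] r) (𝓝 (0 + 0)) := by
    refine Tendsto.add ?_ ?_
    · have := ((hg r hr.1).mono
        (show Ioc 0 t ⊆ Ioi 0 from fun x hx => hx.1)).tendsto.sub_const (g r)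
      rw [sub_self] at this
      simpa using this.norm
    · have := (tendsto_diffusionAt_diffusionIncr h.cont hr.1.le [] (g r)).mono_left
        (nhdsWithin_mono r (show Ioc 0 t ⊆ Ici 0 from fun x hx => hx.1.le))
      simpa using this.norm
  rw [add_zero] at h1
  rw [ContinuousWithinAt, tendsto_iff_norm_sub_tendsto_zero]
  refine squeeze_zero' (Eventually.of_forall fun _ => norm_nonneg _) ?_ h1
  filter_upwards [self_mem_nhdsWithin] with s hs
  have e : heatSemigroup (diffusionIncr a s t) (g s) - heatSemigroup (diffusionIncr a r t) (g r) =
      heatSemigroup (diffusionIncr a s t) (g s - g r) +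
      (heatSemigroup (diffusionIncr a s t) (g r) - heatSemigroup (diffusionIncr a r t) (g r)) := by
    rw [map_sub]; abel
  rw [e]
  exact (norm_add_le _ _).trans (add_le_add (norm_heatSemigroup_le _ _)
    (h.norm_heatSemigroup_sub_left_le hs.1.le hr.1.le hs.2 hr.2 ht (hgm r hr.1)))

theorem intervalIntegrable_heatSemigroup (h : IsElliptic a T κ) {s t : ℝ} (hs : 0 ≤ s)
    (hst : s ≤ t) (ht : t ≤ T) {g : ℝ → LqSpace n q} (hg : ContinuousOn g (Ioi 0))
    (hgm : ∀ s, 0 < s → g s ∈ sobolevInfty n q) {M : ℝ} (hM : ∀ r ∈ Ioc s t, ‖g r‖ ≤ M) :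
    IntervalIntegrable (fun r => heatSemigroup (diffusionIncr a r t) (g r)) volume s t := by
  rw [intervalIntegrable_iff_integrableOn_Ioc_of_le hst]
  refine Integrable.of_bound ?_ M ?_
  · exact ((h.continuousOn_heatSemigroup ht hg hgm).mono
      (Ioc_subset_Ioc_left hs)).aestronglyMeasurable measurableSet_Ioc
  · filter_upwards [ae_restrict_mem measurableSet_Ioc] with r hr
    exact (norm_heatSemigroup_le _ _).trans (hM r hr)

theorem norm_integral_heatSemigroup_le {s t : ℝ} (hst : s ≤ t) {g : ℝ → LqSpace n q} {M : ℝ}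
    (hM : ∀ r ∈ Ioc s t, ‖g r‖ ≤ M) :
    ‖∫ r in s..t, heatSemigroup (diffusionIncr a r t) (g r)‖ ≤ (t - s) * M := by
  refine (intervalIntegral.norm_integral_le_of_norm_le_const (C := M) fun r hr => ?_).trans_eq ?_
  · rw [uIoc_of_le hst] at hr
    exact (norm_heatSemigroup_le _ _).trans (hM r hr)
  · rw [abs_of_nonneg (sub_nonneg.2 hst), mul_comm]

end IsElliptic

/-- Weak derivatives commute with the Bochner integral. -/
theorem toDistr_integral_weakDeriv {w : ℝ → LqSpace n q} {s t : ℝ} (hst : s ≤ t)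
    (hw : ∀ r ∈ Ioc s t, w r ∈ sobolevInfty n q)
    (hint : ∀ m, IntervalIntegrable (fun r => weakDeriv m (w r)) volume s t) (m : List (Fin n)) :
    toDistr (∫ r in s..t, weakDeriv m (w r)) = distrDeriv m (toDistr (∫ r in s..t, w r)) := by
  ext φ
  obtain ⟨ψ, hψ⟩ := exists_distrDeriv_apply m φ
  rw [hψ]
  have h0 := hint []
  simp only [weakDeriv_nil] at h0
  have h1 := (pairing (q := q) φ).intervalIntegral_comp_comm (hint m)
  have h2 := (pairing (q := q) ψ).intervalIntegral_comp_comm h0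
  refine h1.symm.trans (Eq.trans ?_ h2)
  refine intervalIntegral.integral_congr_ae (Eventually.of_forall fun r hr => ?_)
  rw [uIoc_of_le hst] at hr
  show toDistr (weakDeriv m (w r)) φ = toDistr (w r) ψ
  rw [toDistr_weakDeriv (hw r hr), hψ]

end Evolution

/-! ### The Duhamel path of a single problem -/

section Mild

variable {n : ℕ} {q : ℝ≥0∞} [Fact (1 ≤ q)]

/-- The Duhamel formula written with the heat semigroup. -/
def mildSolution (a : ℝ → Matrix (Fin n) (Fin n) ℝ) (u₀ : LqSpace n q) (f : ℝ → LqSpace n q)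
    (t : ℝ) : LqSpace n q :=
  heatSemigroup (diffusionIncr a 0 t) u₀ +
    ∫ s in (0 : ℝ)..t, heatSemigroup (diffusionIncr a s t) (f s)

theorem mildSolution_zero (a : ℝ → Matrix (Fin n) (Fin n) ℝ) (u₀ : LqSpace n q)
    (f : ℝ → LqSpace n q) : mildSolution a u₀ f 0 = u₀ := by
  simp [mildSolution, diffusionIncr_self, heatSemigroup_zero]

theorem weakDeriv_diffusionAt (B : Matrix (Fin n) (Fin n) ℝ) (m : List (Fin n)) {v : LqSpace n q}
    (hv : v ∈ sobolevInfty n q) : weakDeriv m (diffusionAt B [] v) = diffusionAt B m v :=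
  weakDeriv_eq (toDistr_diffusion B hv m)

theorem exists_bound_weakDeriv {f : ℝ → LqSpace n q} (hf : f ∈ sobolevPaths n q)
    (m : List (Fin n)) {s : ℝ} (hs : 0 < s) (t : ℝ) :
    ∃ G, 0 ≤ G ∧ ∀ r ∈ Icc s t, ‖weakDeriv m (f r)‖ ≤ G := by
  obtain ⟨G, hG⟩ := isCompact_Icc.exists_bound_of_continuousOn
    ((hf.2 m).continuousOn.mono fun r (hr : r ∈ Icc s t) => hs.trans_le hr.1)
  exact ⟨max G 0, le_max_right _ _, fun r hr => (hG r hr).trans (le_max_left _ _)⟩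

theorem exists_bound_entry {a : ℝ → Matrix (Fin n) (Fin n) ℝ}
    (ha : ∀ i j, ContinuousOn (fun t => a t i j) (Ici 0)) (t : ℝ) :
    ∃ M, 0 ≤ M ∧ ∀ r ∈ Icc 0 t, ∀ i j, |a r i j| ≤ M := by
  have h1 : ∀ i j, ∃ M, ∀ r ∈ Icc 0 t, |a r i j| ≤ M := fun i j =>
    isCompact_Icc.exists_bound_of_continuousOn ((ha i j).mono Icc_subset_Ici_self)
  choose M hM using h1
  refine ⟨∑ i, ∑ j, |M i j|, by positivity, fun r hr i j => (hM i j r hr).trans ?_⟩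
  refine (le_abs_self _).trans ?_
  refine (Finset.single_le_sum (f := fun j => |M i j|) (fun j _ => abs_nonneg _)
    (Finset.mem_univ j)).trans ?_
  exact Finset.single_le_sum (f := fun i => ∑ j, |M i j|)
    (fun i _ => Finset.sum_nonneg fun j _ => abs_nonneg _) (Finset.mem_univ i)

namespace IsElliptic

variable {a : ℝ → Matrix (Fin n) (Fin n) ℝ} {T κ : ℝ}

theorem duhamel_eq_mildSolution (h : IsElliptic a T κ) {t : ℝ} (ht0 : 0 ≤ t) (ht : t ≤ T)
    (u₀ : LqSpace n q) (f : ℝ → LqSpace n q) : duhamel a u₀ f t = mildSolution a u₀ f t := by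
  rw [duhamel, mildSolution, h.heatOp_eq le_rfl ht0 ht]
  congr 1
  refine intervalIntegral.integral_congr_ae (Eventually.of_forall fun r hr => ?_)
  rw [uIoc_of_le ht0] at hr
  exact h.heatOp_eq hr.1.le hr.2 ht _

variable {f : ℝ → LqSpace n q} {u₀ : LqSpace n q}

theorem continuousOn_weakDeriv_path (hf : f ∈ sobolevPaths n q) (m : List (Fin n)) :
    ContinuousOn (fun t => weakDeriv m (f t)) (Ioi 0) := (hf.2 m).continuousOn

theorem intervalIntegrable_weakDeriv (h : IsElliptic a T κ) (hf : f ∈ sobolevPaths n q)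
    {s t : ℝ} (hs : 0 < s) (hst : s ≤ t) (ht : t ≤ T) (m : List (Fin n)) :
    IntervalIntegrable (fun r => heatSemigroup (diffusionIncr a r t) (weakDeriv m (f r)))
      volume s t := by
  obtain ⟨G, -, hG⟩ := exists_bound_weakDeriv hf m hs t
  exact h.intervalIntegrable_heatSemigroup hs.le hst ht (continuousOn_weakDeriv_path hf m)
    (fun r hr => weakDeriv_mem (hf.1 r hr) m) fun r hr => hG r (Ioc_subset_Icc_self hr)

theorem toDistr_integral (h : IsElliptic a T κ) (hf : f ∈ sobolevPaths n q)
    {s t : ℝ} (hs : 0 < s) (hst : s ≤ t) (ht : t ≤ T) (m : List (Fin n)) :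
    toDistr (∫ r in s..t, heatSemigroup (diffusionIncr a r t) (weakDeriv m (f r))) =
      distrDeriv m (toDistr (∫ r in s..t, heatSemigroup (diffusionIncr a r t) (f r))) := by
  have e : ∀ m, EqOn (fun r => heatSemigroup (diffusionIncr a r t) (weakDeriv m (f r)))
      (fun r => weakDeriv m (heatSemigroup (diffusionIncr a r t) (f r))) (uIoc s t) := by
    intro m r hr
    rw [uIoc_of_le hst] at hr
    exact (weakDeriv_heatSemigroup _ (hf.1 r (hs.trans hr.1)) m).symm
  rw [← toDistr_integral_weakDeriv hst
    (fun r hr => heatSemigroup_mem_sobolevInfty _ (hf.1 r (hs.trans hr.1)))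
    (fun m => (h.intervalIntegrable_weakDeriv hf hs hst ht m).congr (e m))]
  congr 1
  exact intervalIntegral.integral_congr_ae (Eventually.of_forall fun r hr => e m hr)

/-- The source term is integrable down to time `0`, where `f` is bounded but its derivatives need
not be. -/
theorem intervalIntegrable_source (h : IsElliptic a T κ) (hf : f ∈ sobolevPaths n q)
    (hf0 : ContinuousOn f (Ici 0)) {s t : ℝ} (hs : 0 ≤ s) (hst : s ≤ t) (ht : t ≤ T) :
    IntervalIntegrable (fun r => heatSemigroup (diffusionIncr a r t) (f r)) volume s t := by
  obtain ⟨G, hG⟩ := isCompact_Icc.exists_bound_of_continuousOn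
    (hf0.mono fun r (hr : r ∈ Icc s t) => hs.trans hr.1)
  exact h.intervalIntegrable_heatSemigroup hs hst ht (hf0.mono Ioi_subset_Ici_self)
    hf.1 fun r hr => hG r (Ioc_subset_Icc_self hr)

/-- The Duhamel formula restarted at time `s`. -/
theorem mildSolution_split (h : IsElliptic a T κ) (hf : f ∈ sobolevPaths n q)
    (hf0 : ContinuousOn f (Ici 0)) (u₀ : LqSpace n q) {s t : ℝ} (hs : 0 ≤ s) (hst : s ≤ t)
    (ht : t ≤ T) : mildSolution a u₀ f t =
      heatSemigroup (diffusionIncr a s t) (mildSolution a u₀ f s) +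
        ∫ r in s..t, heatSemigroup (diffusionIncr a r t) (f r) := by
  have h0s := h.intervalIntegrable_source hf hf0 le_rfl hs (hst.trans ht)
  have e : EqOn (fun r => heatSemigroup (diffusionIncr a s t)
        (heatSemigroup (diffusionIncr a r s) (f r)))
      (fun r => heatSemigroup (diffusionIncr a r t) (f r)) (uIoc 0 s) := by
    intro r hr
    rw [uIoc_of_le hs] at hr
    exact (h.heatSemigroup_comp hr.1.le hr.2 hst ht _).symm
  have h1 : IntervalIntegrable (fun r => heatSemigroup (diffusionIncr a r t) (f r)) volume 0 s :=
    (h.intervalIntegrable_source hf hf0 le_rfl (hs.trans hst) ht).mono_set (by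
      rw [uIcc_of_le hs, uIcc_of_le (hs.trans hst)]; exact Icc_subset_Icc_right hst)
  rw [mildSolution, ← intervalIntegral.integral_add_adjacent_intervals h1
    (h.intervalIntegrable_source hf hf0 hs hst ht), mildSolution, map_add,
    ← ContinuousLinearMap.intervalIntegral_comp_comm _ h0s,
    h.heatSemigroup_comp le_rfl hs hst ht,
    intervalIntegral.integral_congr_ae (Eventually.of_forall fun r hr => e hr)]
  abel

theorem integral_mem_sobolevInfty (h : IsElliptic a T κ) (hf : f ∈ sobolevPaths n q)
    {s t : ℝ} (hs : 0 < s) (hst : s ≤ t) (ht : t ≤ T) :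
    ∫ r in s..t, heatSemigroup (diffusionIncr a r t) (f r) ∈ sobolevInfty n q := fun m =>
  ⟨_, h.toDistr_integral hf hs hst ht m⟩

/-- Restarting at `t / 2` avoids the initial time: the homogeneous part is smoothed over
`[t / 2, t]`, and the source is smooth there. -/
theorem mildSolution_mem_sobolevInfty (h : IsElliptic a T κ) (hf : f ∈ sobolevPaths n q)
    (hf0 : ContinuousOn f (Ici 0)) (u₀ : LqSpace n q) {t : ℝ} (ht0 : 0 < t) (ht : t ≤ T) :
    mildSolution a u₀ f t ∈ sobolevInfty n q := by
  rw [h.mildSolution_split hf hf0 u₀ (half_pos ht0).le (half_le_self ht0.le) ht]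
  have hc : 0 < (t - t / 2) * κ := mul_pos (by linarith) h.pos
  exact Submodule.add_mem _ (heatSemigroup_mem_sobolevInfty_of_pos hc
      (h.posSemidef_diffusionIncr_sub (half_pos ht0).le (half_le_self ht0.le) ht le_rfl) _)
    (h.integral_mem_sobolevInfty hf (half_pos ht0) (half_le_self ht0.le) ht)

theorem weakDeriv_mildSolution_split (h : IsElliptic a T κ) (hf : f ∈ sobolevPaths n q)
    (hf0 : ContinuousOn f (Ici 0)) (u₀ : LqSpace n q) {s t : ℝ} (hs : 0 < s) (hst : s < t)
    (ht : t ≤ T) (m : List (Fin n)) : weakDeriv m (mildSolution a u₀ f t) =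
      weakDeriv m (heatSemigroup (diffusionIncr a s t) (mildSolution a u₀ f s)) +
        ∫ r in s..t, heatSemigroup (diffusionIncr a r t) (weakDeriv m (f r)) := by
  have hc : 0 < (t - s) * κ := mul_pos (sub_pos.2 hst) h.pos
  rw [h.mildSolution_split hf hf0 u₀ hs.le hst.le ht, weakDeriv_add
    (heatSemigroup_mem_sobolevInfty_of_pos hc
      (h.posSemidef_diffusionIncr_sub hs.le hst.le ht le_rfl) _)
    (h.integral_mem_sobolevInfty hf hs hst.le ht)]
  congr 1
  exact weakDeriv_eq (h.toDistr_integral hf hs hst.le ht m)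

/-- The restarted Duhamel formula for a spatial derivative. -/
theorem weakDeriv_mildSolution (h : IsElliptic a T κ) (hf : f ∈ sobolevPaths n q)
    (hf0 : ContinuousOn f (Ici 0)) (u₀ : LqSpace n q) {s t : ℝ} (hs : 0 < s) (hst : s ≤ t)
    (ht : t ≤ T) (m : List (Fin n)) : weakDeriv m (mildSolution a u₀ f t) =
      heatSemigroup (diffusionIncr a s t) (weakDeriv m (mildSolution a u₀ f s)) +
        ∫ r in s..t, heatSemigroup (diffusionIncr a r t) (weakDeriv m (f r)) := by
  rcases hst.eq_or_lt with rfl | hlt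
  · simp [diffusionIncr_self, heatSemigroup_zero]
  · rw [h.weakDeriv_mildSolution_split hf hf0 u₀ hs hlt ht, weakDeriv_heatSemigroup _
      (h.mildSolution_mem_sobolevInfty hf hf0 u₀ hs (hst.trans ht))]

theorem norm_mildSolution_le {t F : ℝ} (ht : 0 ≤ t) (u₀ : LqSpace n q)
    (hF : ∀ r ∈ Ioc 0 t, ‖f r‖ ≤ F) : ‖mildSolution a u₀ f t‖ ≤ ‖u₀‖ + t * F := by
  refine (norm_add_le _ _).trans (add_le_add (norm_heatSemigroup_le _ _) ?_)
  simpa using norm_integral_heatSemigroup_le (a := a) ht hF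

/-- Smoothing estimate for the Duhamel path. -/
theorem norm_weakDeriv_mildSolution_le (h : IsElliptic a T κ) (hf : f ∈ sobolevPaths n q)
    (hf0 : ContinuousOn f (Ici 0)) (u₀ : LqSpace n q) {s t c G : ℝ} (hs : 0 < s) (hst : s < t)
    (ht : t ≤ T) (hc0 : 0 < c) (hc : c ≤ (t - s) * κ) (m : List (Fin n))
    (hG : ∀ r ∈ Ioc s t, ‖weakDeriv m (f r)‖ ≤ G) :
    ‖weakDeriv m (mildSolution a u₀ f t)‖ ≤
      smoothingConst n m.length * (1 / √c) ^ m.length * ‖mildSolution a u₀ f s‖ +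
        (t - s) * G := by
  rw [h.weakDeriv_mildSolution_split hf hf0 u₀ hs hst ht]
  exact (norm_add_le _ _).trans (add_le_add
    (norm_weakDeriv_heatSemigroup_le hc0
      (h.posSemidef_diffusionIncr_sub hs.le hst.le ht hc) m _)
    (norm_integral_heatSemigroup_le hst.le hG))

theorem exists_bound_weakDeriv_mildSolution (h : IsElliptic a T κ) (hf : f ∈ sobolevPaths n q)
    (hf0 : ContinuousOn f (Ici 0)) (u₀ : LqSpace n q) {s : ℝ} (hs : 0 < s) (m : List (Fin n)) :
    ∃ M, 0 ≤ M ∧ ∀ t ∈ Icc s T, ‖weakDeriv m (mildSolution a u₀ f t)‖ ≤ M := by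
  obtain ⟨G, hG0, hG⟩ := exists_bound_weakDeriv hf m (half_pos hs) T
  refine ⟨smoothingConst n m.length * (1 / √(s / 2 * κ)) ^ m.length *
    ‖mildSolution a u₀ f (s / 2)‖ + |T| * G, ?_, fun t ht => ?_⟩
  · have := smoothingConst_nonneg n m.length
    positivity
  · refine (h.norm_weakDeriv_mildSolution_le hf hf0 u₀ (half_pos hs)
      ((half_lt_self hs).trans_le ht.1) ht.2 (c := s / 2 * κ) (mul_pos (half_pos hs) h.pos)
      (mul_le_mul_of_nonneg_right (by linarith [ht.1]) h.pos.le) m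
      fun r hr => hG r ⟨hr.1.le, hr.2.trans ht.2⟩).trans ?_
    gcongr
    exact (by linarith [ht.1, ht.2] : t - s / 2 ≤ T).trans (le_abs_self T)

/-- Increments of the Duhamel path, to first order in `A(t) - A(s)`. -/
theorem norm_weakDeriv_mildSolution_sub_le (h : IsElliptic a T κ) (hf : f ∈ sobolevPaths n q)
    (hf0 : ContinuousOn f (Ici 0)) (u₀ : LqSpace n q) {s t G : ℝ} (hs : 0 < s) (hst : s ≤ t)
    (ht : t ≤ T) (m : List (Fin n)) (hG : ∀ r ∈ Ioc s t, ‖weakDeriv m (f r)‖ ≤ G) :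
    ‖weakDeriv m (mildSolution a u₀ f t) - weakDeriv m (mildSolution a u₀ f s)‖ ≤
      ‖diffusionAt (diffusionIncr a s t) m (mildSolution a u₀ f s)‖ + (t - s) * G := by
  have hm := h.mildSolution_mem_sobolevInfty hf hf0 u₀ hs (hst.trans ht)
  rw [h.weakDeriv_mildSolution hf hf0 u₀ hs hst ht, add_sub_right_comm,
    ← diffusionAt_weakDeriv _ _ hm]
  exact (norm_add_le _ _).trans (add_le_add
    (norm_heatSemigroup_sub_le (h.posSemidef_diffusionIncr hs.le hst ht) (weakDeriv_mem hm m))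
    (norm_integral_heatSemigroup_le hst hG))

/-- The derivatives of the Duhamel path are Lipschitz continuous in time on `[s, T]`. -/
theorem continuousOn_weakDeriv_mildSolution (h : IsElliptic a T κ) (hf : f ∈ sobolevPaths n q)
    (hf0 : ContinuousOn f (Ici 0)) (u₀ : LqSpace n q) (m : List (Fin n)) {s : ℝ} (hs : 0 < s) :
    ContinuousOn (fun t => weakDeriv m (mildSolution a u₀ f t)) (Icc s T) := by
  obtain ⟨G, hG0, hG⟩ := exists_bound_weakDeriv hf m hs T
  obtain ⟨A, hA0, hA⟩ := exists_bound_entry h.cont T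
  have h1 := fun i j => h.exists_bound_weakDeriv_mildSolution hf hf0 u₀ hs (m ++ [i, j])
  choose M hM0 hM using h1
  set M' := ∑ i, ∑ j, M i j with hM'
  have hMle : ∀ i j, M i j ≤ M' := fun i j =>
    (Finset.single_le_sum (f := fun j => M i j) (fun j _ => hM0 i j) (Finset.mem_univ j)).trans
      (Finset.single_le_sum (f := fun i => ∑ j, M i j)
        (fun i _ => Finset.sum_nonneg fun j _ => hM0 i j) (Finset.mem_univ i))
  have hM'0 : 0 ≤ M' := Finset.sum_nonneg fun i _ => Finset.sum_nonneg fun j _ => hM0 i j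
  set C := (n : ℝ) ^ 2 * A * M' + G with hC
  have hC0 : 0 ≤ C := by positivity
  have key : ∀ x ∈ Icc s T, ∀ y ∈ Icc s T, x ≤ y →
      ‖weakDeriv m (mildSolution a u₀ f y) - weakDeriv m (mildSolution a u₀ f x)‖ ≤
        C * (y - x) := by
    intro x hx y hy hxy
    have hx0 : 0 < x := hs.trans_le hx.1
    refine (h.norm_weakDeriv_mildSolution_sub_le hf hf0 u₀ hx0 hxy hy.2 m
      fun r hr => hG r ⟨hx.1.trans hr.1.le, hr.2.trans hy.2⟩).trans ?_
    have h2 : ∀ i j, |diffusionIncr a x y i j| ≤ (y - x) * A := fun i j =>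
      abs_diffusionIncr_le h.cont hx0.le hxy i j fun r hr =>
        hA r ⟨hx0.le.trans hr.1.le, hr.2.trans hy.2⟩ i j
    have h3 := norm_diffusionAt_le h2 m fun i j => (hM i j x hx).trans (hMle i j)
    calc _ ≤ (n : ℝ) ^ 2 * ((y - x) * A) * M' + (y - x) * G := by gcongr
      _ = _ := by rw [hC]; ring
  have : LipschitzOnWith ⟨C, hC0⟩ (fun t => weakDeriv m (mildSolution a u₀ f t)) (Icc s T) := by
    refine LipschitzOnWith.of_dist_le_mul fun x hx y hy => ?_
    rw [dist_eq_norm, Real.dist_eq]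
    rcases le_total x y with hxy | hxy
    · rw [norm_sub_rev, abs_sub_comm, abs_of_nonneg (sub_nonneg.2 hxy)]
      exact key x hx y hy hxy
    · rw [abs_of_nonneg (sub_nonneg.2 hxy)]
      exact key y hy x hx hxy
  exact this.continuousOn

theorem hasDerivAt_diffusionIncr (ha : ∀ i j, ContinuousOn (fun t => a t i j) (Ici 0)) {t : ℝ}
    (ht : 0 < t) (i j : Fin n) :
    HasDerivAt (fun r => diffusionIncr a t r i j) (a t i j) t := by
  have h1 := intervalIntegral.integral_hasDerivAt_right
    (intervalIntegrable_entry ha le_rfl ht.le i j)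
    (((ha i j).mono Ioi_subset_Ici_self).stronglyMeasurableAtFilter isOpen_Ioi t ht)
    ((ha i j).continuousAt (Ici_mem_nhds ht))
  refine (h1.sub_const (∫ s in (0 : ℝ)..t, a s i j)).congr_of_eventuallyEq
    (Eventually.of_forall fun r => ?_)
  show diffusionIncr a t r i j = _
  rw [diffusionIncr, Matrix.sub_apply, diffusionIntegral, diffusionIntegral, Matrix.of_apply,
    Matrix.of_apply]

/-- The right derivative of the homogeneous part at its starting time, from the second order
expansion of the heat semigroup. -/
theorem hasDerivWithinAt_heatSemigroup (h : IsElliptic a T κ) {t : ℝ} (ht0 : 0 < t) (ht : t < T)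
    {p : LqSpace n q} (hp : p ∈ sobolevInfty n q) :
    HasDerivWithinAt (fun r => heatSemigroup (diffusionIncr a t r) p) (diffusionAt (a t) [] p)
      (Ici t) t := by
  have h1 : HasDerivWithinAt (fun r => diffusionAt (diffusionIncr a t r) [] p)
      (diffusionAt (a t) [] p) (Ici t) t :=
    HasDerivWithinAt.fun_sum fun i _ => HasDerivWithinAt.fun_sum fun j _ =>
      ((hasDerivAt_diffusionIncr h.cont ht0 i j).hasDerivWithinAt.smul_const _)
  obtain ⟨A, hA0, hA⟩ := exists_bound_entry h.cont T
  set M := ∑ i, ∑ j, ∑ k, ∑ l, ‖weakDeriv ([i, j] ++ [k, l]) p‖ with hM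
  have hMle : ∀ i j k l, ‖weakDeriv ([i, j] ++ [k, l]) p‖ ≤ M := fun i j k l => by
    refine le_trans ?_ (Finset.single_le_sum (f := fun i => ∑ j, ∑ k, ∑ l,
      ‖weakDeriv ([i, j] ++ [k, l]) p‖) (fun i _ => by positivity) (Finset.mem_univ i))
    refine le_trans ?_ (Finset.single_le_sum (f := fun j => ∑ k, ∑ l,
      ‖weakDeriv ([i, j] ++ [k, l]) p‖) (fun i _ => by positivity) (Finset.mem_univ j))
    refine le_trans ?_ (Finset.single_le_sum (f := fun k => ∑ l,
      ‖weakDeriv ([i, j] ++ [k, l]) p‖) (fun i _ => by positivity) (Finset.mem_univ k))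
    exact Finset.single_le_sum (f := fun l =>
      ‖weakDeriv ([i, j] ++ [k, l]) p‖) (fun i _ => by positivity) (Finset.mem_univ l)
  -- the remainder is quadratic in `r - t`
  have h2 : HasDerivWithinAt (fun r => heatSemigroup (diffusionIncr a t r) p - p -
      diffusionAt (diffusionIncr a t r) [] p) 0 (Ici t) t := by
    refine (IsBigO.hasFDerivWithinAt (𝕜 := ℝ) (n := 2) ?_ (by simp) (by norm_num)).hasDerivWithinAt
    refine IsBigO.of_bound ((n : ℝ) ^ 2 * A * ((n : ℝ) ^ 2 * A * M)) ?_
    filter_upwards [self_mem_nhdsWithin, mem_nhdsWithin_of_mem_nhds (Iio_mem_nhds ht)] with r hr hrT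
    have hη : ∀ i j, |diffusionIncr a t r i j| ≤ (r - t) * A := fun i j =>
      abs_diffusionIncr_le h.cont ht0.le hr i j fun x hx =>
        hA x ⟨ht0.le.trans hx.1.le, hx.2.trans (le_of_lt hrT)⟩ i j
    refine (norm_heatSemigroup_sub_sub_le
      (h.posSemidef_diffusionIncr ht0.le hr (le_of_lt hrT)) hp).trans ?_
    refine (norm_diffusionAt_le hη [] fun i j => ?_).trans_eq (b := (n : ℝ) ^ 2 * ((r - t) * A) *
      ((n : ℝ) ^ 2 * ((r - t) * A) * M)) ?_
    · rw [List.nil_append, weakDeriv_diffusionAt _ _ hp]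
      exact norm_diffusionAt_le hη _ fun k l => hMle i j k l
    · rw [norm_pow, norm_norm, Real.norm_of_nonneg (sub_nonneg.2 hr)]
      ring
  have h3 := (h2.add h1).add_const p
  rw [zero_add] at h3
  refine h3.congr_of_mem (fun r _ => ?_) (by simp)
  simp

/-- The right derivative of the inhomogeneous part at its starting time. -/
theorem hasDerivWithinAt_integral (h : IsElliptic a T κ) {t : ℝ} (ht0 : 0 < t) (ht : t < T)
    {g : ℝ → LqSpace n q} (hg : ContinuousOn g (Ioi 0))
    (hgm : ∀ s, 0 < s → g s ∈ sobolevInfty n q) :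
    HasDerivWithinAt (fun r => ∫ s in t..r, heatSemigroup (diffusionIncr a s r) (g s)) (g t)
      (Ici t) t := by
  rw [hasDerivWithinAt_iff_isLittleO, isLittleO_iff]
  intro ε hε
  obtain ⟨A, hA0, hA⟩ := exists_bound_entry h.cont T
  set M := ∑ i, ∑ j, ‖weakDeriv ([] ++ [i, j]) (g t)‖ with hM
  have hMle : ∀ i j, ‖weakDeriv ([] ++ [i, j]) (g t)‖ ≤ M := fun i j =>
    (Finset.single_le_sum (f := fun j => ‖weakDeriv ([] ++ [i, j]) (g t)‖)
      (fun j _ => norm_nonneg _) (Finset.mem_univ j)).trans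
      (Finset.single_le_sum (f := fun i => ∑ j, ‖weakDeriv ([] ++ [i, j]) (g t)‖)
        (fun i _ => Finset.sum_nonneg fun j _ => norm_nonneg _) (Finset.mem_univ i))
  have hM0 : 0 ≤ M := by positivity
  obtain ⟨δ, hδ, hgδ⟩ := Metric.continuousAt_iff.1 (hg.continuousAt (Ioi_mem_nhds ht0)) (ε / 2)
    (half_pos hε)
  set C := (n : ℝ) ^ 2 * A * M with hC
  have hC0 : 0 ≤ C := by positivity
  have hev : ∀ᶠ r in 𝓝[Ici t] t, C * (r - t) < ε / 2 := by
    have : Tendsto (fun r => C * (r - t)) (𝓝[Ici t] t) (𝓝 (C * (t - t))) :=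
      ((continuous_const.mul (continuous_id.sub continuous_const)).tendsto t).mono_left
        nhdsWithin_le_nhds
    refine this.eventually (gt_mem_nhds ?_)
    simpa using hε
  filter_upwards [self_mem_nhdsWithin, mem_nhdsWithin_of_mem_nhds (Iio_mem_nhds ht), hev,
    mem_nhdsWithin_of_mem_nhds (Iio_mem_nhds (by linarith : t < t + δ))] with r hr hrT hrC hrδ
  have hrt : t ≤ r := hr
  have hrT' : r ≤ T := le_of_lt hrT
  have hrδ' : r < t + δ := hrδ
  have hsub := fun s (hs : s ∈ Ioc t r) => hgδ (x := s) (by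
    rw [Real.dist_eq, abs_of_pos (sub_pos.2 hs.1)]; linarith [hs.2])
  have hint : IntervalIntegrable (fun s => heatSemigroup (diffusionIncr a s r) (g s))
      volume t r := by
    refine h.intervalIntegrable_heatSemigroup ht0.le hrt hrT' hg hgm (M := ‖g t‖ + ε / 2)
      fun s hs => ?_
    have h1 := hsub s hs
    rw [dist_eq_norm] at h1
    linarith [norm_le_norm_add_norm_sub' (g s) (g t)]
  rw [intervalIntegral.integral_same, sub_zero]
  have e : (∫ s in t..r, heatSemigroup (diffusionIncr a s r) (g s)) - (r - t) • g t =
      ∫ s in t..r, (heatSemigroup (diffusionIncr a s r) (g s) - g t) := by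
    rw [intervalIntegral.integral_sub hint (by simp), intervalIntegral.integral_const]
  rw [e, Real.norm_eq_abs]
  refine intervalIntegral.norm_integral_le_of_norm_le_const fun s hs => ?_
  rw [uIoc_of_le hrt] at hs
  have hs0 : 0 < s := ht0.trans hs.1
  -- one summand is small by continuity of `g`, the other because `A(r) - A(s)` is small
  have e2 : heatSemigroup (diffusionIncr a s r) (g s) - g t =
      heatSemigroup (diffusionIncr a s r) (g s - g t) +
        (heatSemigroup (diffusionIncr a s r) (g t) - g t) := by rw [map_sub]; abel
  have h1 := hsub s hs
  rw [dist_eq_norm] at h1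
  have h2 := norm_heatSemigroup_sub_le (h.posSemidef_diffusionIncr hs0.le hs.2 hrT') (hgm t ht0)
  have hη : ∀ i j, |diffusionIncr a s r i j| ≤ (r - t) * A := fun i j => by
    refine (abs_diffusionIncr_le h.cont hs0.le hs.2 i j fun x hx =>
      hA x ⟨hs0.le.trans hx.1.le, hx.2.trans hrT'⟩ i j).trans ?_
    exact mul_le_mul_of_nonneg_right (by linarith [hs.1]) hA0
  have h3 := norm_diffusionAt_le hη [] hMle
  have h4 : (n : ℝ) ^ 2 * ((r - t) * A) * M = C * (r - t) := by rw [hC]; ring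
  rw [e2]
  linarith [norm_add_le (heatSemigroup (diffusionIncr a s r) (g s - g t))
    (heatSemigroup (diffusionIncr a s r) (g t) - g t),
    norm_heatSemigroup_le (diffusionIncr a s r) (g s - g t)]

theorem hasDerivWithinAt_mildSolution (h : IsElliptic a T κ) (hf : f ∈ sobolevPaths n q)
    (hf0 : ContinuousOn f (Ici 0)) (u₀ : LqSpace n q) {t : ℝ} (ht0 : 0 < t) (ht : t < T)
    (m : List (Fin n)) :
    HasDerivWithinAt (fun t => weakDeriv m (mildSolution a u₀ f t))
      (diffusionAt (a t) m (mildSolution a u₀ f t) + weakDeriv m (f t)) (Ici t) t := by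
  have hm := h.mildSolution_mem_sobolevInfty hf hf0 u₀ ht0 ht.le
  have h1 := (h.hasDerivWithinAt_heatSemigroup ht0 ht (weakDeriv_mem hm m)).add
    (h.hasDerivWithinAt_integral ht0 ht (continuousOn_weakDeriv_path hf m)
      fun s hs => weakDeriv_mem (hf.1 s hs) m)
  rw [diffusionAt_weakDeriv _ _ hm] at h1
  have hmem : Iio T ∩ Ici t ∈ 𝓝[Ici t] t :=
    inter_mem (mem_nhdsWithin_of_mem_nhds (Iio_mem_nhds ht)) self_mem_nhdsWithin
  refine h1.congr_of_eventuallyEq_of_mem ?_ (mem_Ici.2 le_rfl)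
  filter_upwards [hmem] with r hr
  exact h.weakDeriv_mildSolution hf hf0 u₀ ht0 hr.2 (le_of_lt hr.1) m

/-- The Duhamel path satisfies the heat equation in the classical sense, together with all its
spatial derivatives: the restarted formula provides the right derivative, which is continuous in
time, so that it is a two-sided derivative by the fundamental theorem of calculus. -/
theorem hasDerivAt_mildSolution (h : IsElliptic a T κ) (hf : f ∈ sobolevPaths n q)
    (hf0 : ContinuousOn f (Ici 0)) (u₀ : LqSpace n q) {t : ℝ} (ht0 : 0 < t) (ht : t < T)
    (m : List (Fin n)) :
    HasDerivAt (fun t => weakDeriv m (mildSolution a u₀ f t))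
      (diffusionAt (a t) m (mildSolution a u₀ f t) + weakDeriv m (f t)) t := by
  set V := fun t => diffusionAt (a t) m (mildSolution a u₀ f t) + weakDeriv m (f t) with hV
  have hs : 0 < t / 2 := half_pos ht0
  have hst : t / 2 < t := half_lt_self ht0
  have hVc : ContinuousOn V (Icc (t / 2) T) := by
    refine ContinuousOn.add (continuousOn_finsetSum _ fun i _ => continuousOn_finsetSum _
      fun j _ => ?_) ?_
    · exact ((h.cont i j).mono fun r hr => hs.le.trans hr.1).smul
        (h.continuousOn_weakDeriv_mildSolution hf hf0 u₀ _ hs)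
    · exact (continuousOn_weakDeriv_path hf m).mono fun r hr => hs.trans_le hr.1
  have hint : ∀ r ∈ Icc (t / 2) T, IntervalIntegrable V volume (t / 2) r := fun r hr =>
    (hVc.mono (Icc_subset_Icc_right hr.2)).intervalIntegrable_of_Icc hr.1
  have hFTC : ∀ r ∈ Icc (t / 2) T, weakDeriv m (mildSolution a u₀ f r) =
      weakDeriv m (mildSolution a u₀ f (t / 2)) + ∫ s in (t / 2)..r, V s := by
    intro r hr
    have := intervalIntegral.integral_eq_sub_of_hasDeriv_right_of_le hr.1
      ((h.continuousOn_weakDeriv_mildSolution hf hf0 u₀ m hs).mono (Icc_subset_Icc_right hr.2))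
      (fun x hx => (h.hasDerivWithinAt_mildSolution hf hf0 u₀ (hs.trans hx.1)
        (hx.2.trans_le hr.2) m).mono Ioi_subset_Ici_self) (hint r hr)
    rw [this]; abel
  have hVt : ContinuousAt V t := hVc.continuousAt (Icc_mem_nhds hst ht)
  have h1 := intervalIntegral.integral_hasDerivAt_right (hint t ⟨hst.le, ht.le⟩)
    ((hVc.mono Ioo_subset_Icc_self).stronglyMeasurableAtFilter isOpen_Ioo t ⟨hst, ht⟩) hVt
  refine (h1.const_add (weakDeriv m (mildSolution a u₀ f (t / 2)))).congr_of_eventuallyEq ?_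
  filter_upwards [Icc_mem_nhds hst ht] with r hr
  exact hFTC r hr

end IsElliptic

end Mild

/-! ### Regularity of the Duhamel path -/

section Regularity

open TopologicalSpace

variable {n : ℕ} {q : ℝ≥0∞} [Fact (1 ≤ q)]

/-- A continuous diffusivity that is elliptic on every bounded time interval. -/
def IsLocallyElliptic (a : ℝ → Matrix (Fin n) (Fin n) ℝ) : Prop := ∀ T, ∃ κ, IsElliptic a T κ

namespace IsLocallyElliptic

variable {a : matrixPaths n} {f : ℝ → LqSpace n q}

theorem mem_sobolevInfty (h : IsLocallyElliptic a.1) (hf : f ∈ sobolevPaths n q)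
    (hf0 : ContinuousOn f (Ici 0)) (u₀ : LqSpace n q) {t : ℝ} (ht : 0 < t) :
    mildSolution a.1 u₀ f t ∈ sobolevInfty n q :=
  let ⟨_, hκ⟩ := h t
  hκ.mildSolution_mem_sobolevInfty hf hf0 u₀ ht le_rfl

theorem hasDerivAt (h : IsLocallyElliptic a.1) (hf : f ∈ sobolevPaths n q)
    (hf0 : ContinuousOn f (Ici 0)) (u₀ : LqSpace n q) {t : ℝ} (ht : 0 < t) (m : List (Fin n)) :
    HasDerivAt (fun t => weakDeriv m (mildSolution a.1 u₀ f t))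
      (diffusionAt (a.1 t) m (mildSolution a.1 u₀ f t) + weakDeriv m (f t)) t :=
  let ⟨_, hκ⟩ := h (t + 1)
  hκ.hasDerivAt_mildSolution hf hf0 u₀ ht (by linarith) m

/-- Bootstrapping: the equation expresses the time derivative through spatial derivatives, which are
of class `C^N` by induction. -/
theorem contDiffOn (h : IsLocallyElliptic a.1) (hf : f ∈ sobolevPaths n q)
    (hf0 : ContinuousOn f (Ici 0)) (u₀ : LqSpace n q) (m : List (Fin n)) :
    ContDiffOn ℝ ∞ (fun t => weakDeriv m (mildSolution a.1 u₀ f t)) (Ioi 0) := by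
  have key : ∀ (N : ℕ) (m : List (Fin n)),
      ContDiffOn ℝ N (fun t => weakDeriv m (mildSolution a.1 u₀ f t)) (Ioi 0) := by
    intro N
    induction N with
    | zero =>
      intro m
      exact contDiffOn_zero.2 fun t ht =>
        (h.hasDerivAt hf hf0 u₀ ht m).continuousAt.continuousWithinAt
    | succ N ih =>
      intro m
      have hN : ((N : ℕ∞ω) ≤ ((⊤ : ℕ∞) : ℕ∞ω)) := by exact_mod_cast le_top
      rw [Nat.cast_succ]
      refine (contDiffOn_succ_iff_deriv_of_isOpen isOpen_Ioi).2 ⟨fun t ht =>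
        (h.hasDerivAt hf hf0 u₀ ht m).differentiableAt.differentiableWithinAt,
        by simp, ?_⟩
      refine ContDiffOn.congr (f := fun t => diffusionAt (a.1 t) m (mildSolution a.1 u₀ f t) +
        weakDeriv m (f t)) ?_ fun t ht => (h.hasDerivAt hf hf0 u₀ ht m).deriv
      refine ContDiffOn.add (ContDiffOn.sum fun i _ => ContDiffOn.sum fun j _ => ?_)
        ((hf.2 m).of_le hN)
      exact ((a.2 i j).1.of_le hN).smul (ih _)
  exact contDiffOn_infty.2 fun N => key N m

/-- The Duhamel path belongs to `C^∞(ℝ₊, W^{q,∞}) ∩ C([0, ∞), L^q)`. The restriction on the initial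
data enters only through continuity at `t = 0`. -/
theorem mildSolution_mem (h : IsLocallyElliptic a.1) (hf : f ∈ solutionSpace n q)
    {u₀ : LqSpace n q} (hu₀ : u₀ ∈ initialData n q) :
    mildSolution a.1 u₀ f ∈ solutionSpace n q := by
  have hfs : f ∈ sobolevPaths n q := hf.1
  have hf0 : ContinuousOn f (Ici 0) := hf.2
  refine ⟨⟨fun t ht => h.mem_sobolevInfty hfs hf0 u₀ ht, fun m => h.contDiffOn hfs hf0 u₀ m⟩, ?_⟩
  intro t ht
  rcases (mem_Ici.1 ht).eq_or_lt with rfl | ht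
  · obtain ⟨κ, hκ⟩ := h 1
    obtain ⟨F, hF⟩ := isCompact_Icc.exists_bound_of_continuousOn
      (hf0.mono (show Icc (0 : ℝ) 1 ⊆ Ici 0 from Icc_subset_Ici_self))
    have hIcc : Icc (0 : ℝ) 1 ∈ 𝓝[Ici 0] 0 :=
      mem_nhdsWithin.2 ⟨Iio 1, isOpen_Iio, by simp, fun x hx => ⟨hx.2, le_of_lt hx.1⟩⟩
    have h1 : Tendsto (fun t => heatSemigroup (diffusionIncr a.1 0 t) u₀) (𝓝[Ici 0] 0) (𝓝 u₀) := by
      refine tendsto_heatSemigroup hu₀ ?_ fun i j => tendsto_diffusionIncr hκ.cont le_rfl i j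
      filter_upwards [hIcc] with t ht
      exact hκ.posSemidef_diffusionIncr le_rfl ht.1 ht.2
    have h2 : Tendsto (fun t => ∫ s in (0 : ℝ)..t, heatSemigroup (diffusionIncr a.1 s t) (f s))
        (𝓝[Ici 0] 0) (𝓝 0) := by
      have h3 : Tendsto (fun t : ℝ => (t - 0) * F) (𝓝[Ici 0] 0) (𝓝 ((0 - 0) * F)) :=
        Tendsto.mono_left (Continuous.tendsto (by fun_prop) _) nhdsWithin_le_nhds
      rw [sub_zero, zero_mul] at h3
      refine squeeze_zero_norm' ?_ h3
      filter_upwards [hIcc] with t ht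
      exact IsElliptic.norm_integral_heatSemigroup_le ht.1 fun r hr =>
        hF r ⟨hr.1.le, hr.2.trans ht.2⟩
    have h3 := h1.add h2
    rw [add_zero] at h3
    show Tendsto _ _ (𝓝 (mildSolution a.1 u₀ f 0))
    rw [mildSolution_zero]
    exact h3
  · have := (h.hasDerivAt hfs hf0 u₀ ht []).continuousAt.continuousWithinAt (s := Ici 0)
    simpa only [weakDeriv_nil] using this

end IsLocallyElliptic

/-! ### Seminorms of paths -/

theorem sobolevSeminorms_zero_le_iff {u : sobolevPaths n q} {m : List (Fin n)}
    {K : Compacts (Ioi (0 : ℝ))} {C : ℝ} (hC : 0 ≤ C) :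
    sobolevSeminorms n q (m, 0, K) u ≤ C ↔ ∀ t ∈ K, ‖weakDeriv m (u.1 t)‖ ≤ C := by
  refine (norm_restrictDeriv_le_iff ℂ hC).trans (forall₂_congr fun t ht => ?_)
  rw [iteratedDerivWithin_zero]
  show ‖if 0 < (t : ℝ) then weakDeriv m (u.1 t) else 0‖ ≤ C ↔ _
  rw [if_pos (mem_Ioi.1 t.2)]

/-- The seminorms only see positive times; the values of a path at `t ≤ 0` are arbitrary. -/
theorem sobolevSeminorms_eq_zero {u : sobolevPaths n q} (hu : ∀ t, 0 < t → u.1 t = 0)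
    (i : List (Fin n) × (ℕ × Compacts (Ioi (0 : ℝ)))) : sobolevSeminorms n q i u = 0 := by
  obtain ⟨m, k, K⟩ := i
  refine le_antisymm ((norm_restrictDeriv_le_iff ℂ le_rfl).2 fun t ht => ?_) (apply_nonneg _ _)
  have e : EqOn (sobolevPaths.spaceDeriv m u).1 (fun _ => 0) (Ioi 0) := fun s hs => by
    show (if 0 < s then weakDeriv m (u.1 s) else 0) = 0
    rw [if_pos (mem_Ioi.1 hs), hu s hs]
    exact weakDeriv_eq (by simp)
  rw [iteratedDerivWithin_congr e t.2]
  simp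

theorem sobolevSeminorms_congr {u v : sobolevPaths n q} (huv : ∀ t, 0 < t → u.1 t = v.1 t)
    (i : List (Fin n) × (ℕ × Compacts (Ioi (0 : ℝ)))) :
    sobolevSeminorms n q i u = sobolevSeminorms n q i v := by
  have h : sobolevSeminorms n q i (u - v) = 0 := sobolevSeminorms_eq_zero (fun t ht => by
    show u.1 t - v.1 t = 0
    rw [huv t ht, sub_self]) i
  refine le_antisymm ?_ ?_
  · have := map_add_le_add (sobolevSeminorms n q i) (u - v) v
    rwa [sub_add_cancel, h, zero_add] at this
  · have := map_sub_le_add (sobolevSeminorms n q i) u (u - v)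
    rwa [sub_sub_cancel, h, add_zero] at this

theorem sobolevSeminorms_succ_le (u : sobolevPaths n q) (m : List (Fin n)) (k : ℕ)
    (K : Compacts (Ioi (0 : ℝ))) :
    sobolevSeminorms n q (m, k + 1, K) u ≤ sobolevSeminorms n q (m, k, K) (timeDeriv u) := by
  refine (norm_restrictDeriv_le_iff ℂ (apply_nonneg _ _)).2 fun t ht => ?_
  rw [iteratedDerivWithin_succ', ← iteratedDerivWithin_congr (spaceDeriv_timeDeriv u m) t.2]
  exact norm_iteratedDerivWithin_le ℂ ht

/-- Leibniz bound for `∂_t^k ∂_x^m 𝓛_t u`, which only involves time derivatives of `u` of order at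
most `k`. -/
theorem sobolevSeminorms_diffusionOp_le (a : matrixPaths n) (u : sobolevPaths n q)
    (m : List (Fin n)) (k : ℕ) (K : Compacts (Ioi (0 : ℝ))) :
    sobolevSeminorms n q (m, k, K) (diffusionOp a u) ≤
      ∑ i : Fin n, ∑ j : Fin n, ∑ c ∈ Finset.range (k + 1), (k.choose c : ℝ) *
        (matrixSeminorms n ((i, j), Sum.inl (c, K)) a *
          sobolevSeminorms n q (m ++ [i, j], k - c, K) u) := by
  refine (norm_restrictDeriv_le_iff ℂ (Finset.sum_nonneg fun i _ => Finset.sum_nonneg fun j _ =>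
    Finset.sum_nonneg fun c _ => by positivity)).2 fun τ hτ => ?_
  rw [iteratedDerivWithin_congr (spaceDeriv_diffusionOp a u m) τ.2]
  have hsm : ∀ i j, ContDiffOn ℝ ∞ (fun t => a.1 t i j •
      (sobolevPaths.spaceDeriv (m ++ [i, j]) u).1 t) (Ioi 0) := fun i j =>
    ContDiffOn.smul (a.2 i j).1 (sobolevPaths.spaceDeriv (m ++ [i, j]) u).2
  have hk : ∀ N : ℕ, ((N : ℕ∞ω) ≤ ((⊤ : ℕ∞) : ℕ∞ω)) := fun N => by exact_mod_cast le_top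
  rw [iteratedDerivWithin_fun_sum τ.2 (uniqueDiffOn_Ioi 0)
    (fun i _ => (ContDiffOn.sum fun j _ => (hsm i j).of_le (hk k)) _ τ.2)]
  refine norm_sum_le_of_le _ fun i _ => ?_
  rw [iteratedDerivWithin_fun_sum τ.2 (uniqueDiffOn_Ioi 0)
    (fun j _ => ((hsm i j).of_le (hk k)) _ τ.2)]
  refine norm_sum_le_of_le _ fun j _ => ?_
  rw [← norm_iteratedFDerivWithin_eq_norm_iteratedDerivWithin]
  refine (norm_iteratedFDerivWithin_smul_le (a.2 i j).1
    (sobolevPaths.spaceDeriv (m ++ [i, j]) u).2 (uniqueDiffOn_Ioi 0) τ.2 (hk k)).trans ?_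
  refine Finset.sum_le_sum fun c hc => ?_
  rw [mul_assoc]
  refine mul_le_mul_of_nonneg_left ?_ (by positivity)
  rw [norm_iteratedFDerivWithin_eq_norm_iteratedDerivWithin,
    norm_iteratedFDerivWithin_eq_norm_iteratedDerivWithin]
  exact mul_le_mul
    (norm_iteratedDerivWithin_le ℝ
      (g := Submodule.inclusion inf_le_left (matrixPaths.entry (i, j) a)) hτ)
    (norm_iteratedDerivWithin_le ℂ (g := sobolevPaths.spaceDeriv (m ++ [i, j]) u) hτ)
    (norm_nonneg _) (apply_nonneg _ _)

theorem abs_entry_le (a : matrixPaths n) (b : ℕ) {t : ℝ} (ht0 : 0 ≤ t) (ht : t ≤ b)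
    (i j : Fin n) : |a.1 t i j| ≤ matrixSeminorms n ((i, j), Sum.inr b) a :=
  ContinuousMap.norm_coe_le_norm (contPaths.restrict ℝ b
    (Submodule.inclusion inf_le_right (matrixPaths.entry (i, j) a)) : C(Icc (0 : ℝ) b, ℝ))
    ⟨t, ht0, ht⟩

theorem norm_apply_le (u : contPaths ℂ (LqSpace n q)) (b : ℕ) {t : ℝ} (ht0 : 0 ≤ t)
    (ht : t ≤ b) : ‖u.1 t‖ ≤ contSeminorms ℂ (LqSpace n q) b u :=
  ContinuousMap.norm_coe_le_norm (contPaths.restrict ℂ b u : C(Icc (0 : ℝ) b, LqSpace n q))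
    ⟨t, ht0, ht⟩

theorem contSeminorms_le_iff {u : contPaths ℂ (LqSpace n q)} {b : ℕ} {C : ℝ} (hC : 0 ≤ C) :
    contSeminorms ℂ (LqSpace n q) b u ≤ C ↔ ∀ t ∈ Icc (0 : ℝ) b, ‖u.1 t‖ ≤ C :=
  (ContinuousMap.norm_le _ hC).trans ⟨fun h t ht => h ⟨t, ht⟩, fun h t => h t.1 t.2⟩

/-- A compact subset of `(0, ∞)` is contained in some `[2 δ, b]`. The factor `2` leaves an interval
of length `δ` for smoothing a path that is restarted at the time `δ`. -/
theorem exists_Icc_of_compacts (K : Compacts (Ioi (0 : ℝ))) :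
    ∃ (δ : ℝ) (b : ℕ), 0 < δ ∧ ∀ t ∈ K, (t : ℝ) ∈ Icc (2 * δ) b := by
  rcases (K : Set (Ioi (0 : ℝ))).eq_empty_or_nonempty with hK | hK
  · exact ⟨1, 0, one_pos, fun t ht => absurd (show t ∈ (K : Set (Ioi (0 : ℝ))) from ht)
      (by simp [hK])⟩
  · obtain ⟨x, hx, hxmin⟩ := K.isCompact.exists_isMinOn hK continuous_subtype_val.continuousOn
    obtain ⟨y, hy, hymax⟩ := K.isCompact.exists_isMaxOn hK continuous_subtype_val.continuousOn
    obtain ⟨b, hb⟩ := exists_nat_ge (y : ℝ)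
    refine ⟨x / 2, b, half_pos x.2, fun t ht => ⟨?_, ?_⟩⟩
    · have : (x : ℝ) ≤ t := hxmin ht
      linarith
    · have : (t : ℝ) ≤ y := hymax ht
      exact this.trans hb

/-- The compact subset `[δ, b]` of `(0, ∞)`. -/
def compactIcc {δ : ℝ} (hδ : 0 < δ) (b : ℝ) : Compacts (Ioi (0 : ℝ)) :=
  ⟨Subtype.val ⁻¹' Icc δ b, by
    rw [Topology.IsEmbedding.subtypeVal.isCompact_iff, Subtype.image_preimage_coe,
      inter_eq_right.2 (show Icc δ b ⊆ Ioi 0 from fun x hx => hδ.trans_le hx.1)]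
    exact isCompact_Icc⟩

theorem norm_weakDeriv_le (u : sobolevPaths n q) (m : List (Fin n)) {δ b : ℝ} (hδ : 0 < δ) {t : ℝ}
    (ht : t ∈ Icc δ b) :
    ‖weakDeriv m (u.1 t)‖ ≤ sobolevSeminorms n q (m, 0, compactIcc hδ b) u :=
  (sobolevSeminorms_zero_le_iff (apply_nonneg _ _)).1 le_rfl ⟨t, hδ.trans_le ht.1⟩ ht

theorem timeDeriv_mildSolution {a : matrixPaths n} (h : IsLocallyElliptic a.1)
    (f : solutionSpace n q) (u : sobolevPaths n q) {u₀ : LqSpace n q}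
    (hu : ∀ t, u.1 t = mildSolution a.1 u₀ f.1 t) {t : ℝ} (ht : 0 < t) :
    (timeDeriv u).1 t = (diffusionOp a u).1 t + f.1 t := by
  have h1 := (h.hasDerivAt f.2.1 f.2.2 u₀ ht []).deriv
  simp only [weakDeriv_nil] at h1
  have h2 : u.1 = mildSolution a.1 u₀ f.1 := funext hu
  show (if 0 < t then deriv u.1 t else 0) =
    (if 0 < t then ∑ i, ∑ j, a.1 t i j • weakDeriv [i, j] (u.1 t) else 0) + f.1 t
  rw [if_pos ht, if_pos ht, h2, h1]
  rfl

end Regularity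

/-! ### Dependence of the Duhamel path on the data -/

section Comparison

variable {n : ℕ} {q : ℝ≥0∞} [Fact (1 ≤ q)]
variable {a a' : ℝ → Matrix (Fin n) (Fin n) ℝ} {T κ α : ℝ}

/-- The constant in `‖T_A v - T_{A'} v‖ ≤ C (η / c) ‖v‖`, where `T` is the heat semigroup,
`A, A' ≥ c`, and `η` bounds the entries of `A - A'`. -/
def compConst (n : ℕ) : ℝ := n ^ 2 * (2 * n + 1) * smoothingConst n 2

theorem compConst_nonneg (n : ℕ) : 0 ≤ compConst n := by
  have := smoothingConst_nonneg n 2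
  unfold compConst
  positivity

theorem abs_diffusionIncr_sub_le (ha : ∀ i j, ContinuousOn (fun t => a t i j) (Ici 0))
    (ha' : ∀ i j, ContinuousOn (fun t => a' t i j) (Ici 0)) {s t : ℝ} (hs : 0 ≤ s) (hst : s ≤ t)
    (hα : ∀ r ∈ Ioc s t, ∀ i j, |a r i j - a' r i j| ≤ α) (i j : Fin n) :
    |(diffusionIncr a s t - diffusionIncr a' s t) i j| ≤ (t - s) * α := by
  have ht := hs.trans hst
  rw [Matrix.sub_apply, diffusionIncr_apply ha hs ht, diffusionIncr_apply ha' hs ht,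
    ← intervalIntegral.integral_sub (intervalIntegrable_entry ha hs ht i j)
      (intervalIntegrable_entry ha' hs ht i j), ← Real.norm_eq_abs]
  refine (intervalIntegral.norm_integral_le_of_norm_le_const (C := α) fun r hr => ?_).trans_eq ?_
  · rw [uIoc_of_le hst] at hr
    exact hα r hr i j
  · rw [abs_of_nonneg (sub_nonneg.2 hst), mul_comm]

namespace IsElliptic

/-- The comparison of two evolution families is uniform down to `s = t`: both `A(t) - A(s)` and the
difference of two such increments are proportional to `t - s`. -/
theorem norm_heatSemigroup_diffusionIncr_sub_le (h : IsElliptic a T κ) (h' : IsElliptic a' T κ)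
    (hα0 : 0 ≤ α) {s t : ℝ} (hs : 0 ≤ s) (hst : s ≤ t) (ht : t ≤ T)
    (hα : ∀ r ∈ Ioc s t, ∀ i j, |a r i j - a' r i j| ≤ α) (v : LqSpace n q) :
    ‖heatSemigroup (diffusionIncr a s t) v - heatSemigroup (diffusionIncr a' s t) v‖ ≤
      compConst n * (α / κ) * ‖v‖ := by
  rcases hst.eq_or_lt with rfl | hlt
  · rw [diffusionIncr_self, diffusionIncr_self, sub_self, norm_zero]
    have := compConst_nonneg n
    have := h.pos
    positivity
  · have hts := sub_pos.2 hlt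
    have := norm_heatSemigroup_sub_heatSemigroup_le_of_abs (mul_pos hts h.pos)
      (h.posSemidef_diffusionIncr_sub hs hst ht le_rfl)
      (h'.posSemidef_diffusionIncr_sub hs hst ht le_rfl) (mul_nonneg hts.le hα0)
      (abs_diffusionIncr_sub_le h.cont h'.cont hs hst hα) v
    -- the length `t - s` cancels
    rwa [mul_div_mul_left _ _ hts.ne'] at this

theorem norm_integral_sub_le (h : IsElliptic a T κ) (h' : IsElliptic a' T κ)
    (hα0 : 0 ≤ α) {s t : ℝ} (hs : 0 ≤ s) (hst : s ≤ t) (ht : t ≤ T)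
    (hα : ∀ r ∈ Ioc s t, ∀ i j, |a r i j - a' r i j| ≤ α) {g g' : ℝ → LqSpace n q} {ν G : ℝ}
    (hν : ∀ r ∈ Ioc s t, ‖g r - g' r‖ ≤ ν) (hG : ∀ r ∈ Ioc s t, ‖g' r‖ ≤ G)
    (hi : IntervalIntegrable (fun r => heatSemigroup (diffusionIncr a r t) (g r)) volume s t)
    (hi' : IntervalIntegrable (fun r => heatSemigroup (diffusionIncr a' r t) (g' r)) volume s t) :
    ‖(∫ r in s..t, heatSemigroup (diffusionIncr a r t) (g r)) -
      ∫ r in s..t, heatSemigroup (diffusionIncr a' r t) (g' r)‖ ≤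
      (t - s) * (ν + compConst n * (α / κ) * G) := by
  rw [← intervalIntegral.integral_sub hi hi', mul_comm (t - s),
    ← abs_of_nonneg (sub_nonneg.2 hst)]
  refine intervalIntegral.norm_integral_le_of_norm_le_const fun r hr => ?_
  rw [uIoc_of_le hst] at hr
  have e : heatSemigroup (diffusionIncr a r t) (g r) - heatSemigroup (diffusionIncr a' r t) (g' r) =
      heatSemigroup (diffusionIncr a r t) (g r - g' r) + (heatSemigroup (diffusionIncr a r t) (g' r)
        - heatSemigroup (diffusionIncr a' r t) (g' r)) := by rw [map_sub]; abel
  rw [e]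
  refine (norm_add_le _ _).trans (add_le_add ((norm_heatSemigroup_le _ _).trans (hν r hr)) ?_)
  refine (h.norm_heatSemigroup_diffusionIncr_sub_le h' hα0 (hs.trans hr.1.le) hr.2 ht
    (fun x hx => hα x ⟨hr.1.trans hx.1, hx.2⟩) _).trans ?_
  have := compConst_nonneg n
  have := h.pos
  exact mul_le_mul_of_nonneg_left (hG r hr) (by positivity)

variable {f f' : ℝ → LqSpace n q}

/-- Dependence of the Duhamel path on diffusivity, initial datum and source, in `L^q`. -/
theorem norm_mildSolution_sub_le (h : IsElliptic a T κ) (h' : IsElliptic a' T κ)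
    (hα0 : 0 ≤ α) {t : ℝ} (ht0 : 0 ≤ t) (ht : t ≤ T)
    (hα : ∀ r ∈ Ioc 0 t, ∀ i j, |a r i j - a' r i j| ≤ α)
    (hf : f ∈ solutionSpace n q) (hf' : f' ∈ solutionSpace n q) {ν F : ℝ}
    (hν : ∀ r ∈ Ioc 0 t, ‖f r - f' r‖ ≤ ν) (hF : ∀ r ∈ Ioc 0 t, ‖f' r‖ ≤ F)
    (u₀ u₀' : LqSpace n q) :
    ‖mildSolution a u₀ f t - mildSolution a' u₀' f' t‖ ≤
      (‖u₀ - u₀'‖ + compConst n * (α / κ) * ‖u₀'‖) + t * (ν + compConst n * (α / κ) * F) := by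
  have e : mildSolution a u₀ f t - mildSolution a' u₀' f' t =
      (heatSemigroup (diffusionIncr a 0 t) (u₀ - u₀') + (heatSemigroup (diffusionIncr a 0 t) u₀' -
        heatSemigroup (diffusionIncr a' 0 t) u₀')) +
      ((∫ r in (0 : ℝ)..t, heatSemigroup (diffusionIncr a r t) (f r)) -
        ∫ r in (0 : ℝ)..t, heatSemigroup (diffusionIncr a' r t) (f' r)) := by
    rw [mildSolution, mildSolution, map_sub]; abel
  rw [e]
  refine (norm_add_le _ _).trans (add_le_add ((norm_add_le _ _).trans
    (add_le_add (norm_heatSemigroup_le _ _)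
      (h.norm_heatSemigroup_diffusionIncr_sub_le h' hα0 le_rfl ht0 ht hα _))) ?_)
  simpa using h.norm_integral_sub_le h' hα0 le_rfl ht0 ht hα hν hF
    (h.intervalIntegrable_source hf.1 hf.2 le_rfl ht0 ht)
    (h'.intervalIntegrable_source hf'.1 hf'.2 le_rfl ht0 ht)

/-- Dependence of the spatial derivatives of the Duhamel path on the data: both paths are restarted
at the time `s`, and the smoothing over `[s, t]` reduces the claim to the `L^q` estimate at `s`. -/
theorem norm_weakDeriv_mildSolution_sub_mildSolution_le (h : IsElliptic a T κ)
    (h' : IsElliptic a' T κ) (hα0 : 0 ≤ α) {s t c : ℝ} (hs : 0 < s) (hst : s < t) (ht : t ≤ T)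
    (hc0 : 0 < c) (hc : c ≤ (t - s) * κ)
    (hα : ∀ r ∈ Ioc s t, ∀ i j, |a r i j - a' r i j| ≤ α)
    (hf : f ∈ solutionSpace n q) (hf' : f' ∈ solutionSpace n q) (m : List (Fin n)) {ν G : ℝ}
    (hν : ∀ r ∈ Ioc s t, ‖weakDeriv m (f r) - weakDeriv m (f' r)‖ ≤ ν)
    (hG : ∀ r ∈ Ioc s t, ‖weakDeriv m (f' r)‖ ≤ G) (u₀ u₀' : LqSpace n q) :
    ‖weakDeriv m (mildSolution a u₀ f t) - weakDeriv m (mildSolution a' u₀' f' t)‖ ≤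
      (smoothingConst n m.length * (1 / √c) ^ m.length *
          ‖mildSolution a u₀ f s - mildSolution a' u₀' f' s‖ +
        compConst n * (((t - s) * α) / (c / 2)) * (smoothingConst n m.length *
          (1 / √(c / 2)) ^ m.length * ‖mildSolution a' u₀' f' s‖)) +
      (t - s) * (ν + compConst n * (α / κ) * G) := by
  have hA := h.posSemidef_diffusionIncr_sub hs.le hst.le ht hc
  have hA' := h'.posSemidef_diffusionIncr_sub hs.le hst.le ht hc
  set u := mildSolution a u₀ f s
  set u' := mildSolution a' u₀' f' s
  have hsub : weakDeriv m (heatSemigroup (diffusionIncr a s t) u) =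
      weakDeriv m (heatSemigroup (diffusionIncr a s t) (u - u')) +
        weakDeriv m (heatSemigroup (diffusionIncr a s t) u') := by
    rw [← weakDeriv_add (heatSemigroup_mem_sobolevInfty_of_pos hc0 hA _)
      (heatSemigroup_mem_sobolevInfty_of_pos hc0 hA _), ← map_add, sub_add_cancel]
  rw [h.weakDeriv_mildSolution_split hf.1 hf.2 u₀ hs hst ht,
    h'.weakDeriv_mildSolution_split hf'.1 hf'.2 u₀' hs hst ht, hsub, add_sub_add_comm,
    add_sub_assoc]
  refine (norm_add_le _ _).trans (add_le_add ((norm_add_le _ _).trans (add_le_add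
    (norm_weakDeriv_heatSemigroup_le hc0 hA m _)
    (norm_weakDeriv_sub_heatSemigroup_le hc0 hA hA' (mul_nonneg (sub_pos.2 hst).le hα0)
      (abs_diffusionIncr_sub_le h.cont h'.cont hs.le hst.le hα) m _))) ?_)
  exact h.norm_integral_sub_le h' hα0 hs.le hst.le ht hα hν hG
    (h.intervalIntegrable_weakDeriv hf.1 hs hst.le ht m)
    (h'.intervalIntegrable_weakDeriv hf'.1 hs hst.le ht m)

end IsElliptic

end Comparison

/-! ### Moderate and negligible nets of numbers -/

namespace AsymptoticScale

variable {Υ : Type*} [PartialOrder Υ] [IsDirectedOrder Υ] [Nonempty Υ] (ς : AsymptoticScale Υ)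

/-- A moderate net of real numbers. -/
def IsModerate (r : NetParam → ℝ) : Prop :=
  ∃ ℓ, (fun ε => ς.toFun ℓ ε * r ε) =o[netLim] (fun _ => (1 : ℝ))

/-- A negligible net of real numbers. -/
def IsNegligible (r : NetParam → ℝ) : Prop := ∀ ℓ, r =o[netLim] ς.toFun ℓ

variable {ς} {r s : NetParam → ℝ}

theorem IsModerate.mono (hs : ς.IsModerate s) (h0 : ∀ ε, 0 ≤ r ε) (h : ∀ ε, r ε ≤ s ε) :
    ς.IsModerate r := by
  obtain ⟨ℓ, hℓ⟩ := hs
  refine ⟨ℓ, IsBigO.trans_isLittleO (IsBigO.of_bound 1 (Eventually.of_forall fun ε => ?_)) hℓ⟩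
  have hp := (ς.pos' ℓ ε).le
  rw [one_mul, Real.norm_of_nonneg (mul_nonneg hp (h0 ε)),
    Real.norm_of_nonneg (mul_nonneg hp ((h0 ε).trans (h ε)))]
  exact mul_le_mul_of_nonneg_left (h ε) hp

theorem isModerate_const (c : ℝ) : ς.IsModerate fun _ => c := by
  obtain ⟨k, hk⟩ := ς.exists_isLittleO_one
  refine ⟨k, ?_⟩
  simpa [mul_comm] using hk.const_mul_left c

theorem IsModerate.add (hr : ς.IsModerate r) (hs : ς.IsModerate s) :
    ς.IsModerate fun ε => r ε + s ε := by
  obtain ⟨ℓ, hℓ⟩ := hr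
  obtain ⟨j, hj⟩ := hs
  obtain ⟨k, hk1, hk2⟩ := ς.exists_isLittleO_both ℓ j
  refine ⟨k, ?_⟩
  have h1 := (hk1.isBigO.mul (isBigO_refl r netLim)).trans_isLittleO hℓ
  have h2 := (hk2.isBigO.mul (isBigO_refl s netLim)).trans_isLittleO hj
  simpa [mul_add] using h1.add h2

theorem IsModerate.mul (hr : ς.IsModerate r) (hs : ς.IsModerate s) :
    ς.IsModerate fun ε => r ε * s ε := by
  obtain ⟨ℓ, hℓ⟩ := hr
  obtain ⟨j, hj⟩ := hs
  obtain ⟨k, hk⟩ := ς.exists_isLittleO_mul' ℓ j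
  refine ⟨k, (hk.isBigO.mul (isBigO_refl (fun ε => r ε * s ε) netLim)).trans_isLittleO ?_⟩
  have := hℓ.mul hj
  simp only [mul_one] at this
  exact this.congr_left fun ε => by ring

theorem IsModerate.const_mul (hr : ς.IsModerate r) (c : ℝ) : ς.IsModerate fun ε => c * r ε :=
  (isModerate_const c).mul hr

theorem IsModerate.pow (hr : ς.IsModerate r) (k : ℕ) : ς.IsModerate fun ε => r ε ^ k := by
  induction k with
  | zero => simpa using isModerate_const (ς := ς) 1
  | succ k ih => simpa only [pow_succ] using ih.mul hr

theorem IsModerate.sum {ι : Type*} (t : Finset ι) {r : ι → NetParam → ℝ}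
    (hr : ∀ i ∈ t, ς.IsModerate (r i)) : ς.IsModerate fun ε => ∑ i ∈ t, r i ε := by
  classical
  induction t using Finset.induction_on with
  | empty => simpa using isModerate_const (ς := ς) 0
  | insert i t hi ih =>
    simp only [Finset.sum_insert hi]
    exact (hr i (Finset.mem_insert_self i t)).add
      (ih fun j hj => hr j (Finset.mem_insert_of_mem hj))

theorem IsModerate.sqrt (hr : ς.IsModerate r) (h0 : ∀ ε, 0 ≤ r ε) :
    ς.IsModerate fun ε => √(r ε) := by
  refine ((isModerate_const 1).add hr).mono (fun ε => Real.sqrt_nonneg _) fun ε => ?_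
  refine Real.sqrt_le_iff.2 ⟨by linarith [h0 ε], ?_⟩
  nlinarith [h0 ε]

theorem IsNegligible.mono (hs : ς.IsNegligible s) (h0 : ∀ ε, 0 ≤ r ε) (h : ∀ ε, r ε ≤ s ε) :
    ς.IsNegligible r := by
  intro ℓ
  refine IsBigO.trans_isLittleO (IsBigO.of_bound 1 (Eventually.of_forall fun ε => ?_)) (hs ℓ)
  rw [one_mul, Real.norm_of_nonneg (h0 ε), Real.norm_of_nonneg ((h0 ε).trans (h ε))]
  exact h ε

theorem IsNegligible.add (hr : ς.IsNegligible r) (hs : ς.IsNegligible s) :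
    ς.IsNegligible fun ε => r ε + s ε := fun ℓ => (hr ℓ).add (hs ℓ)

theorem IsNegligible.mul (hr : ς.IsNegligible r) (hs : ς.IsModerate s) :
    ς.IsNegligible fun ε => r ε * s ε := by
  intro ℓ
  obtain ⟨j, hj⟩ := hs
  -- `r = o(ς_k) = o(ς_ℓ ς_j)`, and `ς_j s` is bounded
  obtain ⟨k, hk⟩ := ς.exists_isLittleO_mul' ℓ j
  have e1 := ((hr k).trans hk).mul_isBigO (isBigO_refl s netLim)
  have e2 := (isBigO_refl (ς.toFun ℓ) netLim).mul hj.isBigO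
  simp only [mul_one] at e2
  exact e1.trans_isBigO (e2.congr_left fun ε => by ring)

theorem IsNegligible.const_mul (hr : ς.IsNegligible r) (c : ℝ) :
    ς.IsNegligible fun ε => c * r ε := fun ℓ => (hr ℓ).const_mul_left c

theorem IsNegligible.sum {ι : Type*} (t : Finset ι) {r : ι → NetParam → ℝ}
    (hr : ∀ i ∈ t, ς.IsNegligible (r i)) : ς.IsNegligible fun ε => ∑ i ∈ t, r i ε :=
  fun ℓ => IsLittleO.fun_sum fun i hi => hr i hi ℓ

end AsymptoticScale

/-! ### Ellipticity of diffusivity nets -/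

section Ellipticity

open AsymptoticScale

variable {n : ℕ}

/-- A symmetric positive definite matrix is bounded below by the inverse of any bound of its
inverse. -/
theorem posSemidef_sub_of_mul_eq_one {a b : Matrix (Fin n) (Fin n) ℝ} (ha : a.PosDef)
    (hab : a * b = 1) {M K : ℝ} (hb : ∀ i j, |b i j| ≤ M) (hK0 : 0 < K) (hK : n * M ≤ K) :
    (a - (1 / K) • 1).PosSemidef := by
  have hsymm : a.IsSymm := by simpa using ha.isHermitian
  refine posSemidef_of_forall (hsymm.sub (Matrix.isSymm_one.smul _)) fun x => ?_
  have h0 : 0 ≤ x ⬝ᵥ x := Finset.sum_nonneg fun i _ => mul_self_nonneg _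
  -- positivity of the form of `a` at `x - K⁻¹ b x`, where `a (b x) = x`
  have h1 := ha.posSemidef.dotProduct_mulVec_nonneg (x - (1 / K) • b.mulVec x)
  have e1 : a.mulVec (b.mulVec x) = x := by rw [Matrix.mulVec_mulVec, hab, Matrix.one_mulVec]
  have e2 : b.mulVec x ⬝ᵥ a.mulVec x = x ⬝ᵥ x := by
    rw [Matrix.dotProduct_mulVec, ← Matrix.mulVec_transpose, hsymm.eq, e1]
  simp only [star_trivial, Matrix.mulVec_sub, Matrix.mulVec_smul, e1, sub_dotProduct,
    dotProduct_sub, smul_dotProduct, dotProduct_smul, smul_eq_mul, e2] at h1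
  have h2 := (abs_le.1 (abs_dotProduct_mulVec_le hb x)).2
  rw [dotProduct_comm] at h2
  have h3 : 1 / K * (1 / K * (b.mulVec x ⬝ᵥ x)) ≤ 1 / K * (x ⬝ᵥ x) := by
    refine mul_le_mul_of_nonneg_left ?_ (by positivity)
    calc 1 / K * (b.mulVec x ⬝ᵥ x) ≤ 1 / K * (K * (x ⬝ᵥ x)) := by
          refine mul_le_mul_of_nonneg_left (h2.trans ?_) (by positivity)
          exact mul_le_mul_of_nonneg_right hK h0
      _ = x ⬝ᵥ x := by field_simp
  rw [Matrix.sub_mulVec, Matrix.smul_mulVec, Matrix.one_mulVec, dotProduct_sub, dotProduct_smul,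
    smul_eq_mul]
  linarith

/-- The sum of the suprema over `[0, b]` of the matrix entries. -/
def matrixBound (b : ℕ) (a : matrixPaths n) : ℝ :=
  ∑ i, ∑ j, matrixSeminorms n ((i, j), Sum.inr b) a

theorem matrixBound_nonneg (b : ℕ) (a : matrixPaths n) : 0 ≤ matrixBound b a :=
  Finset.sum_nonneg fun _ _ => Finset.sum_nonneg fun _ _ => apply_nonneg _ _

theorem abs_entry_le_matrixBound (a : matrixPaths n) (b : ℕ) {t : ℝ} (ht0 : 0 ≤ t) (ht : t ≤ b)
    (i j : Fin n) : |a.1 t i j| ≤ matrixBound b a :=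
  (abs_entry_le a b ht0 ht i j).trans
    ((Finset.single_le_sum (f := fun j => matrixSeminorms n ((i, j), Sum.inr b) a)
      (fun _ _ => apply_nonneg _ _) (Finset.mem_univ j)).trans
    (Finset.single_le_sum (f := fun i => ∑ j, matrixSeminorms n ((i, j), Sum.inr b) a)
      (fun _ _ => Finset.sum_nonneg fun _ _ => apply_nonneg _ _) (Finset.mem_univ i)))

variable {Υ : Type*} [PartialOrder Υ] [IsDirectedOrder Υ] [Nonempty Υ] {ς : AsymptoticScale Υ}
  {aN : NetParam → matrixPaths n}

theorem isModerate_matrixBound (ha : aN ∈ moderateNets ς (matrixSeminorms n)) (b : ℕ) :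
    ς.IsModerate fun ε => matrixBound b (aN ε) :=
  IsModerate.sum _ fun _ _ => IsModerate.sum _ fun _ _ => ha _

theorem isNegligible_matrixBound (ha : aN ∈ negligibleNets ς (matrixSeminorms n)) (b : ℕ) :
    ς.IsNegligible fun ε => matrixBound b (aN ε) :=
  IsNegligible.sum _ fun _ _ => IsNegligible.sum _ fun _ _ => ha _

/-- On every bounded interval a diffusivity net is bounded below by the inverse of a moderate net:
`K = n ‖a⁻¹‖ + 1`, where the bound of the inverse paths is moderate by assumption. -/
theorem IsDiffusivityNet.exists_isElliptic (ha : IsDiffusivityNet ς n aN) (N : ℕ) :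
    ∃ K : NetParam → ℝ, ς.IsModerate K ∧ (∀ ε, 0 < K ε) ∧
      ∀ ε, IsElliptic (aN ε).1 N (1 / K ε) := by
  obtain ⟨-, hpd, b, hb, hab⟩ := ha
  have h0 : ∀ ε, 0 < n * matrixBound N (b ε) + 1 := fun ε => by
    have := matrixBound_nonneg N (b ε)
    positivity
  refine ⟨fun ε => n * matrixBound N (b ε) + 1,
    ((isModerate_matrixBound hb N).const_mul n).add (isModerate_const 1), h0, fun ε => ?_⟩
  refine ⟨one_div_pos.2 (h0 ε), fun i j => ((aN ε).2 i j).2, fun t ht => ?_⟩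
  exact posSemidef_sub_of_mul_eq_one (hpd ε t ht.1) (hab ε t ht.1.le)
    (abs_entry_le_matrixBound (b ε) N ht.1.le ht.2) (h0 ε) (by linarith)

theorem IsDiffusivityNet.isLocallyElliptic (ha : IsDiffusivityNet ς n aN) (ε : NetParam) :
    IsLocallyElliptic (aN ε).1 := by
  intro T
  obtain ⟨N, hN⟩ := exists_nat_ge T
  obtain ⟨K, -, -, hK⟩ := ha.exists_isElliptic N
  exact ⟨_, (hK ε).mono hN (hK ε).pos le_rfl⟩

end Ellipticity

/-! ### Moderateness of the Duhamel nets and independence of the representatives -/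

section Nets

open TopologicalSpace AsymptoticScale

variable {n : ℕ} {q : ℝ≥0∞} [Fact (1 ≤ q)]
variable {Υ : Type*} [PartialOrder Υ] [IsDirectedOrder Υ] [Nonempty Υ] {ς : AsymptoticScale Υ}

/-- A path in `C^∞(ℝ₊, W^{q,∞}) ∩ C([0, ∞), L^q)` as an element of `C^∞(ℝ₊, W^{q,∞})`. -/
abbrev sobolevPart (u : solutionSpace n q) : sobolevPaths n q := Submodule.inclusion inf_le_left u

/-- The supremum of `‖u(t)‖` over `[0, b]`. -/
abbrev supNorm (b : ℕ) (u : solutionSpace n q) : ℝ := solutionSeminorms n q (Sum.inr b) u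

theorem norm_le_supNorm (u : solutionSpace n q) (b : ℕ) {t : ℝ} (ht0 : 0 ≤ t) (ht : t ≤ b) :
    ‖u.1 t‖ ≤ supNorm b u :=
  norm_apply_le (Submodule.inclusion inf_le_right u) b ht0 ht

theorem sobolevPart_sub (u u' : solutionSpace n q) :
    sobolevPart (u - u') = sobolevPart u - sobolevPart u' := rfl

theorem norm_weakDeriv_le_of_mem (u : solutionSpace n q) (m : List (Fin n)) {δ b : ℝ} (hδ : 0 < δ)
    {t : ℝ} (ht : t ∈ Icc δ b) :
    ‖weakDeriv m (u.1 t)‖ ≤ sobolevSeminorms n q (m, 0, compactIcc hδ b) (sobolevPart u) :=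
  norm_weakDeriv_le (sobolevPart u) m hδ ht

theorem supNorm_le {u : solutionSpace n q} {b : ℕ} {C : ℝ} (hC : 0 ≤ C)
    (h : ∀ t ∈ Icc (0 : ℝ) b, ‖u.1 t‖ ≤ C) : supNorm b u ≤ C :=
  (contSeminorms_le_iff (u := Submodule.inclusion inf_le_right u) hC).2 h

/-- The smoothing factors `c^{-k/2}` are moderate if `c = δ / K` with `K` moderate. -/
theorem isModerate_inv_sqrt {K : NetParam → ℝ} (hK : ς.IsModerate K) (hK0 : ∀ ε, 0 < K ε)
    (δ : ℝ) (hδ : 0 < δ) (k : ℕ) :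
    ς.IsModerate fun ε => (1 / √(δ * (1 / K ε))) ^ k := by
  refine IsModerate.pow ?_ k
  have : (fun ε => 1 / √(δ * (1 / K ε))) = fun ε => √(1 / δ * K ε) := by
    funext ε
    rw [one_div, ← Real.sqrt_inv, mul_inv, one_div, one_div, inv_inv]
  rw [this]
  exact (hK.const_mul (1 / δ)).sqrt fun ε => mul_nonneg (by positivity) (hK0 ε).le

/-- Nets of diffusivities, initial data and sources that represent generalised data of the very weak
Cauchy problem. The initial data are admissible, that is, bounded and uniformly continuous if
`q = ∞`. -/
structure CauchyNet (ς : AsymptoticScale Υ) (n : ℕ) (q : ℝ≥0∞) [Fact (1 ≤ q)] where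
  a : NetParam → matrixPaths n
  u : NetParam → LqSpace n q
  f : NetParam → solutionSpace n q
  isDiffusivityNet : IsDiffusivityNet ς n a
  moderate_u : u ∈ moderateNets ς (lqSeminorms n q)
  mem_initialData : ∀ ε, u ε ∈ initialData n q
  moderate_f : f ∈ moderateNets ς (solutionSeminorms n q)

namespace CauchyNet

variable (D D' : CauchyNet ς n q)

theorem isLocallyElliptic (ε : NetParam) : IsLocallyElliptic (D.a ε).1 :=
  D.isDiffusivityNet.isLocallyElliptic ε

/-- The net of Duhamel paths of the data. -/
def path (ε : NetParam) : solutionSpace n q :=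
  ⟨mildSolution (D.a ε).1 (D.u ε) (D.f ε).1,
    (D.isLocallyElliptic ε).mildSolution_mem (D.f ε).2 (D.mem_initialData ε)⟩

theorem path_apply (ε : NetParam) {t : ℝ} (ht : 0 ≤ t) :
    (D.path ε).1 t = duhamel (D.a ε).1 (D.u ε) (D.f ε).1 t :=
  let ⟨_, hκ⟩ := D.isLocallyElliptic ε t
  (hκ.duhamel_eq_mildSolution ht le_rfl _ _).symm

theorem path_zero (ε : NetParam) : (D.path ε).1 0 = D.u ε := mildSolution_zero _ _ _

/-- The Duhamel paths solve the Cauchy problem. -/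
theorem timeDeriv_path (ε : NetParam) {t : ℝ} (ht : 0 < t) :
    (timeDeriv (sobolevPart (D.path ε))).1 t =
      (diffusionOp (D.a ε) (sobolevPart (D.path ε)) + sobolevPart (D.f ε)).1 t :=
  timeDeriv_mildSolution (D.isLocallyElliptic ε) (D.f ε) _ (fun _ => rfl) ht

theorem isModerate_norm_u : ς.IsModerate fun ε => ‖D.u ε‖ := D.moderate_u ()

theorem isModerate_f (i) : ς.IsModerate fun ε => solutionSeminorms n q i (D.f ε) := D.moderate_f i

theorem isModerate_supNorm (b : ℕ) : ς.IsModerate fun ε => supNorm b (D.path ε) := by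
  refine (D.isModerate_norm_u.add ((D.isModerate_f (Sum.inr b)).const_mul b)).mono
    (fun ε => apply_nonneg _ _) fun ε => ?_
  refine supNorm_le (by positivity) fun t ht => ?_
  refine (IsElliptic.norm_mildSolution_le (F := supNorm b (D.f ε)) ht.1 _ fun r hr =>
    norm_le_supNorm _ b hr.1.le (hr.2.trans ht.2)).trans ?_
  have : 0 ≤ supNorm b (D.f ε) := apply_nonneg _ _
  gcongr
  exact ht.2

/-- The smoothing estimate from the time `δ` on; all its constants are moderate. -/
theorem isModerate_sobolevSeminorms_zero (m : List (Fin n)) (K : Compacts (Ioi (0 : ℝ))) :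
    ς.IsModerate fun ε => sobolevSeminorms n q (m, 0, K) (sobolevPart (D.path ε)) := by
  obtain ⟨δ, b, hδ, hb⟩ := exists_Icc_of_compacts K
  obtain ⟨k, hk, hk0, hell⟩ := D.isDiffusivityNet.exists_isElliptic b
  refine ((((isModerate_inv_sqrt hk hk0 δ hδ m.length).const_mul
    (smoothingConst n m.length)).mul (D.isModerate_supNorm b)).add
    ((D.isModerate_f (Sum.inl (m, 0, compactIcc hδ b))).const_mul b)).mono
    (fun ε => apply_nonneg _ _) fun ε => ?_
  have hs0 := smoothingConst_nonneg n m.length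
  refine (sobolevSeminorms_zero_le_iff ?_).2 fun t ht => ?_
  · have h3 : 0 ≤ supNorm b (D.path ε) := apply_nonneg _ _
    positivity
  · have ht' := hb t ht
    have hκ := (hell ε).pos
    refine ((hell ε).norm_weakDeriv_mildSolution_le (D.f ε).2.1 (D.f ε).2.2 (D.u ε) hδ
      (by linarith [ht'.1]) ht'.2 (mul_pos hδ hκ)
      (mul_le_mul_of_nonneg_right (by linarith [ht'.1]) hκ.le) m fun r hr =>
      norm_weakDeriv_le (sobolevPart (D.f ε)) m hδ ⟨hr.1.le, hr.2.trans ht'.2⟩).trans ?_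
    refine add_le_add (mul_le_mul_of_nonneg_left
      (norm_le_supNorm (D.path ε) b hδ.le (by linarith [ht'.1, ht'.2])) (by positivity))
      (mul_le_mul_of_nonneg_right (by linarith [ht'.2]) (apply_nonneg _ _))

/-- The seminorms with time derivatives are controlled by means of the equation, which trades one
time derivative for two spatial ones. -/
theorem isModerate_sobolevSeminorms (j : ℕ) (m : List (Fin n)) (K : Compacts (Ioi (0 : ℝ))) :
    ς.IsModerate fun ε => sobolevSeminorms n q (m, j, K) (sobolevPart (D.path ε)) := by
  induction j using Nat.strong_induction_on generalizing m K with
  | _ j ih =>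
    rcases j with _ | j
    · exact D.isModerate_sobolevSeminorms_zero m K
    · refine IsModerate.mono (s := fun ε => (∑ i : Fin n, ∑ l : Fin n,
        ∑ c ∈ Finset.range (j + 1), (j.choose c : ℝ) *
          (matrixSeminorms n ((i, l), Sum.inl (c, K)) (D.a ε) *
            sobolevSeminorms n q (m ++ [i, l], j - c, K) (sobolevPart (D.path ε)))) +
        solutionSeminorms n q (Sum.inl (m, j, K)) (D.f ε)) ?_ (fun ε => apply_nonneg _ _)
        fun ε => ?_
      · refine IsModerate.add (IsModerate.sum _ fun i _ => IsModerate.sum _ fun l _ =>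
          IsModerate.sum _ fun c _ => IsModerate.const_mul
            (IsModerate.mul (D.isDiffusivityNet.1 _) ?_) _) (D.isModerate_f _)
        exact ih (j - c) (by omega) _ _
      · refine (sobolevSeminorms_succ_le _ m j K).trans ?_
        rw [sobolevSeminorms_congr fun t ht =>
          D.timeDeriv_path ε ht]
        exact (map_add_le_add _ _ _).trans (add_le_add
          (sobolevSeminorms_diffusionOp_le _ _ m j K) le_rfl)

theorem path_mem_moderateNets : D.path ∈ moderateNets ς (solutionSeminorms n q) := by
  rintro (⟨m, j, K⟩ | b)
  · exact D.isModerate_sobolevSeminorms j m K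
  · exact D.isModerate_supNorm b

variable {D D'}

variable (D D') in
/-- Both nets of data represent the same generalised data. -/
structure Equivalent : Prop where
  a : D.a - D'.a ∈ negligibleNets ς (matrixSeminorms n)
  u : D.u - D'.u ∈ negligibleNets ς (lqSeminorms n q)
  f : D.f - D'.f ∈ negligibleNets ς (solutionSeminorms n q)

/-- A common ellipticity bound for two nets of diffusivities. -/
theorem exists_isElliptic_both (D D' : CauchyNet ς n q) (b : ℕ) :
    ∃ K : NetParam → ℝ, ς.IsModerate K ∧ (∀ ε, 0 < K ε) ∧
      (∀ ε, IsElliptic (D.a ε).1 b (1 / K ε)) ∧ ∀ ε, IsElliptic (D'.a ε).1 b (1 / K ε) := by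
  obtain ⟨k, hk, hk0, h⟩ := D.isDiffusivityNet.exists_isElliptic b
  obtain ⟨k', hk', hk0', h'⟩ := D'.isDiffusivityNet.exists_isElliptic b
  have hpos : ∀ ε, 0 < k ε + k' ε := fun ε => add_pos (hk0 ε) (hk0' ε)
  exact ⟨fun ε => k ε + k' ε, hk.add hk', hpos,
    fun ε => (h ε).mono le_rfl (one_div_pos.2 (hpos ε))
      (one_div_le_one_div_of_le (hk0 ε) (by linarith [hk0' ε])),
    fun ε => (h' ε).mono le_rfl (one_div_pos.2 (hpos ε))
      (one_div_le_one_div_of_le (hk0' ε) (by linarith [hk0 ε]))⟩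

theorem abs_entry_sub_le (b : ℕ) (ε : NetParam) {r : ℝ} (h0 : 0 ≤ r) (hr : r ≤ b)
    (i j : Fin n) :
    |(D.a ε).1 r i j - (D'.a ε).1 r i j| ≤ matrixBound b (D.a ε - D'.a ε) :=
  abs_entry_le_matrixBound (D.a ε - D'.a ε) b h0 hr i j

theorem weakDeriv_sub_apply (u u' : solutionSpace n q) (m : List (Fin n)) {r : ℝ} (hr : 0 < r) :
    weakDeriv m ((u - u').1 r) = weakDeriv m (u.1 r) - weakDeriv m (u'.1 r) := by
  have h3 := weakDeriv_add ((u - u').2.1.1 r hr) (u'.2.1.1 r hr) m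
  have h4 : (u - u').1 r + u'.1 r = u.1 r := by
    show u.1 r - u'.1 r + u'.1 r = u.1 r
    abel
  rw [h4] at h3
  rw [h3, add_sub_cancel_right]

theorem supNorm_path_sub_le {k : ℝ} (hk : 0 < k) (b : ℕ) (ε : NetParam)
    (he : IsElliptic (D.a ε).1 b (1 / k)) (he' : IsElliptic (D'.a ε).1 b (1 / k)) :
    supNorm b (D.path ε - D'.path ε) ≤
      (‖D.u ε - D'.u ε‖ + compConst n * (matrixBound b (D.a ε - D'.a ε) * k) * ‖D'.u ε‖) +
        b * (supNorm b (D.f ε - D'.f ε) +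
          compConst n * (matrixBound b (D.a ε - D'.a ε) * k) * supNorm b (D'.f ε)) := by
  have hC := compConst_nonneg n
  have hα0 := matrixBound_nonneg b (D.a ε - D'.a ε)
  have hf1 : 0 ≤ supNorm b (D.f ε - D'.f ε) := apply_nonneg _ _
  have hf2 : 0 ≤ supNorm b (D'.f ε) := apply_nonneg _ _
  refine supNorm_le (by positivity) fun t ht => ?_
  refine (he.norm_mildSolution_sub_le he' hα0 ht.1 ht.2
    (fun r hr => abs_entry_sub_le b ε hr.1.le (hr.2.trans ht.2)) (D.f ε).2 (D'.f ε).2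
    (fun r hr => norm_le_supNorm (D.f ε - D'.f ε) b hr.1.le (hr.2.trans ht.2))
    (fun r hr => norm_le_supNorm (D'.f ε) b hr.1.le (hr.2.trans ht.2)) (D.u ε) (D'.u ε)).trans ?_
  rw [div_div_eq_mul_div, div_one]
  gcongr
  exact ht.2

/-- The comparison of the spatial derivatives on `K ⊆ [2 δ, b]`, by a restart at `δ`. Every summand
contains the difference of two equivalent nets. -/
theorem sobolevSeminorms_zero_path_sub_le {k δ : ℝ} (hk : 0 < k) (hδ : 0 < δ) (b : ℕ)
    (ε : NetParam) (he : IsElliptic (D.a ε).1 b (1 / k)) (he' : IsElliptic (D'.a ε).1 b (1 / k))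
    (m : List (Fin n)) {K : Compacts (Ioi (0 : ℝ))} (hb : ∀ t ∈ K, (t : ℝ) ∈ Icc (2 * δ) b) :
    sobolevSeminorms n q (m, 0, K) (sobolevPart (D.path ε - D'.path ε)) ≤
      (supNorm b (D.path ε - D'.path ε) *
          (smoothingConst n m.length * (1 / √(δ * (1 / k))) ^ m.length) +
        b / (δ / 2) * (compConst n * (matrixBound b (D.a ε - D'.a ε) * k)) *
          (smoothingConst n m.length * (1 / √(δ / 2 * (1 / k))) ^ m.length *
            supNorm b (D'.path ε))) +
      b * (sobolevSeminorms n q (m, 0, compactIcc hδ b) (sobolevPart (D.f ε - D'.f ε)) +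
        compConst n * (matrixBound b (D.a ε - D'.a ε) * k) *
          sobolevSeminorms n q (m, 0, compactIcc hδ b) (sobolevPart (D'.f ε))) := by
  have hC := compConst_nonneg n
  have hS := smoothingConst_nonneg n m.length
  have hα0 := matrixBound_nonneg b (D.a ε - D'.a ε)
  have hS1 : 0 ≤ smoothingConst n m.length * (1 / √(δ * (1 / k))) ^ m.length := by positivity
  have hS2 : 0 ≤ smoothingConst n m.length * (1 / √(δ / 2 * (1 / k))) ^ m.length := by positivity
  have hα1 : 0 ≤ compConst n * (matrixBound b (D.a ε - D'.a ε) * k) := by positivity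
  have hα2 : 0 ≤ b / (δ / 2) * (compConst n * (matrixBound b (D.a ε - D'.a ε) * k)) := by
    positivity
  have hδ2 : 0 ≤ δ / 2 := by positivity
  have hw1 : 0 ≤ supNorm b (D.path ε - D'.path ε) := apply_nonneg _ _
  have hw2 : 0 ≤ supNorm b (D'.path ε) := apply_nonneg _ _
  have hf1 : 0 ≤ sobolevSeminorms n q (m, 0, compactIcc hδ b) (sobolevPart (D.f ε - D'.f ε)) :=
    apply_nonneg _ _
  have hf2 : 0 ≤ sobolevSeminorms n q (m, 0, compactIcc hδ b) (sobolevPart (D'.f ε)) :=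
    apply_nonneg _ _
  have hsum := add_nonneg hf1 (mul_nonneg hα1 hf2)
  refine (sobolevSeminorms_zero_le_iff (add_nonneg (add_nonneg (mul_nonneg hw1 hS1)
    (mul_nonneg hα2 (mul_nonneg hS2 hw2))) (mul_nonneg b.cast_nonneg hsum))).2 fun t ht => ?_
  have ht' := hb t ht
  have hδb : δ ≤ b := by linarith [ht'.1, ht'.2]
  have ht0 : (0 : ℝ) < t := t.2
  have hα : ∀ r ∈ Ioc δ (t : ℝ), ∀ i j, |(D.a ε).1 r i j - (D'.a ε).1 r i j| ≤
      matrixBound b (D.a ε - D'.a ε) := fun r hr =>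
    abs_entry_sub_le b ε (hδ.le.trans hr.1.le) (hr.2.trans ht'.2)
  have hν : ∀ r ∈ Ioc δ (t : ℝ), ‖weakDeriv m ((D.f ε).1 r) - weakDeriv m ((D'.f ε).1 r)‖ ≤
      sobolevSeminorms n q (m, 0, compactIcc hδ b) (sobolevPart (D.f ε - D'.f ε)) := fun r hr => by
    rw [← weakDeriv_sub_apply _ _ _ (hδ.trans hr.1)]
    exact norm_weakDeriv_le_of_mem _ m hδ ⟨hr.1.le, hr.2.trans ht'.2⟩
  have hG : ∀ r ∈ Ioc δ (t : ℝ), ‖weakDeriv m ((D'.f ε).1 r)‖ ≤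
      sobolevSeminorms n q (m, 0, compactIcc hδ b) (sobolevPart (D'.f ε)) := fun r hr =>
    norm_weakDeriv_le_of_mem _ m hδ ⟨hr.1.le, hr.2.trans ht'.2⟩
  have hδt : δ < t := by linarith [ht'.1]
  have hc : δ * (1 / k) ≤ (t - δ) * (1 / k) :=
    mul_le_mul_of_nonneg_right (by linarith [ht'.1]) he.pos.le
  have h1 := he.norm_weakDeriv_mildSolution_sub_mildSolution_le he' hα0 hδ hδt ht'.2
    (mul_pos hδ he.pos) hc hα (D.f ε).2 (D'.f ε).2 m hν hG (D.u ε) (D'.u ε)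
  have hd1 : ‖(D.path ε).1 δ - (D'.path ε).1 δ‖ ≤ supNorm b (D.path ε - D'.path ε) :=
    norm_le_supNorm (D.path ε - D'.path ε) b hδ.le hδb
  have hd2 := norm_le_supNorm (D'.path ε) b hδ.le hδb
  have htb : (t : ℝ) - δ ≤ b := by linarith [ht'.2]
  have e1 : δ * (1 / k) / 2 = δ / 2 * (1 / k) := by ring
  have e2 : ∀ x y : ℝ, compConst n * (x * y / (δ / 2 * (1 / k))) =
      x / (δ / 2) * (compConst n * (y * k)) := fun x y => by
    field_simp
  have e3 : ∀ y : ℝ, y / (1 / k) = y * k := fun y => by rw [div_div_eq_mul_div, div_one]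
  rw [e1, e2, e3] at h1
  have h2 : weakDeriv m ((D.path ε - D'.path ε).1 t) =
      weakDeriv m (mildSolution (D.a ε).1 (D.u ε) (D.f ε).1 t) -
        weakDeriv m (mildSolution (D'.a ε).1 (D'.u ε) (D'.f ε).1 t) :=
    weakDeriv_sub_apply (D.path ε) (D'.path ε) m ht0
  show ‖weakDeriv m ((D.path ε - D'.path ε).1 t)‖ ≤ _
  rw [h2]
  refine h1.trans (add_le_add (add_le_add ?_ ?_) ?_)
  · rw [mul_comm]
    exact mul_le_mul_of_nonneg_right hd1 hS1
  · exact mul_le_mul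
      (mul_le_mul_of_nonneg_right (div_le_div_of_nonneg_right htb hδ2) hα1)
      (mul_le_mul_of_nonneg_left hd2 hS2) (mul_nonneg hS2 (norm_nonneg _)) hα2
  · exact mul_le_mul_of_nonneg_right htb hsum

/-- The difference `w = u - u'` of two Duhamel paths solves
`∂_t w = 𝓛 w + (𝓛 - 𝓛') u' + (f - f')`. -/
theorem timeDeriv_path_sub (ε : NetParam) {t : ℝ} (ht : 0 < t) :
    (timeDeriv (sobolevPart (D.path ε - D'.path ε))).1 t =
      (diffusionOp (D.a ε) (sobolevPart (D.path ε - D'.path ε)) +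
        diffusionOp (D.a ε - D'.a ε) (sobolevPart (D'.path ε)) +
        sobolevPart (D.f ε - D'.f ε)).1 t := by
  rw [sobolevPart_sub, sobolevPart_sub, map_sub, map_sub, map_sub, AddMonoidHom.sub_apply]
  show (timeDeriv (sobolevPart (D.path ε))).1 t - (timeDeriv (sobolevPart (D'.path ε))).1 t = _
  rw [D.timeDeriv_path ε ht, D'.timeDeriv_path ε ht]
  show (diffusionOp (D.a ε) (sobolevPart (D.path ε))).1 t + (D.f ε).1 t -
    ((diffusionOp (D'.a ε) (sobolevPart (D'.path ε))).1 t + (D'.f ε).1 t) =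
    ((diffusionOp (D.a ε) (sobolevPart (D.path ε))).1 t -
      (diffusionOp (D.a ε) (sobolevPart (D'.path ε))).1 t) +
    ((diffusionOp (D.a ε) (sobolevPart (D'.path ε))).1 t -
      (diffusionOp (D'.a ε) (sobolevPart (D'.path ε))).1 t) + ((D.f ε).1 t - (D'.f ε).1 t)
  abel

namespace Equivalent

theorem isNegligible_matrixBound_mul (h : D.Equivalent D') {K : NetParam → ℝ}
    (hK : ς.IsModerate K) (b : ℕ) :
    ς.IsNegligible fun ε => compConst n * (matrixBound b (D.a ε - D'.a ε) * K ε) :=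
  ((isNegligible_matrixBound h.a b).mul hK).const_mul _

theorem isNegligible_f (h : D.Equivalent D') (i) :
    ς.IsNegligible fun ε => solutionSeminorms n q i (D.f ε - D'.f ε) := h.f i

theorem isNegligible_supNorm (h : D.Equivalent D') (b : ℕ) :
    ς.IsNegligible fun ε => supNorm b (D.path ε - D'.path ε) := by
  obtain ⟨k, hk, hk0, he, he'⟩ := exists_isElliptic_both D D' b
  have hu : ς.IsNegligible fun ε => ‖D.u ε - D'.u ε‖ := h.u ()
  have hαk := h.isNegligible_matrixBound_mul hk b
  exact ((hu.add (hαk.mul D'.isModerate_norm_u)).add (((h.isNegligible_f (Sum.inr b)).add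
    (hαk.mul (D'.isModerate_f (Sum.inr b)))).const_mul b)).mono (fun ε => apply_nonneg _ _)
    fun ε => supNorm_path_sub_le (hk0 ε) b ε (he ε) (he' ε)

theorem isNegligible_sobolevSeminorms_zero (h : D.Equivalent D') (m : List (Fin n))
    (K : Compacts (Ioi (0 : ℝ))) :
    ς.IsNegligible fun ε =>
      sobolevSeminorms n q (m, 0, K) (sobolevPart (D.path ε - D'.path ε)) := by
  obtain ⟨δ, b, hδ, hb⟩ := exists_Icc_of_compacts K
  obtain ⟨k, hk, hk0, he, he'⟩ := exists_isElliptic_both D D' b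
  have hαk := h.isNegligible_matrixBound_mul hk b
  have h1 := (h.isNegligible_supNorm b).mul
    ((isModerate_inv_sqrt hk hk0 δ hδ m.length).const_mul (smoothingConst n m.length))
  have h2 := (hαk.const_mul (b / (δ / 2))).mul
    (((isModerate_inv_sqrt hk hk0 (δ / 2) (half_pos hδ) m.length).const_mul
      (smoothingConst n m.length)).mul (D'.isModerate_supNorm b))
  have h3 := ((h.isNegligible_f (Sum.inl (m, 0, compactIcc hδ b))).add
    (hαk.mul (D'.isModerate_f (Sum.inl (m, 0, compactIcc hδ b))))).const_mul b
  exact ((h1.add h2).add h3).mono (fun ε => apply_nonneg _ _) fun ε =>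
    sobolevSeminorms_zero_path_sub_le (hk0 ε) hδ b ε (he ε) (he' ε) m hb

/-- Time derivatives are traded for spatial ones by the equation of the difference of the paths. -/
theorem isNegligible_sobolevSeminorms (h : D.Equivalent D') (j : ℕ) (m : List (Fin n))
    (K : Compacts (Ioi (0 : ℝ))) :
    ς.IsNegligible fun ε =>
      sobolevSeminorms n q (m, j, K) (sobolevPart (D.path ε - D'.path ε)) := by
  induction j using Nat.strong_induction_on generalizing m K with
  | _ j ih =>
    rcases j with _ | j
    · exact h.isNegligible_sobolevSeminorms_zero m K
    · have h1 : ς.IsNegligible fun ε => ∑ i : Fin n, ∑ l : Fin n,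
          ∑ c ∈ Finset.range (j + 1), (j.choose c : ℝ) *
            (sobolevSeminorms n q (m ++ [i, l], j - c, K)
              (sobolevPart (D.path ε - D'.path ε)) *
              matrixSeminorms n ((i, l), Sum.inl (c, K)) (D.a ε)) :=
        IsNegligible.sum _ fun i _ => IsNegligible.sum _ fun l _ =>
          IsNegligible.sum _ fun c _ => IsNegligible.const_mul
            (IsNegligible.mul (ih (j - c) (by omega) _ _) (D.isDiffusivityNet.1 _)) _
      have h2 : ς.IsNegligible fun ε => ∑ i : Fin n, ∑ l : Fin n,
          ∑ c ∈ Finset.range (j + 1), (j.choose c : ℝ) *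
            (matrixSeminorms n ((i, l), Sum.inl (c, K)) (D.a ε - D'.a ε) *
              sobolevSeminorms n q (m ++ [i, l], j - c, K) (sobolevPart (D'.path ε))) :=
        IsNegligible.sum _ fun i _ => IsNegligible.sum _ fun l _ =>
          IsNegligible.sum _ fun c _ => IsNegligible.const_mul
            (IsNegligible.mul (h.a _) (D'.isModerate_sobolevSeminorms _ _ _)) _
      refine ((h1.add h2).add (h.isNegligible_f (Sum.inl (m, j, K)))).mono
        (fun ε => apply_nonneg _ _) fun ε => ?_
      refine (sobolevSeminorms_succ_le _ m j K).trans ?_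
      rw [sobolevSeminorms_congr fun t ht => timeDeriv_path_sub ε ht]
      refine (map_add_le_add _ _ _).trans (add_le_add ((map_add_le_add _ _ _).trans (add_le_add
        ((sobolevSeminorms_diffusionOp_le _ _ m j K).trans_eq ?_)
        (sobolevSeminorms_diffusionOp_le _ _ m j K))) le_rfl)
      refine Finset.sum_congr rfl fun i _ => Finset.sum_congr rfl fun l _ =>
        Finset.sum_congr rfl fun c _ => ?_
      rw [mul_comm (matrixSeminorms n _ _)]

/-- Equivalent data have equivalent Duhamel nets. -/
theorem path_sub_mem_negligibleNets (h : D.Equivalent D') :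
    D.path - D'.path ∈ negligibleNets ς (solutionSeminorms n q) := by
  rintro (⟨m, j, K⟩ | b)
  · exact h.isNegligible_sobolevSeminorms j m K
  · exact h.isNegligible_supNorm b

end Equivalent

end CauchyNet

end Nets

/-! ### Representatives -/

section Representatives

variable {Υ : Type*} [PartialOrder Υ] [IsDirectedOrder Υ] [Nonempty Υ] {ς : AsymptoticScale Υ}
variable {𝕜 : Type*} [RCLike 𝕜]
variable {X : Type*} [AddCommGroup X] [Module 𝕜 X] {ι : Type*} {p : SeminormFamily 𝕜 X ι}

theorem Represents.sub_mem {h h' : NetParam → X} {x : Colombeau ς p} (hx : Represents h x)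
    (hx' : Represents h' x) : h - h' ∈ negligibleNets ς p := by
  obtain ⟨hm, rfl⟩ := hx
  obtain ⟨hm', he⟩ := hx'
  exact (Submodule.Quotient.eq
    ((negligibleNets ς p).comap (moderateNets ς p).subtype)).1 he.symm

theorem Represents.congr {h h' : NetParam → X} {x : Colombeau ς p} (hx : Represents h x)
    (hm' : h' ∈ moderateNets ς p) (hn : h' - h ∈ negligibleNets ς p) : Represents h' x := by
  obtain ⟨hm, rfl⟩ := hx
  exact ⟨hm', (Submodule.Quotient.eq _).2 hn⟩

theorem exists_represents (x : Colombeau ς p) : ∃ h : NetParam → X, Represents h x := by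
  obtain ⟨⟨h, hm⟩, rfl⟩ := Submodule.Quotient.mk_surjective _ x
  exact ⟨h, hm, rfl⟩

end Representatives

/-! ### Positive parts -/

section PositivePart

variable {n : ℕ} {q : ℝ≥0∞}

theorem lipschitzWith_re_max : LipschitzWith 1 fun z : ℂ => ((max z.re 0 : ℝ) : ℂ) := by
  refine LipschitzWith.of_dist_le_mul fun z w => ?_
  rw [dist_eq_norm, dist_eq_norm, ← Complex.ofReal_sub, Complex.norm_real, NNReal.coe_one, one_mul]
  refine (abs_max_sub_max_le_abs _ _ _).trans ?_
  rw [← Complex.sub_re]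
  exact Complex.abs_re_le_norm _

/-- The function `x ↦ max (Re v(x)) 0`, the positive part of the real part of `v`. -/
def rePosPart (v : LqSpace n q) : LqSpace n q := lipschitzWith_re_max.compLp (by simp) v

theorem coeFn_rePosPart (v : LqSpace n q) :
    rePosPart v =ᵐ[volume] fun x => ((max (v x).re 0 : ℝ) : ℂ) :=
  lipschitzWith_re_max.coeFn_compLp (by simp) v

theorem rePosPart_mem_nonnegLq (v : LqSpace n q) : rePosPart v ∈ nonnegLq n q := by
  filter_upwards [coeFn_rePosPart v] with x hx
  rw [hx]
  simp

theorem rePosPart_eq_self {v : LqSpace n q} (hv : v ∈ nonnegLq n q) : rePosPart v = v := by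
  refine Lp.ext ?_
  filter_upwards [coeFn_rePosPart v, hv] with x h1 h2
  rw [h1, max_eq_left h2.1]
  exact Complex.ext (by simp) (by simp [h2.2])

theorem rePosPart_mem_initialData {v : LqSpace n q} (hv : v ∈ initialData n q) :
    rePosPart v ∈ initialData n q := by
  intro hq
  obtain ⟨g, hg, hvg⟩ := hv hq
  refine ⟨fun x => ((max (g x).re 0 : ℝ) : ℂ),
    lipschitzWith_re_max.uniformContinuous.comp hg, ?_⟩
  filter_upwards [coeFn_rePosPart v, hvg] with x h1 h2
  rw [h1, h2]

theorem norm_rePosPart_le (v : LqSpace n q) : ‖rePosPart v‖ ≤ ‖v‖ := by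
  simpa [rePosPart] using lipschitzWith_re_max.norm_compLp_le (by simp) v

/-- `rePosPart` is Lipschitz and fixes `w`, so `v` is nearly fixed if it is close to `w ≥ 0`. -/
theorem norm_rePosPart_sub_le {v w : LqSpace n q} [Fact (1 ≤ q)] (hw : w ∈ nonnegLq n q) :
    ‖rePosPart v - v‖ ≤ 2 * ‖v - w‖ := by
  have h1 : ‖rePosPart v - rePosPart w‖ ≤ ‖v - w‖ := by
    simpa [rePosPart] using lipschitzWith_re_max.norm_compLp_sub_le (by simp) v w
  rw [rePosPart_eq_self hw] at h1
  have h2 : rePosPart v - v = (rePosPart v - w) - (v - w) := by abel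
  rw [h2]
  linarith [norm_sub_le (rePosPart v - w) (v - w)]

end PositivePart

/-! ### The very weak Cauchy problem -/

section CauchyProblem

open AsymptoticScale

variable {n : ℕ} {q : ℝ≥0∞} [Fact (1 ≤ q)]
variable {Υ : Type*} [PartialOrder Υ] [IsDirectedOrder Υ] [Nonempty Υ] {ς : AsymptoticScale Υ}
variable {a : GenMatrix ς n} {u₀ : GenLq ς n q} {f u : GenSolution ς n q}

theorem solutionSeminorms_eq_zero {w : solutionSpace n q} (hw : ∀ t, 0 ≤ t → w.1 t = 0) (i) :
    solutionSeminorms n q i w = 0 := by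
  rcases i with i | b
  · exact sobolevSeminorms_eq_zero (u := sobolevPart w) (fun t ht => hw t ht.le) i
  · exact le_antisymm (supNorm_le le_rfl fun t ht => by rw [hw t ht.1, norm_zero])
      (apply_nonneg _ _)

namespace CauchyNet

/-- The net `D` of data represents the generalised data `a`, `u₀`, `f`. -/
structure IsDataFor (D : CauchyNet ς n q) (a : GenMatrix ς n) (u₀ : GenLq ς n q)
    (f : GenSolution ς n q) : Prop where
  a : Represents D.a a
  u : Represents D.u u₀
  f : Represents D.f f

theorem exists_isDataFor (ha : IsDiffusivity ς n a) (hu₀ : Colombeau.IsIn (initialData n q) u₀)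
    (f : GenSolution ς n q) : ∃ D : CauchyNet ς n q, D.IsDataFor a u₀ f := by
  obtain ⟨aN, haN, har⟩ := ha
  obtain ⟨uN, huN, hur⟩ := hu₀
  obtain ⟨fN, hfr⟩ := exists_represents f
  exact ⟨⟨aN, uN, fN, haN, hur.1, huN, hfr.1⟩, har, hur, hfr⟩

variable {D D' : CauchyNet ς n q}

theorem IsDataFor.equivalent (h : D.IsDataFor a u₀ f) (h' : D'.IsDataFor a u₀ f) :
    D.Equivalent D' := ⟨h.a.sub_mem h'.a, h.u.sub_mem h'.u, h.f.sub_mem h'.f⟩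

/-- The class of one Duhamel net satisfies the Duhamel formula for all representatives of the data,
because equivalent data have equivalent Duhamel nets. -/
theorem IsDataFor.isDuhamel (h : D.IsDataFor a u₀ f) (hu : Represents D.path u) :
    IsDuhamel a u₀ f u := by
  intro aN uN fN haN har huN hur hfr
  let D' : CauchyNet ς n q := ⟨aN, uN, fN, haN, hur.1, huN, hfr.1⟩
  have h' : D'.IsDataFor a u₀ f := ⟨har, hur, hfr⟩
  exact ⟨D'.path, hu.congr D'.path_mem_moderateNets
    (h'.equivalent h).path_sub_mem_negligibleNets, fun ε t ht => D'.path_apply ε ht⟩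

/-- The Duhamel formula determines the class: it prescribes the paths on `[0, ∞)`, and the seminorms
only depend on these values. -/
theorem IsDataFor.represents_path (h : D.IsDataFor a u₀ f) (hu : IsDuhamel a u₀ f u) :
    Represents D.path u := by
  obtain ⟨uN, huN, he⟩ := hu D.a D.u D.f D.isDiffusivityNet h.a D.mem_initialData h.u h.f
  refine huN.congr D.path_mem_moderateNets fun i ℓ => ?_
  have h0 : ∀ ε, solutionSeminorms n q i ((D.path - uN) ε) = 0 := fun ε =>
    solutionSeminorms_eq_zero (fun t ht => by
      show (D.path ε).1 t - (uN ε).1 t = 0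
      rw [D.path_apply ε ht, he ε t ht, sub_self]) i
  simp only [h0]
  exact isLittleO_zero _ _

theorem IsDataFor.timeDeriv_sub_diffusion (h : D.IsDataFor a u₀ f) (hu : Represents D.path u) :
    u.toSobolev.timeDeriv - GenSobolev.diffusion a u.toSobolev = f.toSobolev := by
  obtain ⟨ham, rfl⟩ := h.a
  obtain ⟨hfm, rfl⟩ := h.f
  obtain ⟨hum, rfl⟩ := hu
  refine (Submodule.Quotient.eq _).2 fun i ℓ => ?_
  have h0 : ∀ ε, sobolevSeminorms n q i (timeDeriv (sobolevPart (D.path ε)) -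
      diffusionOp (D.a ε) (sobolevPart (D.path ε)) - sobolevPart (D.f ε)) = 0 := fun ε =>
    sobolevSeminorms_eq_zero (fun t ht => by
      show (timeDeriv (sobolevPart (D.path ε))).1 t -
        (diffusionOp (D.a ε) (sobolevPart (D.path ε))).1 t - (sobolevPart (D.f ε)).1 t = 0
      rw [D.timeDeriv_path ε ht, sub_sub]
      exact sub_self _) i
  exact (isLittleO_zero _ _).congr_left fun ε => (h0 ε).symm

theorem IsDataFor.atZero_eq (h : D.IsDataFor a u₀ f) (hu : Represents D.path u) :
    u.atZero = u₀ := by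
  obtain ⟨hum, rfl⟩ := hu
  obtain ⟨hu₀m, rfl⟩ := h.u
  refine (Submodule.Quotient.eq _).2 fun i ℓ => ?_
  have h0 : ∀ ε, ‖(D.path ε).1 0 - D.u ε‖ = 0 := fun ε => by
    rw [D.path_zero, sub_self, norm_zero]
  exact (isLittleO_zero _ _).congr_left fun ε => (h0 ε).symm

theorem path_mem_nonnegPaths (D : CauchyNet ς n q) {ε : NetParam} (hu : D.u ε ∈ nonnegLq n q)
    (hf : D.f ε ∈ nonnegPaths n q) : D.path ε ∈ nonnegPaths n q := by
  intro t ht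
  obtain ⟨κ, hκ⟩ := D.isLocallyElliptic ε t
  exact add_mem_nonnegLq (heatSemigroup_nonneg _ hu) (intervalIntegral_mem_nonnegLq ht
    (fun s hs => heatSemigroup_nonneg _ (hf s hs.1.le))
    (hκ.intervalIntegrable_source (D.f ε).2.1 (D.f ε).2.2 le_rfl ht le_rfl))

/-- Non-negative generalised data have representatives that are non-negative and admissible. For
`q = ∞` a uniformly continuous representative and a non-negative one of `u₀` may be different nets;
the positive part of the real part of the former has both properties and the same class. -/
theorem exists_isDataFor_nonneg (ha : IsDiffusivity ς n a)
    (hu₀ : Colombeau.IsIn (initialData n q) u₀) (hu₀' : u₀.IsIn (nonnegLq n q))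
    (hf : f.IsIn (nonnegPaths n q)) : ∃ D : CauchyNet ς n q, D.IsDataFor a u₀ f ∧
      ∀ ε, D.u ε ∈ nonnegLq n q ∧ D.f ε ∈ nonnegPaths n q := by
  obtain ⟨aN, haN, har⟩ := ha
  obtain ⟨uN, huN, hur⟩ := hu₀
  obtain ⟨vN, hvN, hvr⟩ := hu₀'
  obtain ⟨fN, hfN, hfr⟩ := hf
  have hm : (fun ε => rePosPart (uN ε)) ∈ moderateNets ς (lqSeminorms n q) := fun i =>
    IsModerate.mono (hur.1 i) (fun ε => apply_nonneg _ _) fun ε => norm_rePosPart_le (uN ε)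
  have hn : (fun ε => rePosPart (uN ε)) - uN ∈ negligibleNets ς (lqSeminorms n q) := fun i =>
    IsNegligible.mono (IsNegligible.const_mul (hur.sub_mem hvr i) 2) (fun ε => apply_nonneg _ _)
      fun ε => norm_rePosPart_sub_le (hvN ε)
  exact ⟨⟨aN, fun ε => rePosPart (uN ε), fN, haN, hm,
    fun ε => rePosPart_mem_initialData (huN ε), hfr.1⟩, ⟨har, hur.congr hm hn, hfr⟩,
    fun ε => ⟨rePosPart_mem_nonnegLq _, hfN ε⟩⟩

end CauchyNet

end CauchyProblem

end

theorem mainTheorem2 {Υ : Type*} [PartialOrder Υ] [IsDirectedOrder Υ] [Nonempty Υ]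
    (ς : AsymptoticScale Υ) (n : ℕ) (q : ℝ≥0∞) [Fact (1 ≤ q)]
    (a : GenMatrix ς n) (ha : IsDiffusivity ς n a)
    (u₀ : GenLq ς n q) (hu₀ : Colombeau.IsIn (initialData n q) u₀)
    (f : GenSolution ς n q) :
    (∃! u : GenSolution ς n q, IsDuhamel a u₀ f u) ∧
    ∀ u : GenSolution ς n q, IsDuhamel a u₀ f u →
      u.toSobolev.timeDeriv - GenSobolev.diffusion a u.toSobolev = f.toSobolev ∧
      u.atZero = u₀ ∧
      (u₀.IsIn (nonnegLq n q) → f.IsIn (nonnegPaths n q) → u.IsIn (nonnegPaths n q)) := by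
  obtain ⟨D, hD⟩ := CauchyNet.exists_isDataFor ha hu₀ f
  refine ⟨⟨Submodule.Quotient.mk ⟨D.path, D.path_mem_moderateNets⟩,
    hD.isDuhamel ⟨D.path_mem_moderateNets, rfl⟩, fun v hv => ?_⟩, fun u hu => ?_⟩
  · obtain ⟨_, hv'⟩ := hD.represents_path hv
    exact hv'.symm
  · have hr := hD.represents_path hu
    refine ⟨hD.timeDeriv_sub_diffusion hr, hD.atZero_eq hr, fun hu₀' hf => ?_⟩
    obtain ⟨D', hD', hpos⟩ := CauchyNet.exists_isDataFor_nonneg ha hu₀ hu₀' hf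
    exact ⟨D'.path, fun ε => D'.path_mem_nonnegPaths (hpos ε).1 (hpos ε).2,
      hD'.represents_path hu⟩
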